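/- Let $\Omega\subset\mathbb R^3$ be a bounded domain with a Liapunov (i.e. $C^{1,\gamma}$ for some $0<\gamma\le 1$) boundary, let $1<p<\infty$, let $\omega,\varepsilon,\mu,\beta\in\mathbb C$ with $\omega,\varepsilon,\mu\ne 0$, fix square roots $\sqrt\varepsilon,\sqrt\mu$, put $\lambda=\omega\sqrt\varepsilon\sqrt\mu$, and assume $1\pm\lambda\beta\neq 0$. Put $\alpha_1=\lambda/(1+\lambda\beta)$ and $\alpha_2=\lambda/(1-\lambda\beta)$. Let $\vec j\in W^{p,\operatorname{div}}(\Omega)=\{\vec j\in L^p(\Omega;\mathbb C^3):\operatorname{div}\vec j\in L^p(\Omega)\}$ and $\rho=\frac1{i\omega}\operatorname{div}\vec j$. For $\alpha\in\mathbb C$ let $$L_\alpha[\vec j](x)=-\int_\Omega\frac{e^{i\alpha|x-y|}}{4\pi|x-y|}\,\vec j(y)\,dy .$$ A force-free field in $\Omega$ for the wave number $\kappa$ is a $C^1$ field $\vec u:\Omega\to\mathbb C^3$ with $\operatorname{div}\vec u=0$ and $\operatorname{curl}\vec u+\kappa\vec u=0$ in $\Omega$. Then, for $\alpha\in\{\alpha_1,\alpha_2\}$,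 the weak derivatives $\operatorname{curl}L_\alpha[\vec j]$ and $\operatorname{curl}\operatorname{curl}L_\alpha[\vec j]$ exist in $\Omega$ and belong to $L^p(\Omega)$, and the general weak solution of the chiral time-harmonic Maxwell system $$\operatorname{curl}\vec E=i\omega\mu(\vec H+\beta\operatorname{curl}\vec H),\quad \operatorname{curl}\vec H=-i\omega\varepsilon(\vec E+\beta\operatorname{curl}\vec E)+\vec j,\quad \operatorname{div}\vec E=\frac{\rho}{\varepsilon},\quad \operatorname{div}\vec H=0$$ in $\Omega$ is $$\vec E=-\frac{i}{2\omega\varepsilon}\Big(2\vec j-\alpha_1\operatorname{curl}L_{\alpha_1}[\vec j]+\alpha_2\operatorname{curl}L_{\alpha_2}[\vec j]+\operatorname{curl}\operatorname{curl}(L_{\alpha_1}+L_{\alpha_2})[\vec j]\Big)-\sqrt\mu\,(\vec u_{\alpha_1}+\vec u_{-\alpha_2}),$$ $$\vec H=-\frac1{2\lambda}\Big(\alpha_1\operatorname{curl}L_{\alpha_1}[\vec j]+\alpha_2\operatorname{curl}L_{\alpha_2}[\vec j]-\operatorname{curl}\operatorname{curl}(L_{\alpha_1}-L_{\alpha_2})[\vec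 j]\Big)+\frac{\sqrt\varepsilon}{i}(\vec u_{\alpha_1}-\vec u_{-\alpha_2})$$ (almost everywhere in $\Omega$), where $\vec u_{\alpha_1}$ and $\vec u_{-\alpha_2}$ are arbitrary force-free fields in $\Omega$ for the wave numbers $\alpha_1$ and $-\alpha_2$. That is: (a) a pair $(\vec E,\vec H)$ is a weak solution of class $L^p(\Omega)$, tested against all $v\in W^{1,q}_0(\Omega)$, $\frac1p+\frac1q=1$, if and only if it has this form with force-free fields that are moreover in $L^p(\Omega)$; (b) a pair $(\vec E,\vec H)$ is a locally integrable solution in the sense of distributions in $\Omega$ if and only if it has this form with arbitrary force-free fields. -/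

import Mathlib

open MeasureTheory Filter Topology

noncomputable section

namespace ChiralMaxwell

/-- Points of three-dimensional Euclidean space. -/
abbrev E3 : Type := EuclideanSpace ℝ (Fin 3)

/-- Values of complex vector fields. -/
abbrev C3 : Type := Fin 3 → ℂ

/-- A bounded domain (open, connected, nonempty) with a Liapunov boundary: for some `0 < γ ≤ 1`,
near each boundary point the domain is, in suitable Cartesian coordinates, the part of space
above the graph of a `C^{1,γ}` function. -/
def IsBoundedLiapunovDomain (Ω : Set E3) : Prop :=
  IsOpen Ω ∧ IsConnected Ω ∧ Bornology.IsBounded Ω ∧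
    ∃ γ : NNReal, 0 < γ ∧ γ ≤ 1 ∧
      ∀ x₀ ∈ frontier Ω, ∃ (e : E3 ≃ₗᵢ[ℝ] E3) (f : EuclideanSpace ℝ (Fin 2) → ℝ)
        (C : NNReal) (r : ℝ),
        ContDiff ℝ 1 f ∧ HolderWith C γ (fderiv ℝ f) ∧ 0 < r ∧
          ∀ x ∈ Metric.ball x₀ r, (x ∈ Ω ↔ f !₂[e x 0, e x 1] < e x 2)

/-- The classical partial derivative `∂ᵢ f`. -/
def pd (i : Fin 3) (f : E3 → ℂ) (x : E3) : ℂ :=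
  fderiv ℝ f x (EuclideanSpace.single i 1)

/-- The classical gradient. -/
def grad (f : E3 → ℂ) (x : E3) : C3 := fun i => pd i f x

/-- The classical divergence. -/
def divergence (u : E3 → C3) (x : E3) : ℂ := ∑ i, pd i (fun y => u y i) x

/-- The classical curl. -/
def curl (u : E3 → C3) (x : E3) : C3 :=
  ![pd 1 (fun y => u y 2) x - pd 2 (fun y => u y 1) x,
    pd 2 (fun y => u y 0) x - pd 0 (fun y => u y 2) x,
    pd 0 (fun y => u y 1) x - pd 1 (fun y => u y 0) x]

/-- Force-free fields in `Ω` for the wave number `κ`: purely vectorial `C¹` solutions of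
`(D + κ) u = 0`, where `D` is the Moisil-Teodorescu operator, that is
`Sc (D u) = - div u` and `Vec (D u) = curl u` for a vector field `u`. -/
def IsForceFree (Ω : Set E3) (κ : ℂ) (u : E3 → C3) : Prop :=
  ContDiffOn ℝ 1 u Ω ∧ ∀ x ∈ Ω, divergence u x = 0 ∧ curl u x + κ • u x = 0

/-- `φ ∈ C_c^∞(Ω)`. -/
def IsTest (Ω : Set E3) (φ : E3 → ℂ) : Prop :=
  ContDiff ℝ (⊤ : ℕ∞) φ ∧ HasCompactSupport φ ∧ tsupport φ ⊆ Ω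

/-- Test functions of class `C_c^∞(Ω)`, each paired with its gradient. -/
def smoothTests (Ω : Set E3) : Set ((E3 → ℂ) × (E3 → C3)) :=
  {t | IsTest Ω t.1 ∧ t.2 = grad t.1}

/-- The Sobolev space `W_0^{1,q}(Ω)`, the closure of `C_c^∞(Ω)` in the `W^{1,q}`-norm:
each element is paired with its weak gradient. -/
def sobolevTests (Ω : Set E3) (q : ℝ) : Set ((E3 → ℂ) × (E3 → C3)) :=
  {t | MemLp t.1 (ENNReal.ofReal q) (volume.restrict Ω) ∧
    MemLp t.2 (ENNReal.ofReal q) (volume.restrict Ω) ∧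
    ∃ φ : ℕ → E3 → ℂ, (∀ n, IsTest Ω (φ n)) ∧
      Tendsto (fun n => eLpNorm (φ n - t.1) (ENNReal.ofReal q) (volume.restrict Ω))
        atTop (𝓝 0) ∧
      Tendsto (fun n => eLpNorm (grad (φ n) - t.2) (ENNReal.ofReal q) (volume.restrict Ω))
        atTop (𝓝 0)}

/-- `d` is the weak divergence of `F` in `Ω`. -/
def IsWeakDiv (Ω : Set E3) (F : E3 → C3) (d : E3 → ℂ) : Prop :=
  LocallyIntegrableOn F Ω ∧ LocallyIntegrableOn d Ω ∧
    ∀ φ, IsTest Ω φ → ∫ x in Ω, φ x * d x = -∫ x in Ω, dotProduct (grad φ x) (F x)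

/-- `G` is the weak curl of `F` in `Ω`. -/
def IsWeakCurl (Ω : Set E3) (F G : E3 → C3) : Prop :=
  LocallyIntegrableOn F Ω ∧ LocallyIntegrableOn G Ω ∧
    ∀ φ, IsTest Ω φ → ∫ x in Ω, φ x • G x = -∫ x in Ω, crossProduct (grad φ x) (F x)

/-- Complex-valued scalar or vector functions of class `L^p(Ω)`. -/
def MemLpOn {V : Type} [NormedAddCommGroup V] (Ω : Set E3) (p : ℝ) (F : E3 → V) : Prop :=
  MemLp F (ENNReal.ofReal p) (volume.restrict Ω)

/-- `F ∈ W^{p,div}(Ω)`: both `F` and its weak divergence are of class `L^p(Ω)`. -/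
def MemWDiv (Ω : Set E3) (p : ℝ) (F : E3 → C3) : Prop :=
  MemLpOn Ω p F ∧ ∃ d : E3 → ℂ, MemLpOn Ω p d ∧ IsWeakDiv Ω F d

/-- The fundamental solution `θ(x) = - exp(iα|x|) / (4π|x|)` of `Δ + α²`. -/
def theta (α : ℂ) (x : E3) : ℂ :=
  -Complex.exp (Complex.I * α * (‖x‖ : ℂ)) / (4 * (Real.pi : ℂ) * (‖x‖ : ℂ))

/-- The Helmholtz Newton potential `L_α[F](x) = ∫_Ω θ(x - y) F(y) dy`. -/
def newton (Ω : Set E3) (α : ℂ) (F : E3 → C3) (x : E3) : C3 :=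
  ∫ y in Ω, theta α (x - y) • F y

/-- The chiral Maxwell system
`curl E = iωμ (H + β curl H)`, `curl H = -iωε (E + β curl E) + j`,
`div E = ρ / ε`, `div H = 0` in `Ω`, tested against all `v` (with gradient `g`) in the class `T`;
`∫ v curl F` is read as `- ∫ g × F`, and `∫ v div F` as `- ∫ g · F`. -/
def WeakChiralMaxwell (Ω : Set E3) (T : Set ((E3 → ℂ) × (E3 → C3))) (ω ε μ β : ℂ)
    (j : E3 → C3) (ρ : E3 → ℂ) (E H : E3 → C3) : Prop :=
  ∀ v g, (v, g) ∈ T →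
    (-∫ x in Ω, crossProduct (g x) (E x)) =
        (Complex.I * ω * μ) •
          ((∫ x in Ω, v x • H x) + β • (-∫ x in Ω, crossProduct (g x) (H x))) ∧
    (-∫ x in Ω, crossProduct (g x) (H x)) =
        -(Complex.I * ω * ε) •
          ((∫ x in Ω, v x • E x) + β • (-∫ x in Ω, crossProduct (g x) (E x))) +
          ∫ x in Ω, v x • j x ∧
    (-∫ x in Ω, dotProduct (g x) (E x)) = ∫ x in Ω, v x * (ρ x / ε) ∧
    (-∫ x in Ω, dotProduct (g x) (H x)) = 0

/-- Weak solutions of class `L^p(Ω)`, tested against `W_0^{1,q}(Ω)` with `1/p + 1/q = 1`. -/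
def IsLpWeakSolution (Ω : Set E3) (p : ℝ) (ω ε μ β : ℂ) (j : E3 → C3) (ρ : E3 → ℂ)
    (E H : E3 → C3) : Prop :=
  MemLpOn Ω p E ∧ MemLpOn Ω p H ∧
    WeakChiralMaxwell Ω (sobolevTests Ω (p / (p - 1))) ω ε μ β j ρ E H

/-- Locally integrable solutions in the sense of distributions in `Ω`. -/
def IsLocalWeakSolution (Ω : Set E3) (ω ε μ β : ℂ) (j : E3 → C3) (ρ : E3 → ℂ)
    (E H : E3 → C3) : Prop :=
  LocallyIntegrableOn E Ω ∧ LocallyIntegrableOn H Ω ∧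
    WeakChiralMaxwell Ω (smoothTests Ω) ω ε μ β j ρ E H

/-- `(E, H)` is given in `Ω` by the general formula, where `C₁, K₁, C₂, K₂` stand for
`curl L_{α₁}[j]`, `curl curl L_{α₁}[j]`, `curl L_{α₂}[j]`, `curl curl L_{α₂}[j]`,
`rε, rμ` for the square roots of `ε, μ`, and `k = ω rε rμ`. -/
def IsGivenBy (Ω : Set E3) (ω ε rε rμ k α₁ α₂ : ℂ) (j C₁ K₁ C₂ K₂ u₁ u₂ E H : E3 → C3) : Prop :=
  (∀ᵐ x ∂(volume.restrict Ω), E x =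
    -(Complex.I / (2 * ω * ε)) •
        ((2 : ℂ) • j x - α₁ • C₁ x + α₂ • C₂ x + (K₁ x + K₂ x))
      - rμ • (u₁ x + u₂ x)) ∧
  (∀ᵐ x ∂(volume.restrict Ω), H x =
    -(1 / (2 * k)) • (α₁ • C₁ x + α₂ • C₂ x - (K₁ x - K₂ x))
      + (rε / Complex.I) • (u₁ x - u₂ x))

end ChiralMaxwell

end

open ChiralMaxwell

noncomputable section

namespace ChiralMaxwell

/-! A linear change of unknowns diagonalizes the system. Put `A = -i/(2ωε)`, `B = 1/(2k)` with `k =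
ω√ε√μ`, and write `E = A (Q₁ + Q₂)`, `H = B (Q₁ - Q₂)`. Half the sum and half the difference of the
curl equations decouple into `curl Q₁ = -α₁ Q₁ + α₁ j` and `curl Q₂ = α₂ Q₂ - α₂ j`, while the
divergence equations become `div Q₁ = div Q₂ = div j` (`weakChiralMaxwell_iff`). Both are Beltrami
equations `curl Q = -s Q + s j`, with `s = α₁` and `s = -α₂`.

A particular solution comes from the Newton potential `W`: since `(Δ + s²) W = j`, one has `curl
curl W + j = grad div W + s² W`, whose curl is `s² curl W`; hence `V = curl curl W + j - s curl W`
solves the Beltrami equation and has the divergence of `j` (`exists_weak_curl_newton`,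
`beltrami_of_weak_curl`). Any other solution with the same divergence differs from `V` by a weak
force-free field. Its components solve the Helmholtz equation weakly, so by Weyl's lemma it agrees
almost everywhere with a classical one (`exists_isForceFree_ae_eq`). This gives (b). For (a), the
potential terms are in `L^p` and the formula can be solved for the force-free fields, so these are
in `L^p` exactly when `E` and `H` are; by Hölder and density, `C_c^∞` and `W_0^{1,q}` test the same
equations (`weakChiralMaxwell_sobolevTests_iff`).

The analytic core is the `L^p` bound for second derivatives of the potential. The Calderón-Zygmund
inequality `‖∂ᵢ∂ⱼψ‖_p ≤ C ‖Δψ‖_p` (`exists_eLpNorm_pd_pd_le`) is proved by a Bellman function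
instead of singular integrals. Let `W` now be the operator averaging over the points `± d₁ ± d₂ ±
d₃` and `D` the symmetric difference along `d₁`. A function `b(x, y) ≤ C (x^p + y^q)` that is convex
with a gain `|δx| |δy|` makes `∫ b(Wⁿu, Wⁿv)` drop at each step by at least a multiple of `∫ |D Wⁿu|
|D Wⁿv|`, which bounds the sum over `n`. As `W` is self-adjoint and commutes with `D`, the numbers
`∫ D Wⁿ(W² - 1)ψ · D Wⁿφ` telescope to `∫ D²ψ · φ`. When the steps shrink like `h`, `W² - 1` becomes
`h²` times a sum of three second derivatives, and `φ` is chosen dual to `∂ₐ²ψ`.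

To pass to the potential, the kernel `θ` is cut off to an integrable parametrix that inverts `Δ +
α²` up to a smooth remainder (`exists_parametrix`); the same parametrix yields Weyl's lemma. That
`θ` is a fundamental solution follows by regularizing `‖x‖` to `√(‖x‖² + ε²)`. -/

/-! ### The Bellman function -/

/-- A Bellman function for the bilinear embedding with exponents `p = 1 + 1 / r` and `1 + r`. -/
def bellman (p r x y : ℝ) : ℝ :=
  x ^ p + 12 / ((1 + r) * r) * y ^ (1 + r) + y * √(x ^ 2 + (y ^ r) ^ 2)

/-- The right side is the second derivative of `Y √(X² + Y^{2r})` along a line with velocity `(a,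
c)`, where `w = Y^r` and `m` is the root. Using `m² = X² + w²`, the numerator is an `a²` term, a
mixed term of size at most `2 |ac| m³`, and a nonnegative `c²` term, which is dropped. -/
lemma bellman_algebra {r X Y w m a c : ℝ} (hr : 0 < r) (hr1 : r ≤ 1) (hX : 0 < X) (hY : 0 < Y)
    (hm : 0 < m) (hm2 : m ^ 2 = X ^ 2 + w ^ 2) :
    Y * w ^ 2 / m ^ 3 * a ^ 2 - 2 * |a * c| ≤
      ((a ^ 2 * Y + 3 * a * c * X + 2 * r * (1 + r) * c ^ 2 * w ^ 2 / Y) * m ^ 2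
        - (a * X * Y + c * (X ^ 2 + (1 + r) * w ^ 2)) * (a * X + r * c * w ^ 2 / Y)) / m ^ 3 := by
  have hXm : X ≤ m := by nlinarith [sq_nonneg w]
  have hid : (a ^ 2 * Y + 3 * a * c * X + 2 * r * (1 + r) * c ^ 2 * w ^ 2 / Y) * m ^ 2
        - (a * X * Y + c * (X ^ 2 + (1 + r) * w ^ 2)) * (a * X + r * c * w ^ 2 / Y)
      = Y * w ^ 2 * a ^ 2 + 2 * (a * c) * (X * (m ^ 2 - r * w ^ 2))
        + w ^ 2 / Y * r * ((2 * r + 1) * X ^ 2 + (r + 1) * w ^ 2) * c ^ 2 := by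
    rw [hm2]; field_simp; ring
  have h1 : 0 ≤ w ^ 2 / Y * r * ((2 * r + 1) * X ^ 2 + (r + 1) * w ^ 2) * c ^ 2 := by positivity
  have h0 : 0 ≤ m ^ 2 - r * w ^ 2 := by nlinarith [sq_nonneg w, sq_nonneg X]
  have h2 : X * (m ^ 2 - r * w ^ 2) ≤ m ^ 3 := by
    calc X * (m ^ 2 - r * w ^ 2) ≤ m * m ^ 2 := by
          apply mul_le_mul hXm _ h0 hm.le
          nlinarith [sq_nonneg w]
      _ = m ^ 3 := by ring
  have h3 : -(|a * c| * m ^ 3) ≤ (a * c) * (X * (m ^ 2 - r * w ^ 2)) := by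
    have h4 : 0 ≤ X * (m ^ 2 - r * w ^ 2) := mul_nonneg hX.le h0
    nlinarith [neg_abs_le (a * c), abs_nonneg (a * c),
      mul_le_mul_of_nonneg_left h2 (abs_nonneg (a * c)),
      mul_le_mul_of_nonneg_right (neg_abs_le (a * c)) h4]
  have hm3 : 0 < m ^ 3 := by positivity
  rw [hid, le_div_iff₀ hm3]
  have : (Y * w ^ 2 / m ^ 3 * a ^ 2 - 2 * |a * c|) * m ^ 3
      = Y * w ^ 2 * a ^ 2 - 2 * (|a * c| * m ^ 3) := by field_simp
  rw [this]
  linarith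

/-- The two contributions to the coefficient of `a²` complement each other: the mixed term of the
Bellman function wins for `X ≤ w`, the power `X^p` for `w ≤ X`, where `w = Y^r`. -/
lemma bellman_coeff {p r X Y : ℝ} (hr : 0 < r) (hr1 : r ≤ 1) (hpr : r * (p - 1) = 1)
    (hX : 0 < X) (hY : 0 < Y) :
    1 / 3 * (Y / Y ^ r) ≤ p * (p - 1) * X ^ (p - 2)
      + Y * (Y ^ r) ^ 2 / (√(X ^ 2 + (Y ^ r) ^ 2)) ^ 3 := by
  set w := Y ^ r with hw
  have hw0 : 0 < w := Real.rpow_pos_of_pos hY r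
  set m := √(X ^ 2 + w ^ 2) with hm
  have hm0 : 0 < m := Real.sqrt_pos.2 (by positivity)
  have hm2 : m ^ 2 = X ^ 2 + w ^ 2 := Real.sq_sqrt (by positivity)
  have hp2 : 2 ≤ p := by nlinarith
  rcases le_total X w with h | h
  · have h1 : 0 ≤ p * (p - 1) * X ^ (p - 2) := by
      have := Real.rpow_pos_of_pos hX (p - 2)
      have : 0 ≤ p - 1 := by linarith
      positivity
    -- Here `m ≤ √2 w`; the value 1.42 exceeds `√2` and has a cube below 3.
    have h2 : m ≤ 1.42 * w := by nlinarith
    have h3 : m ^ 3 ≤ 3 * w ^ 3 := by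
      calc m ^ 3 ≤ (1.42 * w) ^ 3 := pow_le_pow_left₀ hm0.le h2 3
        _ ≤ 3 * w ^ 3 := by nlinarith [pow_pos hw0 3]
    have h4 : 1 / 3 * (Y / w) ≤ Y * w ^ 2 / m ^ 3 := by
      rw [le_div_iff₀ (by positivity)]
      calc 1 / 3 * (Y / w) * m ^ 3 ≤ 1 / 3 * (Y / w) * (3 * w ^ 3) := by gcongr
        _ = Y * w ^ 2 := by field_simp
    linarith
  · have h1 : Y / w = w ^ (p - 2) := by
      rw [hw, ← Real.rpow_mul hY.le, show r * (p - 2) = 1 - r by linarith, Real.rpow_sub hY,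
        Real.rpow_one]
    have h2 : w ^ (p - 2) ≤ X ^ (p - 2) := Real.rpow_le_rpow hw0.le h (by linarith)
    have h3 : 0 ≤ Y * w ^ 2 / m ^ 3 := by positivity
    have h4 : 0 < X ^ (p - 2) := Real.rpow_pos_of_pos hX _
    have h5 : 2 ≤ p * (p - 1) := by nlinarith
    rw [h1]
    nlinarith

/-- The function is differentiated twice. Its Hessian form dominates `(1/3) z a² + 12 c² / z -
2|ac|` with `z = Y / Y^r`, and the weight 12 in `bellman` is what makes this at least `2|ac|`, the
second derivative of the subtracted square. -/
lemma bellman_line_convex {p r x y a c : ℝ} (hr : 0 < r) (hr1 : r ≤ 1) (hpr : r * (p - 1) = 1)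
    (hx : ∀ t ∈ Set.Icc (0 : ℝ) 1, 0 < x + t * a) (hy : ∀ t ∈ Set.Icc (0 : ℝ) 1, 0 < y + t * c) :
    ConvexOn ℝ (Set.Icc (0 : ℝ) 1)
      (fun t => bellman p r (x + t * a) (y + t * c) - |a * c| * t ^ 2) := by
  set X : ℝ → ℝ := fun t => x + t * a
  set Y : ℝ → ℝ := fun t => y + t * c
  set w : ℝ → ℝ := fun t => Y t ^ r
  set m : ℝ → ℝ := fun t => √(X t ^ 2 + w t ^ 2)
  have hX : ∀ t, HasDerivAt X a t := fun t => 
    (((hasDerivAt_id t).mul_const a).const_add x).congr_deriv (one_mul a)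
  have hY : ∀ t, HasDerivAt Y c t := fun t => 
    (((hasDerivAt_id t).mul_const c).const_add y).congr_deriv (one_mul c)
  have hXp : ∀ t ∈ Set.Icc (0 : ℝ) 1, 0 < X t := hx
  have hYp : ∀ t ∈ Set.Icc (0 : ℝ) 1, 0 < Y t := hy
  have hw : ∀ t ∈ Set.Icc (0 : ℝ) 1, HasDerivAt w (r * c * w t / Y t) t := by
    intro t ht
    have := (hY t).rpow_const (p := r) (Or.inl (hYp t ht).ne')
    convert this using 1
    rw [Real.rpow_sub_one (hYp t ht).ne']
    simp only [w]; ring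
  have hwp : ∀ t ∈ Set.Icc (0 : ℝ) 1, 0 < w t := fun t ht => Real.rpow_pos_of_pos (hYp t ht) r
  have hm2 : ∀ t, m t ^ 2 = X t ^ 2 + w t ^ 2 := fun t => Real.sq_sqrt (by positivity)
  have hmp : ∀ t ∈ Set.Icc (0 : ℝ) 1, 0 < m t := fun t ht =>
    Real.sqrt_pos.2 (by have := hXp t ht; positivity)
  have hm : ∀ t ∈ Set.Icc (0 : ℝ) 1,
      HasDerivAt m ((a * X t + r * c * w t ^ 2 / Y t) / m t) t := by
    intro t ht
    have h0 := hXp t ht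
    have h1 := hYp t ht
    have h2 := hmp t ht
    have := (((hX t).pow 2).add ((hw t ht).pow 2)).sqrt (by
      have : 0 < X t ^ 2 + w t ^ 2 := by positivity
      exact this.ne')
    refine this.congr_deriv ?_
    change _ / (2 * m t) = _
    field_simp
    simp only [Nat.cast_ofNat]
    ring
  set f1 : ℝ → ℝ := fun t => p * X t ^ (p - 1) * a + 12 / r * c * w t
    + (a * X t * Y t + c * (X t ^ 2 + (1 + r) * w t ^ 2)) / m t - 2 * |a * c| * t
  set f2 : ℝ → ℝ := fun t => p * (p - 1) * X t ^ (p - 2) * a ^ 2 + 12 * c ^ 2 * (w t / Y t)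
    + ((a ^ 2 * Y t + 3 * a * c * X t + 2 * r * (1 + r) * c ^ 2 * w t ^ 2 / Y t) * m t ^ 2
        - (a * X t * Y t + c * (X t ^ 2 + (1 + r) * w t ^ 2)) *
          (a * X t + r * c * w t ^ 2 / Y t)) / m t ^ 3 - 2 * |a * c|
  have hf : ∀ t ∈ Set.Icc (0 : ℝ) 1, HasDerivAt
      (fun t => bellman p r (x + t * a) (y + t * c) - |a * c| * t ^ 2) (f1 t) t := by
    intro t ht
    have h0 := hXp t ht
    have h1 := hYp t ht
    have h2 := hmp t ht
    have hd := ((((hX t).rpow_const (p := p) (Or.inl h0.ne')).add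
      (((hY t).rpow_const (p := 1 + r) (Or.inl h1.ne')).const_mul (12 / ((1 + r) * r)))).add
      ((hY t).mul (hm t ht))).sub (((hasDerivAt_id t).pow 2).const_mul |a * c|)
    refine hd.congr_deriv ?_
    simp only [f1, id, add_sub_cancel_left]
    change _ + 12 / ((1 + r) * r) * (c * (1 + r) * w t) + _ - _ = _
    have h3 := hm2 t
    have h4 : c * m t = c * m t ^ 2 / m t := by field_simp
    rw [h4, h3]
    have h5 : (12 : ℝ) / ((1 + r) * r) * (c * (1 + r) * w t) = 12 / r * c * w t := by
      have : 1 + r ≠ 0 := by positivity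
      field_simp
    rw [h5]
    simp only [Nat.cast_ofNat, Nat.reduceSub, pow_one, mul_one]
    field_simp
    ring
  have hf' : ∀ t ∈ Set.Icc (0 : ℝ) 1, HasDerivAt f1 (f2 t) t := by
    intro t ht
    have h0 := hXp t ht
    have h1 := hYp t ht
    have h2 := hmp t ht
    have hd := (((((hX t).rpow_const (p := p - 1) (Or.inl h0.ne')).const_mul p).mul_const a).add
      ((hw t ht).const_mul (12 / r * c))).add
      (((((hX t).const_mul a).mul (hY t)).add
        ((((hX t).pow 2).add (((hw t ht).pow 2).const_mul (1 + r))).const_mul c)).div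
          (hm t ht) h2.ne')
    have hd' := hd.sub ((hasDerivAt_id t).const_mul (2 * |a * c|))
    refine hd'.congr_deriv ?_
    have e : p - 1 - 1 = p - 2 := by ring
    simp only [f2, e, Pi.mul_apply, Pi.add_apply, Pi.pow_apply]
    field_simp
    simp
    ring
  refine convexOn_of_hasDerivWithinAt2_nonneg (convex_Icc 0 1)
    (fun t ht => (hf t ht).continuousAt.continuousWithinAt)
    (fun t ht => (hf t (interior_subset ht)).hasDerivWithinAt)
    (fun t ht => (hf' t (interior_subset ht)).hasDerivWithinAt) ?_
  intro t ht
  have ht := interior_subset ht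
  have h1 := bellman_algebra (a := a) (c := c) hr hr1 (hXp t ht) (hYp t ht) (hmp t ht) (hm2 t)
  have h2 := bellman_coeff hr hr1 hpr (hXp t ht) (hYp t ht)
  change 1 / 3 * (Y t / w t) ≤ p * (p - 1) * X t ^ (p - 2) + Y t * w t ^ 2 / m t ^ 3 at h2
  have h3 := mul_le_mul_of_nonneg_right h2 (sq_nonneg a)
  set z := Y t / w t with hz
  have hz0 : 0 < z := div_pos (hYp t ht) (hwp t ht)
  have hz1 : w t / Y t = z⁻¹ := by rw [hz, inv_div]
  -- The arithmetic-geometric mean inequality, with `2 √(12/3) = 4`. Of the four copies of `|ac|`,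
  -- two absorb the mixed term and two absorb `|ac| t²`.
  have h4 : 4 * |a * c| ≤ 1 / 3 * z * a ^ 2 + 12 * c ^ 2 * z⁻¹ := by
    rw [abs_mul, ← sq_abs a, ← sq_abs c]
    have : 1 / 3 * z * |a| ^ 2 + 12 * |c| ^ 2 * z⁻¹ - 4 * (|a| * |c|)
        = z / 3 * (|a| - 6 * |c| * z⁻¹) ^ 2 := by field_simp; ring
    nlinarith [mul_nonneg (div_nonneg hz0.le (by norm_num : (0:ℝ) ≤ 3))
      (sq_nonneg (|a| - 6 * |c| * z⁻¹))]
  simp only [f2, hz1]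
  linarith

lemma bellman_midpoint_of_pos {p r x₁ y₁ x₂ y₂ : ℝ} (hr : 0 < r) (hr1 : r ≤ 1)
    (hpr : r * (p - 1) = 1) (hx₁ : 0 < x₁) (hy₁ : 0 < y₁) (hx₂ : 0 < x₂) (hy₂ : 0 < y₂) :
    bellman p r ((x₁ + x₂) / 2) ((y₁ + y₂) / 2) + |x₁ - x₂| * |y₁ - y₂| / 4 ≤
      (bellman p r x₁ y₁ + bellman p r x₂ y₂) / 2 := by
  have pos : ∀ {u v : ℝ}, 0 < u → 0 < v → ∀ t ∈ Set.Icc (0 : ℝ) 1, 0 < u + t * (v - u) := by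
    intro u v hu hv t ht
    have : u + t * (v - u) = (1 - t) * u + t * v := by ring
    rw [this]
    rcases ht.1.eq_or_lt with h | h
    · subst h; simpa using hu
    · have : 0 ≤ (1 - t) * u := mul_nonneg (by linarith [ht.2]) hu.le
      have : 0 < t * v := mul_pos h hv
      linarith
  have h := (bellman_line_convex (a := x₂ - x₁) (c := y₂ - y₁) hr hr1 hpr (pos hx₁ hx₂)
    (pos hy₁ hy₂)).2
    (show (0 : ℝ) ∈ Set.Icc (0 : ℝ) 1 by simp) (show (1 : ℝ) ∈ Set.Icc (0 : ℝ) 1 by simp)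
    (show (0 : ℝ) ≤ 1 / 2 by norm_num) (show (0 : ℝ) ≤ 1 / 2 by norm_num) (by norm_num)
  simp only [smul_eq_mul] at h
  norm_num at h
  have e1 : x₁ + 1 / 2 * (x₂ - x₁) = (x₁ + x₂) / 2 := by ring
  have e2 : y₁ + 1 / 2 * (y₂ - y₁) = (y₁ + y₂) / 2 := by ring
  rw [e1, e2, abs_sub_comm x₂, abs_sub_comm y₂] at h
  linarith

lemma continuous_bellman {p r : ℝ} (hr : 0 < r) (hp : 0 < p) :
    Continuous fun z : ℝ × ℝ => bellman p r z.1 z.2 := by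
  unfold bellman
  have h1 : Continuous fun z : ℝ × ℝ => z.1 ^ p := continuous_fst.rpow_const fun _ => Or.inr hp.le
  have h2 : Continuous fun z : ℝ × ℝ => z.2 ^ (1 + r) :=
    continuous_snd.rpow_const fun _ => Or.inr (by linarith)
  have h3 : Continuous fun z : ℝ × ℝ => z.2 ^ r := continuous_snd.rpow_const fun _ => Or.inr hr.le
  fun_prop

/-- Shifting all coordinates by a small `ε > 0` leaves the differences unchanged, so the open
quadrant case and continuity reach the boundary, where the powers need not be smooth. -/
lemma bellman_midpoint {p r x₁ y₁ x₂ y₂ : ℝ} (hr : 0 < r) (hr1 : r ≤ 1)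
    (hpr : r * (p - 1) = 1) (hx₁ : 0 ≤ x₁) (hy₁ : 0 ≤ y₁) (hx₂ : 0 ≤ x₂) (hy₂ : 0 ≤ y₂) :
    bellman p r ((x₁ + x₂) / 2) ((y₁ + y₂) / 2) + |x₁ - x₂| * |y₁ - y₂| / 4 ≤
      (bellman p r x₁ y₁ + bellman p r x₂ y₂) / 2 := by
  have hp : 0 < p := by nlinarith
  have hb := continuous_bellman hr hp
  have hl : ∀ x y : ℝ, Tendsto (fun ε : ℝ => bellman p r (x + ε) (y + ε)) (𝓝[>] 0)
      (𝓝 (bellman p r x y)) := by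
    intro x y
    have : Continuous fun ε : ℝ => bellman p r (x + ε) (y + ε) :=
      hb.comp (f := fun ε : ℝ => (x + ε, y + ε)) (by fun_prop)
    simpa using (this.tendsto 0).mono_left nhdsWithin_le_nhds
  refine le_of_tendsto_of_tendsto ((hl ((x₁ + x₂) / 2) ((y₁ + y₂) / 2)).add_const _)
    (((hl x₁ y₁).add (hl x₂ y₂)).div_const 2) ?_
  filter_upwards [self_mem_nhdsWithin] with ε hε
  have hε : 0 < ε := hε
  have := bellman_midpoint_of_pos hr hr1 hpr (x₁ := x₁ + ε) (y₁ := y₁ + ε) (x₂ := x₂ + ε)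
    (y₂ := y₂ + ε) (by linarith) (by linarith) (by linarith) (by linarith)
  have e1 : (x₁ + ε + (x₂ + ε)) / 2 = (x₁ + x₂) / 2 + ε := by ring
  have e2 : (y₁ + ε + (y₂ + ε)) / 2 = (y₁ + y₂) / 2 + ε := by ring
  rwa [e1, e2, add_sub_add_right_eq_sub, add_sub_add_right_eq_sub] at this

lemma bellman_zero {p r : ℝ} (hr : 0 < r) (hp : 0 < p) : bellman p r 0 0 = 0 := by
  simp [bellman, Real.zero_rpow hp.ne', Real.zero_rpow (show 1 + r ≠ 0 by linarith)]

lemma bellman_nonneg {p r x y : ℝ} (hr : 0 < r) (hx : 0 ≤ x) (hy : 0 ≤ y) :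
    0 ≤ bellman p r x y := by
  unfold bellman; positivity

lemma bellman_le {p r x y : ℝ} (hr : 0 < r) (hpr : r * (p - 1) = 1)
    (hx : 0 ≤ x) (hy : 0 ≤ y) :
    bellman p r x y ≤ (12 / ((1 + r) * r) + 2) * (x ^ p + y ^ (1 + r)) := by
  have hp : 0 < p := by nlinarith
  have h1 : √(x ^ 2 + (y ^ r) ^ 2) ≤ x + y ^ r := by
    have : 0 ≤ y ^ r := Real.rpow_nonneg hy r
    rw [Real.sqrt_le_left (by positivity)]
    nlinarith [mul_nonneg hx this]
  have hpq : p.HolderConjugate (1 + r) := by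
    rw [Real.holderConjugate_iff]
    refine ⟨by nlinarith, ?_⟩
    have : r ≠ 0 := hr.ne'
    have hp' : p = 1 + 1 / r := by field_simp; linarith
    rw [hp']
    field_simp
    ring
  have h2 : x * y ≤ x ^ p + y ^ (1 + r) := by
    have := Real.young_inequality_of_nonneg hx hy hpq
    have h3 : x ^ p / p ≤ x ^ p := div_le_self (by positivity) hpq.lt.le
    have h4 : y ^ (1 + r) / (1 + r) ≤ y ^ (1 + r) := div_le_self (by positivity) (by linarith)
    linarith
  have h5 : y * y ^ r = y ^ (1 + r) := by
    rw [Real.rpow_add' hy (by linarith), Real.rpow_one]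
  have h6 : y * √(x ^ 2 + (y ^ r) ^ 2) ≤ x * y + y ^ (1 + r) := by
    rw [← h5]; nlinarith
  have h7 : 0 ≤ 12 / ((1 + r) * r) := by positivity
  have h8 : 0 ≤ x ^ p := by positivity
  unfold bellman
  nlinarith [mul_nonneg h7 h8]

/-- A convex function on the quadrant that witnesses the bilinear embedding. -/
lemma exists_bellman {p q : ℝ} (hpq : p.HolderConjugate q) :
    ∃ (b : ℝ → ℝ → ℝ) (C : ℝ), 0 < C ∧ (Continuous fun z : ℝ × ℝ => b z.1 z.2) ∧ b 0 0 = 0 ∧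
      (∀ x y, 0 ≤ x → 0 ≤ y → 0 ≤ b x y ∧ b x y ≤ C * (x ^ p + y ^ q)) ∧
      ∀ x₁ y₁ x₂ y₂, 0 ≤ x₁ → 0 ≤ y₁ → 0 ≤ x₂ → 0 ≤ y₂ →
        b ((x₁ + x₂) / 2) ((y₁ + y₂) / 2) + |x₁ - x₂| * |y₁ - y₂| / 4 ≤ (b x₁ y₁ + b x₂ y₂) / 2 := by
  have key : ∀ {p q : ℝ}, p.HolderConjugate q → 2 ≤ p →
      0 < q - 1 ∧ q - 1 ≤ 1 ∧ (q - 1) * (p - 1) = 1 := by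
    intro p q h h2
    have h3 := h.sub_one_mul_conj
    have h4 := h.symm.lt
    refine ⟨by linarith, ?_, by nlinarith⟩
    nlinarith
  rcases le_total 2 p with h | h
  · obtain ⟨hr, hr1, hpr⟩ := key hpq h
    refine ⟨bellman p (q - 1), 12 / ((1 + (q - 1)) * (q - 1)) + 2, by positivity,
      continuous_bellman hr hpq.pos, bellman_zero hr hpq.pos, fun x y hx hy =>
      ⟨bellman_nonneg hr hx hy, ?_⟩, fun x₁ y₁ x₂ y₂ h1 h2 h3 h4 =>
      bellman_midpoint hr hr1 hpr h1 h2 h3 h4⟩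
    have := bellman_le hr hpr hx hy
    simpa using this
  -- For `p ≤ 2` the conjugate exponent is at least 2, and the two variables exchange roles.
  · have hq : 2 ≤ q := by
      have h3 := hpq.sub_one_mul_conj
      have h4 := hpq.lt
      nlinarith
    obtain ⟨hr, hr1, hpr⟩ := key hpq.symm hq
    refine ⟨fun x y => bellman q (p - 1) y x, 12 / ((1 + (p - 1)) * (p - 1)) + 2, by positivity,
      (continuous_bellman hr hpq.symm.pos).comp continuous_swap, bellman_zero hr hpq.symm.pos,
      fun x y hx hy => ⟨bellman_nonneg hr hy hx, ?_⟩, fun x₁ y₁ x₂ y₂ h1 h2 h3 h4 => ?_⟩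
    · have := bellman_le hr hpr hy hx
      simpa [add_comm] using this
    · rw [mul_comm |x₁ - x₂|]
      exact bellman_midpoint hr hr1 hpr h2 h1 h4 h3

/-! ### Averages and symmetric differences -/

/-- Continuous functions with compact support. -/
def IsCc (u : E3 → ℝ) : Prop := Continuous u ∧ HasCompactSupport u

/-- The average of `u` over the two points `x ± d`. -/
def avg (d : E3) (u : E3 → ℝ) (x : E3) : ℝ := (u (x + d) + u (x - d)) / 2

/-- The symmetric difference of `u` in direction `d`. -/
def dif (d : E3) (u : E3 → ℝ) (x : E3) : ℝ := u (x + d) - u (x - d)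

namespace IsCc

variable {u v : E3 → ℝ}

lemma integrable (hu : IsCc u) : Integrable u := hu.1.integrable_of_hasCompactSupport hu.2

lemma translate (hu : IsCc u) (d : E3) : IsCc fun x => u (x + d) :=
  ⟨hu.1.comp (continuous_add_const d), hu.2.comp_homeomorph (Homeomorph.addRight d)⟩

lemma translate' (hu : IsCc u) (d : E3) : IsCc fun x => u (x - d) := by
  simpa [sub_eq_add_neg] using hu.translate (-d)

lemma add (hu : IsCc u) (hv : IsCc v) : IsCc fun x => u x + v x :=
  ⟨hu.1.add hv.1, hu.2.add hv.2⟩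

lemma sub (hu : IsCc u) (hv : IsCc v) : IsCc fun x => u x - v x :=
  ⟨hu.1.sub hv.1, by simpa [sub_eq_add_neg] using! hu.2.add hv.2.neg⟩

lemma mul (hu : IsCc u) (hv : Continuous v) : IsCc fun x => u x * v x :=
  ⟨hu.1.mul hv, hu.2.mul_right⟩

lemma comp (hu : IsCc u) {g : ℝ → ℝ} (hg : Continuous g) (h0 : g 0 = 0) :
    IsCc fun x => g (u x) := ⟨hg.comp hu.1, hu.2.comp_left h0⟩

lemma comp₂ (hu : IsCc u) (hv : IsCc v) {b : ℝ → ℝ → ℝ}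
    (hb : Continuous fun z : ℝ × ℝ => b z.1 z.2) (h0 : b 0 0 = 0) :
    IsCc fun x => b (u x) (v x) :=
  ⟨hb.comp (hu.1.prodMk hv.1), hu.2.comp₂_left hv.2 h0⟩

lemma avg (hu : IsCc u) (d : E3) : IsCc (avg d u) := by
  have := ((hu.translate d).add (hu.translate' d)).mul (v := fun _ => 1 / 2) continuous_const
  convert this using 2
  simp only [ChiralMaxwell.avg]; ring

lemma dif (hu : IsCc u) (d : E3) : IsCc (dif d u) := (hu.translate d).sub (hu.translate' d)

lemma abs (hu : IsCc u) : IsCc fun x => |u x| := hu.comp continuous_abs abs_zero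

lemma rpow_abs (hu : IsCc u) {p : ℝ} (hp : 0 < p) : IsCc fun x => |u x| ^ p :=
  hu.abs.comp (g := fun t => t ^ p) (continuous_id.rpow_const fun _ => Or.inr hp.le)
    (Real.zero_rpow hp.ne')

end IsCc

lemma avg_dif_comm (d e : E3) (u : E3 → ℝ) : dif d (avg e u) = avg e (dif d u) := by
  funext x
  simp only [avg, dif]
  rw [show x + d + e = x + e + d by abel, show x + d - e = x - e + d by abel,
    show x - d + e = x + e - d by abel, show x - d - e = x - e - d by abel]
  ring

lemma avg_avg_comm (d e : E3) (u : E3 → ℝ) : avg d (avg e u) = avg e (avg d u) := by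
  funext x
  simp only [avg]
  rw [show x + d + e = x + e + d by abel, show x + d - e = x - e + d by abel,
    show x - d + e = x + e - d by abel, show x - d - e = x - e - d by abel]
  ring

lemma integral_avg {u : E3 → ℝ} (hu : IsCc u) (d : E3) : ∫ x, avg d u x = ∫ x, u x := by
  simp only [avg]
  rw [integral_div, integral_add (hu.translate d).integrable (hu.translate' d).integrable,
    integral_add_right_eq_self u d, integral_sub_right_eq_self u d]
  ring

lemma integral_avg_mul {u v : E3 → ℝ} (hu : IsCc u) (hv : IsCc v) (d : E3) :
    ∫ x, avg d u x * v x = ∫ x, u x * avg d v x := by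
  have h1 : ∫ x, u (x + d) * v x = ∫ x, u x * v (x - d) := by
    simpa using integral_add_right_eq_self (fun x => u x * v (x - d)) d
  have h2 : ∫ x, u (x - d) * v x = ∫ x, u x * v (x + d) := by
    simpa using integral_sub_right_eq_self (fun x => u x * v (x + d)) d
  have e1 : ∀ x, avg d u x * v x = (u (x + d) * v x + u (x - d) * v x) / 2 := fun x => by
    simp only [avg]; ring
  have e2 : ∀ x, u x * avg d v x = (u x * v (x - d) + u x * v (x + d)) / 2 := fun x => by
    simp only [avg]; ring
  simp_rw [e1, e2]
  rw [integral_div, integral_div,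
    integral_add ((hu.translate d).mul hv.1).integrable ((hu.translate' d).mul hv.1).integrable,
    integral_add (hu.mul (hv.translate' d).1).integrable (hu.mul (hv.translate d).1).integrable,
    h1, h2]

lemma integral_dif_mul_dif {u v : E3 → ℝ} (hu : IsCc u) (hv : IsCc v) (d : E3) :
    ∫ x, dif d u x * dif d v x = -∫ x, dif d (dif d u) x * v x := by
  have hw := hu.dif d
  have h1 : ∫ x, dif d u x * v (x + d) = ∫ x, dif d u (x - d) * v x := by
    simpa using (integral_sub_right_eq_self (fun x => dif d u x * v (x + d)) d).symm
  have h2 : ∫ x, dif d u x * v (x - d) = ∫ x, dif d u (x + d) * v x := by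
    simpa using (integral_add_right_eq_self (fun x => dif d u x * v (x - d)) d).symm
  have e1 : ∀ x, dif d u x * dif d v x = dif d u x * v (x + d) - dif d u x * v (x - d) :=
    fun x => by rw [← mul_sub]; rfl
  have e2 : ∀ x, dif d (dif d u) x * v x = dif d u (x + d) * v x - dif d u (x - d) * v x :=
    fun x => by rw [← sub_mul]; rfl
  simp_rw [e1, e2]
  rw [integral_sub (hw.mul (hv.translate d).1).integrable (hw.mul (hv.translate' d).1).integrable,
    integral_sub ((hw.translate d).mul hv.1).integrable ((hw.translate' d).mul hv.1).integrable,
    h1, h2]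
  ring

/-! ### The random walk and its bilinear embedding -/

/-- One step of the random walk with steps `± d₁ ± d₂ ± d₃`. -/
def walk (d₁ d₂ d₃ : E3) (u : E3 → ℝ) : E3 → ℝ := avg d₃ (avg d₂ (avg d₁ u))

section walk

variable {d₁ d₂ d₃ : E3} {u v : E3 → ℝ}

lemma IsCc.walk (hu : IsCc u) : IsCc (walk d₁ d₂ d₃ u) := ((hu.avg _).avg _).avg _

lemma IsCc.walk_iterate (hu : IsCc u) (n : ℕ) : IsCc ((ChiralMaxwell.walk d₁ d₂ d₃)^[n] u) := by
  induction n with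
  | zero => exact hu
  | succ n ih => rw [Function.iterate_succ_apply']; exact ih.walk

lemma dif_walk (d : E3) : dif d (walk d₁ d₂ d₃ u) = walk d₁ d₂ d₃ (dif d u) := by
  simp only [walk, avg_dif_comm]

lemma integral_walk_mul (hu : IsCc u) (hv : IsCc v) :
    ∫ x, walk d₁ d₂ d₃ u x * v x = ∫ x, u x * walk d₁ d₂ d₃ v x := by
  simp only [walk]
  rw [integral_avg_mul ((hu.avg _).avg _) hv, integral_avg_mul (hu.avg _) (hv.avg _),
    integral_avg_mul hu ((hv.avg _).avg _), avg_avg_comm d₂ d₃, avg_avg_comm d₁ d₃,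
    avg_avg_comm d₁ d₂]

lemma avg_sub (d : E3) : avg d (fun x => u x - v x) = fun x => avg d u x - avg d v x := by
  funext x; simp only [avg]; ring

lemma walk_sub : walk d₁ d₂ d₃ (fun x => u x - v x)
    = fun x => walk d₁ d₂ d₃ u x - walk d₁ d₂ d₃ v x := by
  simp only [walk, avg_sub]

lemma walk_iterate_sub (n : ℕ) : (walk d₁ d₂ d₃)^[n] (fun x => u x - v x)
    = fun x => (walk d₁ d₂ d₃)^[n] u x - (walk d₁ d₂ d₃)^[n] v x := by
  induction n with
  | zero => rfl
  | succ n ih => simp only [Function.iterate_succ_apply', ih, walk_sub]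

lemma avg_nonneg (d : E3) (hu : ∀ x, 0 ≤ u x) (x : E3) : 0 ≤ avg d u x := by
  have := hu (x + d); have := hu (x - d)
  simp only [avg]; positivity

lemma walk_nonneg (hu : ∀ x, 0 ≤ u x) (x : E3) : 0 ≤ walk d₁ d₂ d₃ u x :=
  avg_nonneg _ (avg_nonneg _ (avg_nonneg _ hu)) x

lemma walk_iterate_nonneg (hu : ∀ x, 0 ≤ u x) (n : ℕ) (x : E3) :
    0 ≤ (walk d₁ d₂ d₃)^[n] u x := by
  induction n generalizing x with
  | zero => exact hu x
  | succ n ih => rw [Function.iterate_succ_apply']; exact walk_nonneg ih x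

end walk

/-- The decrease of `∫ b(u, v)` under averaging controls the bilinear form of differences. -/
lemma integral_bellman_avg {b : ℝ → ℝ → ℝ} (hb : Continuous fun z : ℝ × ℝ => b z.1 z.2)
    (h0 : b 0 0 = 0)
    (hmid : ∀ x₁ y₁ x₂ y₂, 0 ≤ x₁ → 0 ≤ y₁ → 0 ≤ x₂ → 0 ≤ y₂ →
        b ((x₁ + x₂) / 2) ((y₁ + y₂) / 2) + |x₁ - x₂| * |y₁ - y₂| / 4 ≤ (b x₁ y₁ + b x₂ y₂) / 2)
    {u v : E3 → ℝ} (hu : IsCc u) (hv : IsCc v) (hu0 : ∀ x, 0 ≤ u x) (hv0 : ∀ x, 0 ≤ v x)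
    (d : E3) :
    (∫ x, b (avg d u x) (avg d v x)) + (∫ x, |dif d u x| * |dif d v x|) / 4
      ≤ ∫ x, b (u x) (v x) := by
  have hw := hu.comp₂ hv hb h0
  have h1 := ((hu.avg d).comp₂ (hv.avg d) hb h0).integrable
  have h2 := ((hu.dif d).abs.mul (hv.dif d).abs.1).integrable
  -- Averaging preserves the integral of `b(u, v)`; after this the claim is the integral of the
  -- pointwise midpoint inequality.
  rw [← integral_avg hw d, ← integral_div, ← integral_add h1 (h2.div_const 4)]
  exact integral_mono (h1.add (h2.div_const 4)) (hw.avg d).integrable fun x =>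
    hmid _ _ _ _ (hu0 _) (hv0 _) (hu0 _) (hv0 _)

/-- A step of the walk is three averages, and each lowers `∫ b(U, V)`. The gain of the average along
`d₁`, which is the first one applied, is kept and the other two are discarded; the sum telescopes
because `b ≥ 0` on the quadrant. -/
lemma sum_integral_dif_le_bellman {b : ℝ → ℝ → ℝ} (hb : Continuous fun z : ℝ × ℝ => b z.1 z.2)
    (h0 : b 0 0 = 0) (hnn : ∀ x y, 0 ≤ x → 0 ≤ y → 0 ≤ b x y)
    (hmid : ∀ x₁ y₁ x₂ y₂, 0 ≤ x₁ → 0 ≤ y₁ → 0 ≤ x₂ → 0 ≤ y₂ →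
        b ((x₁ + x₂) / 2) ((y₁ + y₂) / 2) + |x₁ - x₂| * |y₁ - y₂| / 4 ≤ (b x₁ y₁ + b x₂ y₂) / 2)
    {u v : E3 → ℝ} (hu : IsCc u) (hv : IsCc v) (hu0 : ∀ x, 0 ≤ u x) (hv0 : ∀ x, 0 ≤ v x)
    (d₁ d₂ d₃ : E3) (N : ℕ) :
    ∑ n ∈ Finset.range N, ∫ x, |dif d₁ ((walk d₁ d₂ d₃)^[n] u) x| *
      |dif d₁ ((walk d₁ d₂ d₃)^[n] v) x| ≤ 4 * ∫ x, b (u x) (v x) := by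
  have key : ∀ N, (∑ n ∈ Finset.range N, ∫ x, |dif d₁ ((walk d₁ d₂ d₃)^[n] u) x| *
      |dif d₁ ((walk d₁ d₂ d₃)^[n] v) x|) +
        4 * ∫ x, b ((walk d₁ d₂ d₃)^[N] u x) ((walk d₁ d₂ d₃)^[N] v x)
          ≤ 4 * ∫ x, b (u x) (v x) := by
    intro N
    induction N with
    | zero => simp
    | succ N ih =>
      rw [Finset.sum_range_succ, Function.iterate_succ_apply', Function.iterate_succ_apply']
      have hU := hu.walk_iterate (d₁ := d₁) (d₂ := d₂) (d₃ := d₃) N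
      have hV := hv.walk_iterate (d₁ := d₁) (d₂ := d₂) (d₃ := d₃) N
      have hU0 := walk_iterate_nonneg (d₁ := d₁) (d₂ := d₂) (d₃ := d₃) hu0 N
      have hV0 := walk_iterate_nonneg (d₁ := d₁) (d₂ := d₂) (d₃ := d₃) hv0 N
      set U := (walk d₁ d₂ d₃)^[N] u
      set V := (walk d₁ d₂ d₃)^[N] v
      have s1 := integral_bellman_avg hb h0 hmid hU hV hU0 hV0 d₁
      have s2 := integral_bellman_avg hb h0 hmid (hU.avg d₁) (hV.avg d₁) (avg_nonneg _ hU0)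
        (avg_nonneg _ hV0) d₂
      have s3 := integral_bellman_avg hb h0 hmid ((hU.avg d₁).avg d₂) ((hV.avg d₁).avg d₂)
        (avg_nonneg _ (avg_nonneg _ hU0)) (avg_nonneg _ (avg_nonneg _ hV0)) d₃
      have p2 : 0 ≤ ∫ x, |dif d₂ (avg d₁ U) x| * |dif d₂ (avg d₁ V) x| :=
        integral_nonneg fun x => by positivity
      have p3 : 0 ≤ ∫ x, |dif d₃ (avg d₂ (avg d₁ U)) x| * |dif d₃ (avg d₂ (avg d₁ V)) x| :=
        integral_nonneg fun x => by positivity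
      simp only [walk]
      linarith
  have h1 := key N
  have h2 : 0 ≤ ∫ x, b ((walk d₁ d₂ d₃)^[N] u x) ((walk d₁ d₂ d₃)^[N] v x) :=
    integral_nonneg fun x => hnn _ _ (walk_iterate_nonneg hu0 N x) (walk_iterate_nonneg hv0 N x)
  linarith

/-- Bilinear embedding for the random walk, for nonnegative functions. -/
lemma exists_sum_integral_dif_le_of_nonneg {p q : ℝ} (hpq : p.HolderConjugate q) :
    ∃ C : ℝ, 0 < C ∧ ∀ (d₁ d₂ d₃ : E3) (u v : E3 → ℝ), IsCc u → IsCc v → (∀ x, 0 ≤ u x) →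
      (∀ x, 0 ≤ v x) → ∀ N : ℕ,
      ∑ n ∈ Finset.range N, ∫ x, |dif d₁ ((walk d₁ d₂ d₃)^[n] u) x| *
        |dif d₁ ((walk d₁ d₂ d₃)^[n] v) x| ≤ C * ((∫ x, |u x| ^ p) + ∫ x, |v x| ^ q) := by
  obtain ⟨b, C, hC, hb, h0, hbd, hmid⟩ := exists_bellman hpq
  refine ⟨4 * C, by positivity, fun d₁ d₂ d₃ u v hu hv hu0 hv0 N => ?_⟩
  refine (sum_integral_dif_le_bellman hb h0 (fun x y hx hy => (hbd x y hx hy).1) hmid hu hv hu0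
    hv0 d₁ d₂ d₃ N).trans ?_
  have i1 := (hu.rpow_abs hpq.pos).integrable
  have i2 := (hv.rpow_abs hpq.symm.pos).integrable
  rw [mul_assoc]
  refine mul_le_mul_of_nonneg_left ?_ (by norm_num)
  rw [← integral_add i1 i2, ← integral_const_mul]
  refine integral_mono (hu.comp₂ hv hb h0).integrable ((i1.add i2).const_mul C) fun x => ?_
  simp only [abs_of_nonneg (hu0 x), abs_of_nonneg (hv0 x)]
  exact (hbd _ _ (hu0 x) (hv0 x)).2

/-- Splitting `u` and `v` into positive and negative parts gives four products, each controlled by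
the nonnegative case; hence the factor 4. -/
lemma exists_sum_integral_dif_le {p q : ℝ} (hpq : p.HolderConjugate q) :
    ∃ C : ℝ, 0 < C ∧ ∀ (d₁ d₂ d₃ : E3) (u v : E3 → ℝ), IsCc u → IsCc v → ∀ N : ℕ,
      ∑ n ∈ Finset.range N, ∫ x, |dif d₁ ((walk d₁ d₂ d₃)^[n] u) x| *
        |dif d₁ ((walk d₁ d₂ d₃)^[n] v) x| ≤ C * ((∫ x, |u x| ^ p) + ∫ x, |v x| ^ q) := by
  obtain ⟨C, hC, h⟩ := exists_sum_integral_dif_le_of_nonneg hpq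
  refine ⟨4 * C, by positivity, fun d₁ d₂ d₃ u v hu hv N => ?_⟩
  have pos : ∀ {w : E3 → ℝ}, IsCc w → IsCc (fun x => max (w x) 0) := fun hw =>
    hw.comp (g := fun t => max t 0) (by fun_prop) (by simp)
  have neg : ∀ {w : E3 → ℝ}, IsCc w → IsCc (fun x => max (-w x) 0) := fun hw =>
    hw.comp (g := fun t => max (-t) 0) (by fun_prop) (by simp)
  have split : ∀ w : E3 → ℝ, w = fun x => max (w x) 0 - max (-w x) 0 := fun w => by
    funext x; rcases le_total (w x) 0 with h | h <;> simp [h]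
  have abs_le : ∀ (w : E3 → ℝ) (n : ℕ) (x : E3), |dif d₁ ((walk d₁ d₂ d₃)^[n] w) x| ≤
      |dif d₁ ((walk d₁ d₂ d₃)^[n] fun x => max (w x) 0) x| +
        |dif d₁ ((walk d₁ d₂ d₃)^[n] fun x => max (-w x) 0) x| := by
    intro w n x
    conv_lhs => rw [split w, walk_iterate_sub]
    simp only [dif]
    rw [sub_sub_sub_comm]
    exact abs_sub _ _
  have pow_pos : ∀ {w : E3 → ℝ}, IsCc w → ∀ {s : ℝ}, 0 < s →
      ∫ x, |max (w x) 0| ^ s ≤ ∫ x, |w x| ^ s := fun hw s hs =>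
    integral_mono ((pos hw).rpow_abs hs).integrable (hw.rpow_abs hs).integrable fun x =>
      Real.rpow_le_rpow (abs_nonneg _) (by
        rw [abs_of_nonneg (le_max_right _ _)]; exact max_le (le_abs_self _) (abs_nonneg _)) hs.le
  have pow_neg : ∀ {w : E3 → ℝ}, IsCc w → ∀ {s : ℝ}, 0 < s →
      ∫ x, |max (-w x) 0| ^ s ≤ ∫ x, |w x| ^ s := fun hw s hs =>
    integral_mono ((neg hw).rpow_abs hs).integrable (hw.rpow_abs hs).integrable fun x =>
      Real.rpow_le_rpow (abs_nonneg _) (by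
        rw [abs_of_nonneg (le_max_right _ _)]; exact max_le (neg_le_abs _) (abs_nonneg _)) hs.le
  have hd : ∀ {w : E3 → ℝ}, IsCc w → ∀ n, IsCc (dif d₁ ((walk d₁ d₂ d₃)^[n] w)) := fun hw n =>
    (hw.walk_iterate n).dif d₁
  have term : ∀ n, ∫ x, |dif d₁ ((walk d₁ d₂ d₃)^[n] u) x| * |dif d₁ ((walk d₁ d₂ d₃)^[n] v) x| ≤
      (∫ x, |dif d₁ ((walk d₁ d₂ d₃)^[n] fun x => max (u x) 0) x| *
        |dif d₁ ((walk d₁ d₂ d₃)^[n] fun x => max (v x) 0) x|) +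
      (∫ x, |dif d₁ ((walk d₁ d₂ d₃)^[n] fun x => max (u x) 0) x| *
        |dif d₁ ((walk d₁ d₂ d₃)^[n] fun x => max (-v x) 0) x|) +
      ((∫ x, |dif d₁ ((walk d₁ d₂ d₃)^[n] fun x => max (-u x) 0) x| *
        |dif d₁ ((walk d₁ d₂ d₃)^[n] fun x => max (v x) 0) x|) +
      (∫ x, |dif d₁ ((walk d₁ d₂ d₃)^[n] fun x => max (-u x) 0) x| *
        |dif d₁ ((walk d₁ d₂ d₃)^[n] fun x => max (-v x) 0) x|)) := by
    intro n
    have i1 := ((hd (pos hu) n).abs.mul (hd (pos hv) n).abs.1).integrable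
    have i2 := ((hd (pos hu) n).abs.mul (hd (neg hv) n).abs.1).integrable
    have i3 := ((hd (neg hu) n).abs.mul (hd (pos hv) n).abs.1).integrable
    have i4 := ((hd (neg hu) n).abs.mul (hd (neg hv) n).abs.1).integrable
    rw [← integral_add' i1 i2, ← integral_add' i3 i4, ← integral_add' (i1.add i2) (i3.add i4)]
    refine integral_mono ((hd hu n).abs.mul (hd hv n).abs.1).integrable
      ((i1.add i2).add (i3.add i4)) fun x => ?_
    refine (mul_le_mul (abs_le u n x) (abs_le v n x) (abs_nonneg _) (by positivity)).trans_eq ?_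
    simp only [Pi.add_apply]
    ring
  refine (Finset.sum_le_sum fun n _ => term n).trans ?_
  rw [Finset.sum_add_distrib, Finset.sum_add_distrib, Finset.sum_add_distrib]
  have nn : ∀ (w : E3 → ℝ) x, 0 ≤ max (w x) 0 := fun w x => le_max_right _ _
  have h1 := h d₁ d₂ d₃ _ _ (pos hu) (pos hv) (nn _) (nn _) N
  have h2 := h d₁ d₂ d₃ _ _ (pos hu) (neg hv) (nn _) (nn fun x => -v x) N
  have h3 := h d₁ d₂ d₃ _ _ (neg hu) (pos hv) (nn fun x => -u x) (nn _) N
  have h4 := h d₁ d₂ d₃ _ _ (neg hu) (neg hv) (nn fun x => -u x) (nn fun x => -v x) N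
  have a1 := mul_le_mul_of_nonneg_left (pow_pos hu hpq.pos) hC.le
  have a2 := mul_le_mul_of_nonneg_left (pow_pos hv hpq.symm.pos) hC.le
  have a3 := mul_le_mul_of_nonneg_left (pow_neg hu hpq.pos) hC.le
  have a4 := mul_le_mul_of_nonneg_left (pow_neg hv hpq.symm.pos) hC.le
  linarith

/-- With `p = q = 2` and `u = v` the embedding bounds a series with these nonnegative terms. This
removes the end term of the telescoping sum in the next result. -/
lemma tendsto_integral_dif_sq {u : E3 → ℝ} (hu : IsCc u) (d₁ d₂ d₃ : E3) :
    Tendsto (fun n => ∫ x, dif d₁ ((walk d₁ d₂ d₃)^[n] u) x ^ 2) atTop (𝓝 0) := by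
  obtain ⟨C, -, h⟩ := exists_sum_integral_dif_le Real.HolderConjugate.two_two
  refine (summable_of_sum_range_le (c := C * ((∫ x, |u x| ^ (2 : ℝ)) + ∫ x, |u x| ^ (2 : ℝ)))
    (fun n => integral_nonneg fun x => sq_nonneg _) fun N => ?_).tendsto_atTop_zero
  simpa only [← sq, sq_abs] using h d₁ d₂ d₃ u u hu hu N

/-- The discrete form of the `L^p` bound for second derivatives. -/
lemma exists_integral_dif_mul_dif_le {p q : ℝ} (hpq : p.HolderConjugate q) :
    ∃ C : ℝ, 0 < C ∧ ∀ (d₁ d₂ d₃ : E3) (ψ φ : E3 → ℝ), IsCc ψ → IsCc φ →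
      |∫ x, dif d₁ (dif d₁ ψ) x * φ x| ≤
        C * ((∫ x, |walk d₁ d₂ d₃ (walk d₁ d₂ d₃ ψ) x - ψ x| ^ p) + ∫ x, |φ x| ^ q) := by
  obtain ⟨C, hC, h⟩ := exists_sum_integral_dif_le hpq
  refine ⟨C, hC, fun d₁ d₂ d₃ ψ φ hψ hφ => ?_⟩
  set W := walk d₁ d₂ d₃ with hW
  set f : E3 → ℝ := fun x => W (W ψ) x - ψ x with hf
  have hWW : IsCc (W (W ψ)) := hψ.walk.walk
  have hfc : IsCc f := hWW.sub hψ
  set S : ℕ → ℝ := fun n => ∫ x, dif d₁ (W^[n] ψ) x * dif d₁ (W^[n] φ) x with hS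
  -- One factor `W` of `W² Wⁿψ` is moved to `φ`, since `W` is self-adjoint and commutes with the
  -- difference: `∫ D Wⁿ⁺²ψ · D Wⁿφ = ∫ D Wⁿ⁺¹ψ · D Wⁿ⁺¹φ`.
  have hstep : ∀ n, ∫ x, dif d₁ (W^[n] f) x * dif d₁ (W^[n] φ) x = S (n + 1) - S n := by
    intro n
    have c1 : IsCc (dif d₁ (W^[n] ψ)) := (hψ.walk_iterate n).dif d₁
    have c2 : IsCc (dif d₁ (W^[n] φ)) := (hφ.walk_iterate n).dif d₁
    have c3 : IsCc (dif d₁ (W^[n + 1] ψ)) := (hψ.walk_iterate (n + 1)).dif d₁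
    have c4 : IsCc (dif d₁ (W^[n] (W (W ψ)))) := (hWW.walk_iterate n).dif d₁
    have e1 : ∀ x, dif d₁ (W^[n] f) x * dif d₁ (W^[n] φ) x =
        dif d₁ (W^[n] (W (W ψ))) x * dif d₁ (W^[n] φ) x
          - dif d₁ (W^[n] ψ) x * dif d₁ (W^[n] φ) x := by
      intro x
      rw [hf, hW, walk_iterate_sub]
      simp only [dif]; ring
    simp_rw [e1]
    rw [integral_sub (c4.mul c2.1).integrable (c1.mul c2.1).integrable]
    congr 1
    have e2 : dif d₁ (W^[n] (W (W ψ))) = W (dif d₁ (W^[n + 1] ψ)) := by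
      rw [← Function.iterate_succ_apply, ← Function.iterate_succ_apply,
        Function.iterate_succ_apply', hW, dif_walk]
    rw [e2, hW, integral_walk_mul c3 c2, ← dif_walk, ← hW, ← Function.iterate_succ_apply' W]
  have hbound : ∀ N, |S N - S 0| ≤ C * ((∫ x, |f x| ^ p) + ∫ x, |φ x| ^ q) := by
    intro N
    rw [← Finset.sum_range_sub]
    refine (Finset.abs_sum_le_sum_abs _ _).trans ((Finset.sum_le_sum fun n _ => ?_).trans
      (h d₁ d₂ d₃ f φ hfc hφ N))
    rw [← hstep n]
    refine (abs_integral_le_integral_abs).trans_eq ?_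
    simp only [abs_mul]
    rfl
  have hlim : Tendsto S atTop (𝓝 0) := by
    have h1 := (tendsto_integral_dif_sq hψ d₁ d₂ d₃).add (tendsto_integral_dif_sq hφ d₁ d₂ d₃)
    rw [add_zero] at h1
    refine squeeze_zero_norm (fun n => ?_) h1
    have c1 : IsCc (dif d₁ (W^[n] ψ)) := (hψ.walk_iterate n).dif d₁
    have c2 : IsCc (dif d₁ (W^[n] φ)) := (hφ.walk_iterate n).dif d₁
    have i1 : Integrable fun x => dif d₁ (W^[n] ψ) x ^ 2 := by
      simpa only [sq] using (c1.mul c1.1).integrable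
    have i2 : Integrable fun x => dif d₁ (W^[n] φ) x ^ 2 := by
      simpa only [sq] using (c2.mul c2.1).integrable
    rw [Real.norm_eq_abs, ← integral_add i1 i2]
    refine (abs_integral_le_integral_abs).trans (integral_mono (c1.mul c2.1).abs.integrable
      (i1.add i2) fun x => ?_)
    simp only [abs_mul]
    nlinarith [sq_abs (dif d₁ (W^[n] ψ) x), sq_abs (dif d₁ (W^[n] φ) x),
      sq_nonneg (|dif d₁ (W^[n] ψ) x| - |dif d₁ (W^[n] φ) x|),
      sq_nonneg (dif d₁ (W^[n] ψ) x), sq_nonneg (dif d₁ (W^[n] φ) x)]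
  have h0 : |0 - S 0| ≤ C * ((∫ x, |f x| ^ p) + ∫ x, |φ x| ^ q) :=
    le_of_tendsto (hlim.sub_const (S 0)).abs (Eventually.of_forall hbound)
  -- Summation by parts: since `S` tends to zero, the telescoped sum is `-S 0`, the integral to be
  -- bounded.
  have e : S 0 = -∫ x, dif d₁ (dif d₁ ψ) x * φ x := integral_dif_mul_dif hψ hφ d₁
  rw [e] at h0
  simpa using h0

/-! ### From differences to derivatives -/

/-- The directional derivative. -/
def dd {F : Type*} [NormedAddCommGroup F] [NormedSpace ℝ F] (a : E3) (f : E3 → F) (x : E3) : F :=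
  fderiv ℝ f x a

section dd

variable {F : Type*} [NormedAddCommGroup F] [NormedSpace ℝ F] {f : E3 → F}

lemma contDiff_dd (hf : ContDiff ℝ (⊤ : ℕ∞) f) (a : E3) : ContDiff ℝ (⊤ : ℕ∞) (dd a f) :=
  (hf.fderiv_right (m := (⊤ : ℕ∞)) (by simp)).clm_apply contDiff_const

lemma hasCompactSupport_dd (hf : HasCompactSupport f) (a : E3) : HasCompactSupport (dd a f) :=
  hf.fderiv_apply ℝ a

lemma hasDerivAt_line (hf : ContDiff ℝ (⊤ : ℕ∞) f) (x a : E3) (t : ℝ) :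
    HasDerivAt (fun s : ℝ => f (x + s • a)) (dd a f (x + t • a)) t := by
  have h1 : HasFDerivAt f (fderiv ℝ f (x + t • a)) (x + t • a) :=
    ((hf.differentiable (by simp)) _).hasFDerivAt
  have h2 : HasDerivAt (fun s : ℝ => x + s • a) a t := by
    simpa using! ((hasDerivAt_id t).smul_const a).const_add x
  exact h1.comp_hasDerivAt t h2

lemma hasDerivAt_line_neg (hf : ContDiff ℝ (⊤ : ℕ∞) f) (x a : E3) (t : ℝ) :
    HasDerivAt (fun s : ℝ => f (x - s • a)) (-dd a f (x - t • a)) t := by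
  have := hasDerivAt_line hf x (-a) t
  simpa [dd, sub_eq_add_neg] using this

end dd

/-- Smooth functions with compact support. -/
def IsCcSmooth (u : E3 → ℝ) : Prop := ContDiff ℝ (⊤ : ℕ∞) u ∧ HasCompactSupport u

lemma IsCcSmooth.isCc {u : E3 → ℝ} (hu : IsCcSmooth u) : IsCc u := ⟨hu.1.continuous, hu.2⟩

lemma IsCcSmooth.dd {u : E3 → ℝ} (hu : IsCcSmooth u) (a : E3) : IsCcSmooth (dd a u) :=
  ⟨contDiff_dd hu.1 a, hasCompactSupport_dd hu.2 a⟩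

lemma IsCc.uniformContinuous {u : E3 → ℝ} (hu : IsCc u) : UniformContinuous u :=
  hu.1.uniformContinuous_of_tendsto_cocompact (x := 0) hu.2.is_zero_at_infty

/-- Second-order Taylor estimate for the symmetric average. -/
lemma abs_avg_sub_le {u : E3 → ℝ} (hu : ContDiff ℝ (⊤ : ℕ∞) u) (x a : E3) {h ω : ℝ} (hh : 0 ≤ h)
    (hω : ∀ s : ℝ, |s| ≤ h → |dd a (dd a u) (x + s • a) - dd a (dd a u) x| ≤ ω) :
    |avg (h • a) u x - u x - h ^ 2 * (1 / 2 * dd a (dd a u) x)| ≤ h ^ 2 * ω := by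
  set D := dd a (dd a u) x
  -- `n` is the derivative of `m`, and `n'` is at most `2ω` in absolute value on `[0, h]`. Two
  -- applications of the mean value inequality give `2ωh²`; the average halves it.
  set n : ℝ → ℝ := fun t => dd a u (x + t • a) - dd a u (x - t • a) - 2 * t * D
  set m : ℝ → ℝ := fun t => u (x + t • a) + u (x - t • a) - t ^ 2 * D
  have hn : ∀ t, HasDerivAt n (dd a (dd a u) (x + t • a) + dd a (dd a u) (x - t • a) - 2 * D) t := by
    intro t
    have := ((hasDerivAt_line (contDiff_dd hu a) x a t).sub
      (hasDerivAt_line_neg (contDiff_dd hu a) x a t)).sub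
      (((hasDerivAt_id t).const_mul 2).mul_const D)
    refine this.congr_deriv ?_
    ring
  have hm : ∀ t, HasDerivAt m (n t) t := by
    intro t
    have := ((hasDerivAt_line hu x a t).add (hasDerivAt_line_neg hu x a t)).sub
      (((hasDerivAt_id t).pow 2).mul_const D)
    refine this.congr_deriv ?_
    simp [n]; ring
  have hn0 : n 0 = 0 := by simp [n]
  have bn : ∀ t ∈ Set.Icc (0 : ℝ) h, |n t| ≤ 2 * ω * t := by
    intro t ht
    have := norm_image_sub_le_of_norm_deriv_le_segment' (f := n) (a := 0) (b := h) (C := 2 * ω)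
      (fun s _ => (hn s).hasDerivWithinAt) (fun s hs => by
        have h1 := hω s (by rw [abs_of_nonneg hs.1]; exact hs.2.le)
        have h2 := hω (-s) (by rw [abs_neg, abs_of_nonneg hs.1]; exact hs.2.le)
        rw [neg_smul, ← sub_eq_add_neg] at h2
        rw [Real.norm_eq_abs]
        rw [abs_le] at h1 h2 ⊢
        constructor <;> linarith) t ht
    simpa [hn0] using this
  have hω0 : 0 ≤ ω := (abs_nonneg _).trans (hω 0 (by simpa using hh))
  have bm := norm_image_sub_le_of_norm_deriv_le_segment' (f := m) (a := 0) (b := h)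
    (C := 2 * ω * h) (fun s _ => (hm s).hasDerivWithinAt) (fun s hs => by
      refine (bn s ⟨hs.1, hs.2.le⟩).trans ?_
      have := hs.2
      gcongr) h ⟨hh, le_rfl⟩
  simp only [m, Real.norm_eq_abs] at bm
  simp only [zero_smul, add_zero, sub_zero] at bm
  have e : avg (h • a) u x - u x - h ^ 2 * (1 / 2 * D)
      = (u (x + h • a) + u (x - h • a) - h ^ 2 * D - (u x + u x - 0 ^ 2 * D)) / 2 := by
    simp only [avg]; ring
  rw [e, abs_div, abs_two, div_le_iff₀ (by norm_num)]
  linarith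

lemma tendstoUniformly_avg_sub {u : E3 → ℝ} (hu : IsCcSmooth u) (a : E3) :
    TendstoUniformly (fun (h : ℝ) x => (avg (h • a) u x - u x) / h ^ 2)
      (fun x => 1 / 2 * dd a (dd a u) x) (𝓝[>] 0) := by
  rw [Metric.tendstoUniformly_iff]
  intro ε hε
  have huc := (hu.dd a |>.dd a).isCc.uniformContinuous
  rw [Metric.uniformContinuous_iff] at huc
  obtain ⟨δ, hδ, hd⟩ := huc (ε / 2) (by positivity)
  have hev : ∀ᶠ h : ℝ in 𝓝[>] 0, ‖h • a‖ < δ := by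
    have : Tendsto (fun h : ℝ => ‖h • a‖) (𝓝[>] 0) (𝓝 0) := by
      have : Continuous fun h : ℝ => ‖h • a‖ := by fun_prop
      simpa using (this.tendsto 0).mono_left nhdsWithin_le_nhds
    exact this.eventually (gt_mem_nhds hδ)
  filter_upwards [hev, self_mem_nhdsWithin] with h h1 h2 x
  have h2 : 0 < h := h2
  have := abs_avg_sub_le hu.1 x a (h := h) (ω := ε / 2) h2.le (fun s hs => by
    rw [← Real.dist_eq]
    refine (hd ?_).le
    rw [dist_eq_norm, add_sub_cancel_left]
    refine lt_of_le_of_lt ?_ h1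
    rw [norm_smul, norm_smul, Real.norm_eq_abs, Real.norm_eq_abs, abs_of_pos h2]
    gcongr)
  rw [dist_comm, Real.dist_eq]
  have e : (avg (h • a) u x - u x) / h ^ 2 - 1 / 2 * dd a (dd a u) x
      = (avg (h • a) u x - u x - h ^ 2 * (1 / 2 * dd a (dd a u) x)) / h ^ 2 := by
    field_simp
  rw [e, abs_div, abs_of_pos (by positivity : 0 < h ^ 2), div_lt_iff₀ (by positivity)]
  nlinarith [pow_pos h2 2]

lemma tendstoUniformly_avg {F : ℝ → E3 → ℝ} {G : E3 → ℝ}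
    (hF : TendstoUniformly F G (𝓝[>] 0)) (hG : UniformContinuous G) (a : E3) :
    TendstoUniformly (fun (h : ℝ) => avg (h • a) (F h)) G (𝓝[>] 0) := by
  rw [Metric.tendstoUniformly_iff] at hF ⊢
  rw [Metric.uniformContinuous_iff] at hG
  intro ε hε
  obtain ⟨δ, hδ, hd⟩ := hG (ε / 2) (by positivity)
  have hev : ∀ᶠ h : ℝ in 𝓝[>] 0, ‖h • a‖ < δ := by
    have : Tendsto (fun h : ℝ => ‖h • a‖) (𝓝[>] 0) (𝓝 0) := by
      have : Continuous fun h : ℝ => ‖h • a‖ := by fun_prop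
      simpa using (this.tendsto 0).mono_left nhdsWithin_le_nhds
    exact this.eventually (gt_mem_nhds hδ)
  filter_upwards [hev, hF (ε / 2) (by positivity)] with h h1 h2 x
  have a1 := h2 (x + h • a)
  have a2 := h2 (x - h • a)
  have b1 := @hd (x + h • a) x (by simpa [dist_eq_norm] using h1)
  have b2 := @hd (x - h • a) x (by simpa [dist_eq_norm] using h1)
  rw [Real.dist_eq, abs_lt] at a1 a2 b1 b2
  rw [Real.dist_eq, abs_lt]
  simp only [ChiralMaxwell.avg]
  constructor <;> linarith

/-- The walk minus the identity telescopes into one-direction increments followed by averages, and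
averaging does not disturb a uniform limit that is uniformly continuous. Hence `(W - 1)u / h²` tends
to half the sum of the second derivatives, and `W² - 1 = W(W - 1) + (W - 1)` doubles it. -/
lemma tendstoUniformly_walk {u : E3 → ℝ} (hu : IsCcSmooth u) (a b c : E3) :
    TendstoUniformly (fun (h : ℝ) x => (walk (h • a) (h • b) (h • c)
        (walk (h • a) (h • b) (h • c) u) x - u x) / h ^ 2)
      (fun x => dd a (dd a u) x + dd b (dd b u) x + dd c (dd c u) x) (𝓝[>] 0) := by
  have uc : ∀ a, UniformContinuous (fun x => 1 / 2 * dd a (dd a u) x) := fun a =>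
    ((hu.dd a |>.dd a).isCc.comp (g := fun t => 1 / 2 * t) (by fun_prop) (by simp)).uniformContinuous
  have ha := tendstoUniformly_avg (tendstoUniformly_avg (tendstoUniformly_avg_sub hu a) (uc a) b)
    (uc a) c
  have hb := tendstoUniformly_avg (tendstoUniformly_avg_sub hu b) (uc b) c
  have hc := tendstoUniformly_avg_sub hu c
  have hG := (ha.add hb).add hc
  have huc := ((uc a).add (uc b)).add (uc c)
  have hW := tendstoUniformly_avg (tendstoUniformly_avg (tendstoUniformly_avg hG huc a) huc b) huc c
  have := hW.add hG
  convert this using 1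
  · funext h x
    simp only [walk, avg, Pi.add_apply]
    ring
  · funext x
    simp only [Pi.add_apply]
    ring

/-- The double symmetric difference is `u(x + 2ha) - 2u(x) + u(x - 2ha)`, which is twice the
increment of the average with direction `2a`. -/
lemma tendstoUniformly_dif_dif {u : E3 → ℝ} (hu : IsCcSmooth u) (a : E3) :
    TendstoUniformly (fun (h : ℝ) x => dif (h • a) (dif (h • a) u) x / h ^ 2)
      (fun x => 4 * dd a (dd a u) x) (𝓝[>] 0) := by
  have h1 := tendstoUniformly_avg_sub hu ((2 : ℝ) • a)
  have h2 := h1.add h1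
  convert h2 using 1
  · funext h x
    simp only [dif, avg, Pi.add_apply]
    rw [show x + h • a + h • a = x + h • (2 : ℝ) • a by module,
      show x + h • a - h • a = x by module, show x - h • a + h • a = x by module,
      show x - h • a - h • a = x - h • (2 : ℝ) • a by module]
    ring
  · funext x
    have e : dd ((2 : ℝ) • a) (dd ((2 : ℝ) • a) u) x = 4 * dd a (dd a u) x := by
      have e1 : dd ((2 : ℝ) • a) u = fun x => (2 : ℝ) • dd a u x := by
        funext x; simp [dd]
      rw [e1]
      rw [dd, fderiv_fun_const_smul (((contDiff_dd hu.1 a).differentiable (by simp)) x)]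
      simp [dd]; ring
    simp only [Pi.add_apply, e]
    ring

/-- `u` vanishes outside the closed ball of radius `R` about the origin. -/
def VanishesOutside (R : ℝ) (u : E3 → ℝ) : Prop := ∀ x, R < ‖x‖ → u x = 0

lemma VanishesOutside.avg {R : ℝ} {u : E3 → ℝ} (hu : VanishesOutside R u) {d : E3} {s : ℝ}
    (hd : ‖d‖ ≤ s) : VanishesOutside (R + s) (avg d u) := by
  intro x hx
  have h1 := norm_sub_le (x + d) d
  have h2 := norm_add_le (x - d) d
  rw [add_sub_cancel_right] at h1
  rw [sub_add_cancel] at h2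
  simp [ChiralMaxwell.avg, hu (x + d) (by linarith), hu (x - d) (by linarith)]

lemma VanishesOutside.dif {R : ℝ} {u : E3 → ℝ} (hu : VanishesOutside R u) {d : E3} {s : ℝ}
    (hd : ‖d‖ ≤ s) : VanishesOutside (R + s) (dif d u) := by
  intro x hx
  have h1 := norm_sub_le (x + d) d
  have h2 := norm_add_le (x - d) d
  rw [add_sub_cancel_right] at h1
  rw [sub_add_cancel] at h2
  simp [ChiralMaxwell.dif, hu (x + d) (by linarith), hu (x - d) (by linarith)]

lemma exists_vanishesOutside {u : E3 → ℝ} (hu : HasCompactSupport u) :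
    ∃ R, VanishesOutside R u := by
  obtain ⟨R, hR⟩ := hu.isCompact.isBounded.subset_closedBall 0
  refine ⟨R, fun x hx => ?_⟩
  by_contra h
  have := hR (subset_tsupport u h)
  rw [mem_closedBall_zero_iff] at this
  linarith

/-- Integrals of a continuous expression converge along a uniformly convergent family with
bounded supports. -/
lemma tendsto_integral_of_tendstoUniformly {F : ℝ → E3 → ℝ} {G : E3 → ℝ}
    (hF : TendstoUniformly F G (𝓝[>] 0)) (hFc : ∀ h, Continuous (F h)) (hG : IsCc G) {R : ℝ}
    (hR : ∀ᶠ h in 𝓝[>] 0, VanishesOutside R (F h)) {g : ℝ → E3 → ℝ}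
    (hg : Continuous fun z : ℝ × E3 => g z.1 z.2) (hg0 : ∀ x, g 0 x = 0) :
    Tendsto (fun h => ∫ x, g (F h x) x) (𝓝[>] 0) (𝓝 (∫ x, g (G x) x)) := by
  obtain ⟨M, hM⟩ := hG.1.bounded_above_of_compact_support hG.2
  -- By uniform convergence the values lie in `[-(M+1), M+1]` for small parameters, so `g` is
  -- evaluated on a compact set and a constant on the ball dominates.
  have hK : IsCompact (Set.Icc (-(M + 1)) (M + 1) ×ˢ Metric.closedBall (0 : E3) R) :=
    isCompact_Icc.prod (isCompact_closedBall 0 R)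
  obtain ⟨B, hB⟩ := hK.exists_bound_of_continuousOn hg.continuousOn
  refine tendsto_integral_filter_of_dominated_convergence
    (Set.indicator (Metric.closedBall 0 R) fun _ => B) ?_ ?_ ?_ ?_
  · exact Eventually.of_forall fun h =>
      (hg.comp ((hFc h).prodMk continuous_id)).aestronglyMeasurable
  · rw [Metric.tendstoUniformly_iff] at hF
    filter_upwards [hR, hF 1 one_pos] with h h1 h2
    refine Eventually.of_forall fun x => ?_
    by_cases hx : x ∈ Metric.closedBall (0 : E3) R
    · rw [Set.indicator_of_mem hx]
      refine hB (F h x, x) ⟨?_, hx⟩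
      have a1 := h2 x
      have a2 := hM x
      rw [Real.dist_eq, abs_lt] at a1
      rw [Real.norm_eq_abs, abs_le] at a2
      constructor <;> simp only <;> linarith
    · rw [Set.indicator_of_notMem hx, h1 x (by simpa using hx), hg0]
      simp
  · rw [integrable_indicator_iff measurableSet_closedBall]
    exact integrableOn_const (isCompact_closedBall (0 : E3) R).measure_lt_top.ne
  · refine Eventually.of_forall fun x => ?_
    exact ((hg.comp (f := fun t : ℝ => (t, x)) (by fun_prop)).tendsto (G x)).comp
      (hF.tendsto_at x)

/-! ### The Calderón-Zygmund inequality -/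

/-- The scaling limit of the discrete inequality. The constant does not depend on the directions, so
it survives `h → 0`. The parameter `s` stays free in order to absorb the constant later. -/
lemma exists_integral_dd_mul_le {p q : ℝ} (hpq : p.HolderConjugate q) :
    ∃ C : ℝ, 0 < C ∧ ∀ (a b c : E3) (ψ φ : E3 → ℝ), IsCcSmooth ψ → IsCc φ → ∀ s : ℝ, 0 < s →
      4 * s * |∫ x, dd a (dd a ψ) x * φ x| ≤
        C * (s ^ p * (∫ x, |dd a (dd a ψ) x + dd b (dd b ψ) x + dd c (dd c ψ) x| ^ p) +
          ∫ x, |φ x| ^ q) := by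
  obtain ⟨C, hC, H⟩ := exists_integral_dif_mul_dif_le hpq
  refine ⟨C, hC, fun a b c ψ φ hψ hφ s hs => ?_⟩
  obtain ⟨R, hR⟩ := exists_vanishesOutside hψ.2
  have small : ∀ᶠ h : ℝ in 𝓝[>] 0, ∀ v : E3, ‖h • v‖ ≤ ‖v‖ := by
    filter_upwards [Ioo_mem_nhdsGT (show (0 : ℝ) < 1 by norm_num)] with h hh v
    rw [norm_smul, Real.norm_eq_abs, abs_of_pos hh.1]
    exact mul_le_of_le_one_left (norm_nonneg v) hh.2.le
  have t1 := tendsto_integral_of_tendstoUniformly (R := R + ‖a‖ + ‖a‖)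
    (tendstoUniformly_dif_dif hψ a)
    (fun h => ((hψ.isCc.dif _).dif _).1.div_const _)
    ((hψ.dd a |>.dd a).isCc.comp (g := fun t => 4 * t) (by fun_prop) (by simp))
    (by
      filter_upwards [small] with h hh x hx
      simp [((hR.dif (hh a)).dif (hh a)) x hx])
    (g := fun t x => s * (t * φ x)) (by have := hφ.1; fun_prop) (by simp)
  set S := ‖a‖ + ‖b‖ + ‖c‖ with hS
  have t2 := tendsto_integral_of_tendstoUniformly (R := R + ‖a‖ + ‖b‖ + ‖c‖ + ‖a‖ + ‖b‖ + ‖c‖)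
    (tendstoUniformly_walk hψ a b c)
    (fun h => ((hψ.isCc.walk.walk).1.sub hψ.1.continuous).div_const _)
    (((hψ.dd a |>.dd a).isCc.add (hψ.dd b |>.dd b).isCc).add (hψ.dd c |>.dd c).isCc)
    (by
      filter_upwards [small] with h hh x hx
      have e1 := ((((((hR.avg (hh a)).avg (hh b)).avg (hh c)).avg (hh a)).avg (hh b)).avg (hh c))
        x hx
      have e2 : ψ x = 0 := hR x (by
        have := norm_nonneg a; have := norm_nonneg b; have := norm_nonneg c; linarith)
      simp only [walk, e1, e2]
      simp)
    (g := fun t _ => |s * t| ^ p) (by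
      refine Continuous.rpow_const (by fun_prop) fun _ => Or.inr hpq.nonneg)
    (by simp [Real.zero_rpow hpq.ne_zero])
  have lim := le_of_tendsto_of_tendsto t1.abs ((t2.add_const (∫ x, |φ x| ^ q)).const_mul C) (by
    filter_upwards with h
    -- The factor `1 / h²` normalizes both the double difference and `W² - 1`.
    have hk := H (h • a) (h • b) (h • c) (fun x => s / h ^ 2 * ψ x) φ
      (hψ.isCc.comp (g := fun t => s / h ^ 2 * t) (by fun_prop) (by simp)) hφ
    refine (le_of_eq ?_).trans (hk.trans (le_of_eq ?_))
    · congr 2 with x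
      simp only [dif]; ring
    · congr 4 with x
      simp only [walk, avg]; congr 2; ring)
  have e1 : ∫ x, s * (4 * dd a (dd a ψ) x * φ x) = 4 * s * ∫ x, dd a (dd a ψ) x * φ x := by
    rw [← integral_const_mul]; congr 1 with x; ring
  have e2 : ∫ x, |s * (dd a (dd a ψ) x + dd b (dd b ψ) x + dd c (dd c ψ) x)| ^ p =
      s ^ p * ∫ x, |dd a (dd a ψ) x + dd b (dd b ψ) x + dd c (dd c ψ) x| ^ p := by
    rw [← integral_const_mul]; congr 1 with x
    rw [abs_mul, abs_of_pos hs, Real.mul_rpow hs.le (abs_nonneg _)]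
  rw [e1, e2, abs_mul, abs_of_pos (by positivity)] at lim
  exact lim

/-- **Calderón-Zygmund inequality** for a second derivative in one direction. -/
theorem exists_integral_dd_dd_le {p : ℝ} (hp : 1 < p) :
    ∃ C : ℝ, 0 < C ∧ ∀ (a b c : E3) (ψ : E3 → ℝ), IsCcSmooth ψ →
      ∫ x, |dd a (dd a ψ) x| ^ p ≤
        C * ∫ x, |dd a (dd a ψ) x + dd b (dd b ψ) x + dd c (dd c ψ) x| ^ p := by
  have hpq : p.HolderConjugate (p / (p - 1)) := Real.HolderConjugate.conjExponent hp
  obtain ⟨C, hC, H⟩ := exists_integral_dd_mul_le hpq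
  refine ⟨C ^ p / 3, by positivity, fun a b c ψ hψ => ?_⟩
  have hg := (hψ.dd a |>.dd a).isCc
  set g := dd a (dd a ψ) with hgdef
  -- A continuous formula for `sign(t) |t|^(p-1)`, the extremal function in the duality of `L^p` and
  -- `L^q`.
  set sg : ℝ → ℝ := fun t => (max t 0) ^ (p - 1) - (max (-t) 0) ^ (p - 1) with hsg
  have hp1 : 0 < p - 1 := by linarith
  have hsgc : Continuous sg := by
    refine Continuous.sub ?_ ?_ <;>
      exact Continuous.rpow_const (by fun_prop) fun _ => Or.inr hp1.le
  have hsg0 : sg 0 = 0 := by simp [hsg]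
  have pw : ∀ t : ℝ, 0 ≤ t → t * t ^ (p - 1) = t ^ p := fun t ht => by
    have := Real.rpow_add' ht (y := 1) (z := p - 1) (by linarith)
    rw [Real.rpow_one] at this
    rw [← this]; congr 1; ring
  have hsg1 : ∀ t, t * sg t = |t| ^ p := by
    intro t
    rcases le_total 0 t with h | h
    · simp only [hsg, max_eq_left h, max_eq_right (neg_nonpos.2 h), Real.zero_rpow hp1.ne',
        abs_of_nonneg h, sub_zero, pw t h]
    · simp only [hsg, max_eq_right h, max_eq_left (neg_nonneg.2 h), Real.zero_rpow hp1.ne',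
        abs_of_nonpos h, zero_sub]
      rw [← pw (-t) (neg_nonneg.2 h)]; ring
  have hsg2 : ∀ t, |sg t| = |t| ^ (p - 1) := by
    intro t
    rcases le_total 0 t with h | h
    · simp only [hsg, max_eq_left h, max_eq_right (neg_nonpos.2 h), Real.zero_rpow hp1.ne',
        abs_of_nonneg h, sub_zero]
      exact abs_of_nonneg (Real.rpow_nonneg h _)
    · simp only [hsg, max_eq_right h, max_eq_left (neg_nonneg.2 h), Real.zero_rpow hp1.ne',
        abs_of_nonpos h, zero_sub, abs_neg]
      exact abs_of_nonneg (Real.rpow_nonneg (neg_nonneg.2 h) _)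
  have hsg3 : ∀ t, |sg t| ^ (p / (p - 1)) = |t| ^ p := by
    intro t
    rw [hsg2, ← Real.rpow_mul (abs_nonneg t)]
    congr 1; field_simp
  -- With `s = C` and `T = ∫ |g|^p`, `X` the corresponding integral of the sum, the bound reads `4CT
  -- ≤ C (C^p X + T)`, so the dual term is absorbed and `T ≤ C^p X / 3`.
  have := H a b c ψ (fun x => sg (g x)) hψ (hg.comp hsgc hsg0) C hC
  simp only [← hgdef, hsg1, hsg3] at this
  rw [abs_of_nonneg (integral_nonneg fun x => by positivity)] at this
  set T := ∫ x, |g x| ^ p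
  set X := ∫ x, |g x + dd b (dd b ψ) x + dd c (dd c ψ) x| ^ p
  have h3 : 4 * T ≤ C ^ p * X + T := by
    refine le_of_mul_le_mul_left ?_ hC
    linarith
  linarith

/-- The basis vectors of `E3`. -/
abbrev bv (i : Fin 3) : E3 := EuclideanSpace.single i 1

lemma pd_eq_dd (i : Fin 3) (f : E3 → ℂ) : pd i f = dd (bv i) f := rfl

/-- The Laplacian. -/
def lap (f : E3 → ℂ) (x : E3) : ℂ := ∑ i, pd i (pd i f) x

section calculus

variable {F : Type*} [NormedAddCommGroup F] [NormedSpace ℝ F] {f g : E3 → F}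

lemma dd_add_dir (a b : E3) (f : E3 → F) : dd (a + b) f = fun x => dd a f x + dd b f x := by
  funext x; simp [dd]

lemma dd_smul_dir (c : ℝ) (a : E3) (f : E3 → F) : dd (c • a) f = fun x => c • dd a f x := by
  funext x; simp [dd]

lemma dd_fun_add (hf : Differentiable ℝ f) (hg : Differentiable ℝ g) (a : E3) :
    dd a (fun x => f x + g x) = fun x => dd a f x + dd a g x := by
  funext x; simp [dd, fderiv_fun_add (hf x) (hg x)]

lemma dd_fun_smul (hf : Differentiable ℝ f) (c : ℝ) (a : E3) :
    dd a (fun x => c • f x) = fun x => c • dd a f x := by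
  funext x; simp [dd, fderiv_fun_const_smul (hf x)]

lemma dd_comm (hf : ContDiff ℝ (⊤ : ℕ∞) f) (a b : E3) : dd a (dd b f) = dd b (dd a f) := by
  funext x
  have h1 : ∀ a b : E3, dd a (dd b f) x = fderiv ℝ (fderiv ℝ f) x a b := by
    intro a b
    have hd : DifferentiableAt ℝ (fderiv ℝ f) x :=
      ((hf.fderiv_right (m := (⊤ : ℕ∞)) (by simp)).differentiable (by simp)) x
    change fderiv ℝ (fun y => fderiv ℝ f y b) x a = _
    rw [fderiv_clm_apply hd (differentiableAt_const b)]
    simp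
  rw [h1, h1]
  exact (hf.contDiffAt.isSymmSndFDerivAt (by
    rw [minSmoothness_of_isRCLikeNormedField]; 
    exact (WithTop.coe_le_coe.2 le_top : ((2 : ℕ∞) : WithTop ℕ∞) ≤ ((⊤ : ℕ∞) : WithTop ℕ∞)))).eq a b

lemma dd_clm_comp {G : Type*} [NormedAddCommGroup G] [NormedSpace ℝ G] (L : F →L[ℝ] G)
    (hf : Differentiable ℝ f) (a : E3) : dd a (fun x => L (f x)) = fun x => L (dd a f x) := by
  funext x
  have := L.hasFDerivAt.comp x (hf x).hasFDerivAt
  simp only [dd]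
  rw [show (fun x => L (f x)) = L ∘ f from rfl, this.fderiv]
  rfl

end calculus

lemma contDiff_pd {f : E3 → ℂ} (hf : ContDiff ℝ (⊤ : ℕ∞) f) (i : Fin 3) :
    ContDiff ℝ (⊤ : ℕ∞) (pd i f) := contDiff_dd hf _

lemma hasCompactSupport_pd {f : E3 → ℂ} (hf : HasCompactSupport f) (i : Fin 3) :
    HasCompactSupport (pd i f) := hasCompactSupport_dd hf _

lemma contDiff_lap {f : E3 → ℂ} (hf : ContDiff ℝ (⊤ : ℕ∞) f) : ContDiff ℝ (⊤ : ℕ∞) (lap f) :=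
  ContDiff.sum fun i _ => contDiff_pd (contDiff_pd hf i) i

lemma tsupport_pd_subset (i : Fin 3) (f : E3 → ℂ) : tsupport (pd i f) ⊆ tsupport f :=
  tsupport_fderiv_apply_subset ℝ _

lemma IsCc.eLpNorm_eq {u : E3 → ℝ} (hu : IsCc u) {p : ℝ} (hp : 0 < p) :
    eLpNorm u (ENNReal.ofReal p) volume = ENNReal.ofReal ((∫ x, |u x| ^ p) ^ p⁻¹) := by
  have hm : MemLp u (ENNReal.ofReal p) volume := hu.1.memLp_of_hasCompactSupport hu.2
  rw [hm.eLpNorm_eq_integral_rpow_norm (by simpa using hp) (by simp),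
    ENNReal.toReal_ofReal hp.le]
  rfl

lemma exists_eLpNorm_dd_dd_le {p : ℝ} (hp : 1 < p) :
    ∃ C : NNReal, ∀ (a b c : E3) (ψ : E3 → ℝ), IsCcSmooth ψ →
      eLpNorm (dd a (dd a ψ)) (ENNReal.ofReal p) volume ≤
        C * eLpNorm (fun x => dd a (dd a ψ) x + dd b (dd b ψ) x + dd c (dd c ψ) x)
          (ENNReal.ofReal p) volume := by
  obtain ⟨C, hC, H⟩ := exists_integral_dd_dd_le hp
  refine ⟨(C ^ p⁻¹).toNNReal, fun a b c ψ hψ => ?_⟩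
  have hp0 : 0 < p := by linarith
  have h1 := (hψ.dd a |>.dd a).isCc
  have h2 := (h1.add (hψ.dd b |>.dd b).isCc).add (hψ.dd c |>.dd c).isCc
  rw [h1.eLpNorm_eq hp0, h2.eLpNorm_eq hp0]
  change _ ≤ ENNReal.ofReal _ * _
  rw [← ENNReal.ofReal_mul (by positivity), ← Real.mul_rpow hC.le
    (integral_nonneg fun x => by positivity)]
  refine ENNReal.ofReal_le_ofReal (Real.rpow_le_rpow (integral_nonneg fun x => by positivity)
    (H a b c ψ hψ) (by positivity))

/-- Real and imaginary parts commute with the derivatives and do not increase norms; each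
contributes one constant `C`. -/
lemma exists_eLpNorm_dd_dd_le_complex {p : ℝ} (hp : 1 < p) :
    ∃ C : NNReal, ∀ (a b c : E3) (ψ : E3 → ℂ), ContDiff ℝ (⊤ : ℕ∞) ψ → HasCompactSupport ψ →
      eLpNorm (dd a (dd a ψ)) (ENNReal.ofReal p) volume ≤
        C * eLpNorm (fun x => dd a (dd a ψ) x + dd b (dd b ψ) x + dd c (dd c ψ) x)
          (ENNReal.ofReal p) volume := by
  obtain ⟨C, H⟩ := exists_eLpNorm_dd_dd_le hp
  refine ⟨C + C, fun a b c ψ hψ hs => ?_⟩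
  have hp1 : 1 ≤ ENNReal.ofReal p := by simpa using hp.le
  have part : ∀ (L : ℂ →L[ℝ] ℝ), (∀ z, ‖L z‖ ≤ ‖z‖) →
      eLpNorm (fun x => L (dd a (dd a ψ) x)) (ENNReal.ofReal p) volume ≤
        C * eLpNorm (fun x => dd a (dd a ψ) x + dd b (dd b ψ) x + dd c (dd c ψ) x)
          (ENNReal.ofReal p) volume := by
    intro L hL
    have hLψ : IsCcSmooth (fun x => L (ψ x)) :=
      ⟨L.contDiff.comp hψ, hs.comp_left (g := L) (map_zero L)⟩
    have e : ∀ a, dd a (dd a fun x => L (ψ x)) = fun x => L (dd a (dd a ψ) x) := by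
      intro a
      rw [dd_clm_comp L (hψ.differentiable (by simp)),
        dd_clm_comp L ((contDiff_dd hψ a).differentiable (by simp))]
    have := H a b c _ hLψ
    rw [e a, e b, e c] at this
    refine this.trans ?_
    gcongr
    refine eLpNorm_mono fun x => ?_
    rw [← map_add, ← map_add]
    exact hL _
  have hre := part Complex.reCLM fun z => Complex.abs_re_le_norm z
  have him := part Complex.imCLM fun z => Complex.abs_im_le_norm z
  have hc := (contDiff_dd (contDiff_dd hψ a) a).continuous
  have e : dd a (dd a ψ) = (fun x => ((Complex.reCLM (dd a (dd a ψ) x) : ℝ) : ℂ)) +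
      fun x => ((Complex.imCLM (dd a (dd a ψ) x) : ℝ) : ℂ) * Complex.I := by
    funext x
    simp [Complex.re_add_im]
  have n1 : eLpNorm (fun x => ((Complex.reCLM (dd a (dd a ψ) x) : ℝ) : ℂ)) (ENNReal.ofReal p) volume
      = eLpNorm (fun x => Complex.reCLM (dd a (dd a ψ) x)) (ENNReal.ofReal p) volume :=
    eLpNorm_congr_norm_ae (Eventually.of_forall fun x => by simp)
  have n2 : eLpNorm (fun x => ((Complex.imCLM (dd a (dd a ψ) x) : ℝ) : ℂ) * Complex.I)
      (ENNReal.ofReal p) volume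
      = eLpNorm (fun x => Complex.imCLM (dd a (dd a ψ) x)) (ENNReal.ofReal p) volume :=
    eLpNorm_congr_norm_ae (Eventually.of_forall fun x => by simp)
  calc eLpNorm (dd a (dd a ψ)) (ENNReal.ofReal p) volume
      ≤ eLpNorm (fun x => ((Complex.reCLM (dd a (dd a ψ) x) : ℝ) : ℂ)) (ENNReal.ofReal p) volume
        + eLpNorm (fun x => ((Complex.imCLM (dd a (dd a ψ) x) : ℝ) : ℂ) * Complex.I)
          (ENNReal.ofReal p) volume := by
        conv_lhs => rw [e]
        refine eLpNorm_add_le ?_ ?_ hp1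
        · exact (Continuous.aestronglyMeasurable (by fun_prop))
        · exact (Continuous.aestronglyMeasurable (by fun_prop))
    _ ≤ _ := by
        rw [n1, n2]
        push_cast
        rw [add_mul]
        exact add_le_add hre him

/-- **Calderón-Zygmund inequality**: all second derivatives are controlled by the Laplacian. -/
theorem exists_eLpNorm_pd_pd_le {p : ℝ} (hp : 1 < p) :
    ∃ C : NNReal, ∀ (i j : Fin 3) (ψ : E3 → ℂ), ContDiff ℝ (⊤ : ℕ∞) ψ → HasCompactSupport ψ →
      eLpNorm (pd i (pd j ψ)) (ENNReal.ofReal p) volume ≤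
        C * eLpNorm (lap ψ) (ENNReal.ofReal p) volume := by
  obtain ⟨C, H⟩ := exists_eLpNorm_dd_dd_le_complex hp
  have hp1 : 1 ≤ ENNReal.ofReal p := by simpa using hp.le
  refine ⟨2 * C + C + C, fun i j ψ hψ hs => ?_⟩
  have perm : ∀ i : Fin 3, ∃ j k : Fin 3, ∀ f : Fin 3 → ℂ, f i + f j + f k = ∑ l, f l := by
    intro i
    fin_cases i
    · exact ⟨1, 2, fun f => by simp [Fin.sum_univ_three]⟩
    · exact ⟨0, 2, fun f => by simp [Fin.sum_univ_three]; ring⟩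
    · exact ⟨0, 1, fun f => by simp [Fin.sum_univ_three]; ring⟩
  have diag : ∀ i, eLpNorm (pd i (pd i ψ)) (ENNReal.ofReal p) volume ≤
      C * eLpNorm (lap ψ) (ENNReal.ofReal p) volume := by
    intro i
    obtain ⟨j, k, hjk⟩ := perm i
    have := H (bv i) (bv j) (bv k) ψ hψ hs
    refine this.trans_eq ?_
    congr 2
    funext x
    exact hjk fun l => pd l (pd l ψ) x
  have hd : ∀ a, Differentiable ℝ (dd a ψ) := fun a => (contDiff_dd hψ a).differentiable (by simp)
  have hdir : ∀ a b : E3, dd (a + b) (dd (a + b) ψ) = fun x =>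
      dd a (dd a ψ) x + dd b (dd b ψ) x + 2 * dd a (dd b ψ) x := by
    intro a b
    rw [dd_add_dir a b ψ, dd_add_dir, dd_fun_add (hd a) (hd b), dd_fun_add (hd a) (hd b)]
    funext x
    rw [dd_comm hψ b a]; ring
  rcases eq_or_ne i j with rfl | hij
  · refine (diag i).trans ?_
    gcongr
    refine le_add_of_nonneg_left (zero_le)
  obtain ⟨k, hk⟩ : ∃ k : Fin 3, ∀ f : Fin 3 → ℂ, f i + f j + f k = ∑ l, f l := by
    have e3 : ∀ i j : Fin 3, i ≠ j → ∃ k : Fin 3, Finset.univ = {i, j, k} ∧ k ≠ i ∧ k ≠ j := by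
      decide
    obtain ⟨k, h1, h2, h3⟩ := e3 i j hij
    refine ⟨k, fun f => ?_⟩
    rw [h1, Finset.sum_insert (by simp [hij, h2.symm]), Finset.sum_insert (by simp [h3.symm]),
      Finset.sum_singleton, add_assoc]
  -- The directions `eᵢ + eⱼ`, `eᵢ - eⱼ`, `√2 eₖ` are orthogonal of equal length, so their second
  -- derivatives add up to `2Δ`. The mixed derivative then follows by polarization.
  have hmix : eLpNorm (dd (bv i + bv j) (dd (bv i + bv j) ψ)) (ENNReal.ofReal p) volume ≤
      (2 * C : NNReal) * eLpNorm (lap ψ) (ENNReal.ofReal p) volume := by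
    refine (H (bv i + bv j) (bv i + (-1 : ℝ) • bv j) (√2 • bv k) ψ hψ hs).trans_eq ?_
    have e : (fun x => dd (bv i + bv j) (dd (bv i + bv j) ψ) x +
        dd (bv i + (-1 : ℝ) • bv j) (dd (bv i + (-1 : ℝ) • bv j) ψ) x +
        dd (√2 • bv k) (dd (√2 • bv k) ψ) x) = (2 : ℂ) • lap ψ := by
      funext x
      rw [hdir, hdir]
      have s1 : ∀ (c : ℝ) (a : E3), dd (c • a) (dd (c • a) ψ) = fun x => c ^ 2 • dd a (dd a ψ) x := by
        intro c a
        rw [dd_smul_dir c a ψ, dd_smul_dir, dd_fun_smul (hd a)]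
        funext x
        rw [smul_smul, sq]
      rw [s1, s1, dd_smul_dir (-1) (bv j) ψ, dd_fun_smul (hd _)]
      have := hk fun l => pd l (pd l ψ) x
      simp only [pd_eq_dd] at this
      simp only [Pi.smul_apply, lap, pd_eq_dd, ← this, Real.sq_sqrt (by norm_num : (0:ℝ) ≤ 2)]
      simp
      ring
    rw [e, eLpNorm_const_smul]
    push_cast
    rw [mul_comm (2 : ENNReal), mul_assoc]
    congr 2
    simp [enorm_eq_nnnorm]
  have e : pd i (pd j ψ) = (2⁻¹ : ℂ) • ((dd (bv i + bv j) (dd (bv i + bv j) ψ) -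
      dd (bv i) (dd (bv i) ψ)) - dd (bv j) (dd (bv j) ψ)) := by
    funext x
    rw [hdir]
    simp only [Pi.smul_apply, Pi.sub_apply, pd_eq_dd, smul_eq_mul]
    ring
  have hm : ∀ a, AEStronglyMeasurable (dd a (dd a ψ)) volume := fun a =>
    (contDiff_dd (contDiff_dd hψ a) a).continuous.aestronglyMeasurable
  have hhalf : ‖(2⁻¹ : ℂ)‖ₑ ≤ 1 := by
    rw [← ofReal_norm]
    simp only [norm_inv, Complex.norm_ofNat]
    exact ENNReal.ofReal_le_one.2 (by norm_num)
  rw [e, eLpNorm_const_smul]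
  calc _ ≤ 1 * (eLpNorm (dd (bv i + bv j) (dd (bv i + bv j) ψ)) (ENNReal.ofReal p) volume +
        eLpNorm (dd (bv i) (dd (bv i) ψ)) (ENNReal.ofReal p) volume +
        eLpNorm (dd (bv j) (dd (bv j) ψ)) (ENNReal.ofReal p) volume) := by
        refine mul_le_mul hhalf ?_ (zero_le) (zero_le)
        refine (eLpNorm_sub_le ((hm _).sub (hm _)) (hm _) hp1).trans ?_
        gcongr
        exact eLpNorm_sub_le (hm _) (hm _) hp1
    _ ≤ _ := by
        rw [one_mul]
        push_cast
        rw [add_mul, add_mul]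
        refine add_le_add (add_le_add ?_ (diag i)) (diag j)
        simpa using hmix

/-! ### Convolution estimates, first derivatives and integration by parts -/

/-- **Minkowski's integral inequality** for averages of translates. -/
lemma lintegral_lintegral_translate_rpow_le {S : Type*} [MeasurableSpace S] (ν : Measure S)
    [SFinite ν] {τ : S → E3} (hτ : Measurable τ) {G : E3 → ENNReal} (hG : Measurable G)
    {p : ℝ} (hp : 1 < p) :
    ∫⁻ x, (∫⁻ s, G (x - τ s) ∂ν) ^ p ≤ ν Set.univ ^ p * ∫⁻ x, G x ^ p := by
  have hpq : p.HolderConjugate (p / (p - 1)) := Real.HolderConjugate.conjExponent hp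
  have hm : Measurable fun z : E3 × S => G (z.1 - τ z.2) :=
    hG.comp (measurable_fst.sub (hτ.comp measurable_snd))
  -- Hölder against the constant 1; Tonelli and translation invariance do the rest.
  have h1 : ∀ x, (∫⁻ s, G (x - τ s) ∂ν) ^ p ≤
      (∫⁻ s, G (x - τ s) ^ p ∂ν) * ν Set.univ ^ (p - 1) := by
    intro x
    have hx : Measurable fun s => G (x - τ s) := hm.comp (measurable_const.prodMk measurable_id)
    have := ENNReal.lintegral_mul_le_Lp_mul_Lq ν hpq hx.aemeasurable
      (aemeasurable_const (b := (1 : ENNReal)))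
    simp only [Pi.mul_apply, mul_one, ENNReal.one_rpow, lintegral_one] at this
    refine (ENNReal.rpow_le_rpow this hpq.nonneg).trans_eq ?_
    rw [ENNReal.mul_rpow_of_nonneg _ _ hpq.nonneg, ← ENNReal.rpow_mul, ← ENNReal.rpow_mul]
    congr 1
    · rw [one_div_mul_cancel hpq.ne_zero, ENNReal.rpow_one]
    · congr 1
      have := hpq.ne_zero
      have := hpq.sub_one_ne_zero
      field_simp
  calc ∫⁻ x, (∫⁻ s, G (x - τ s) ∂ν) ^ p
      ≤ ∫⁻ x, (∫⁻ s, G (x - τ s) ^ p ∂ν) * ν Set.univ ^ (p - 1) := lintegral_mono h1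
    _ = (∫⁻ x, ∫⁻ s, G (x - τ s) ^ p ∂ν) * ν Set.univ ^ (p - 1) := by
        rw [lintegral_mul_const]
        exact (hm.pow_const p).lintegral_prod_right'
    _ = (ν Set.univ * ∫⁻ x, G x ^ p) * ν Set.univ ^ (p - 1) := by
        congr 1
        rw [lintegral_lintegral_swap (hm.pow_const p).aemeasurable]
        have : ∀ s, ∫⁻ x, G (x - τ s) ^ p = ∫⁻ x, G x ^ p := fun s =>
          lintegral_sub_right_eq_self (fun x => G x ^ p) (τ s)
        simp_rw [this]
        rw [lintegral_const, mul_comm]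
    _ = ν Set.univ ^ p * ∫⁻ x, G x ^ p := by
        rw [mul_right_comm]
        congr 1
        conv_lhs => rw [← ENNReal.rpow_one (ν Set.univ)]
        rw [← ENNReal.rpow_mul, ← ENNReal.rpow_add_of_nonneg _ _ (by norm_num) (by linarith)]
        congr 1; ring

lemma eLpNorm_le_of_enorm_le_lintegral_translate {S : Type*} [MeasurableSpace S] (ν : Measure S)
    [SFinite ν] {τ : S → E3} (hτ : Measurable τ) {f g : E3 → ℂ} (hg : Measurable g)
    {p : ℝ} (hp : 1 < p) (h : ∀ x, ‖f x‖ₑ ≤ ∫⁻ s, ‖g (x - τ s)‖ₑ ∂ν) :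
    eLpNorm f (ENNReal.ofReal p) volume ≤ ν Set.univ * eLpNorm g (ENNReal.ofReal p) volume := by
  have hp0 : 0 < p := by linarith
  have h0 : ENNReal.ofReal p ≠ 0 := by simpa using hp0
  rw [eLpNorm_eq_lintegral_rpow_enorm_toReal h0 (by simp),
    eLpNorm_eq_lintegral_rpow_enorm_toReal h0 (by simp), ENNReal.toReal_ofReal hp0.le]
  calc (∫⁻ x, ‖f x‖ₑ ^ p) ^ (1 / p)
      ≤ (∫⁻ x, (∫⁻ s, ‖g (x - τ s)‖ₑ ∂ν) ^ p) ^ (1 / p) := by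
        gcongr with x
        exact h x
    _ ≤ (ν Set.univ ^ p * ∫⁻ x, ‖g x‖ₑ ^ p) ^ (1 / p) := by
        gcongr
        exact lintegral_lintegral_translate_rpow_le ν hτ hg.enorm hp
    _ = _ := by
        rw [ENNReal.mul_rpow_of_nonneg _ _ (by positivity), ← ENNReal.rpow_mul,
          mul_one_div_cancel hp0.ne', ENNReal.rpow_one]

/-- **Young's inequality** for an integrable kernel. -/
lemma eLpNorm_integral_kernel_mul_le {κ f : E3 → ℂ} (hκ : Measurable κ) (hf : Measurable f) {p : ℝ}
    (hp : 1 < p) :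
    eLpNorm (fun x => ∫ y, κ (x - y) * f y) (ENNReal.ofReal p) volume ≤
      (∫⁻ x, ‖κ x‖ₑ) * eLpNorm f (ENNReal.ofReal p) volume := by
  have := eLpNorm_le_of_enorm_le_lintegral_translate (volume.withDensity fun y => ‖κ y‖ₑ)
    measurable_id (f := fun x => ∫ y, κ (x - y) * f y) hf hp fun x => by
      rw [lintegral_withDensity_eq_lintegral_mul _ hκ.enorm (by fun_prop)]
      refine (enorm_integral_le_lintegral_enorm _).trans_eq ?_
      rw [← lintegral_sub_left_eq_self _ x]
      simp [enorm_mul]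
  simpa using this

/-- First derivatives are controlled by the function and its second derivatives. -/
lemma eLpNorm_dd_le {ψ : E3 → ℂ} (hψ : ContDiff ℝ (⊤ : ℕ∞) ψ) {p : ℝ} (hp : 1 < p) (a : E3) :
    eLpNorm (dd a ψ) (ENNReal.ofReal p) volume ≤ 2 * eLpNorm ψ (ENNReal.ofReal p) volume +
      eLpNorm (dd a (dd a ψ)) (ENNReal.ofReal p) volume := by
  have hp1 : 1 ≤ ENNReal.ofReal p := by simpa using hp.le
  have c0 := hψ.continuous
  have c1 := (contDiff_dd hψ a).continuous
  have c2 := (contDiff_dd (contDiff_dd hψ a) a).continuous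
  set r : E3 → ℂ := fun x => dd a ψ x - (ψ (x + a) - ψ x) with hr
  have hrbd : eLpNorm r (ENNReal.ofReal p) volume ≤
      eLpNorm (dd a (dd a ψ)) (ENNReal.ofReal p) volume := by
    have := eLpNorm_le_of_enorm_le_lintegral_translate
      ((volume : Measure ℝ).restrict (Set.Ioc 0 1)) (τ := fun t => -(t • a))
      (by fun_prop) (f := r) c2.measurable hp fun x => ?_
    · simpa using this
    -- In this combination the first derivatives cancel upon differentiation, so integrating over
    -- `[0, 1]` is Taylor's formula with integral remainder.
    have hd : ∀ t : ℝ, HasDerivAt (fun t : ℝ => ψ (x + t • a) + ((1 - t : ℝ) : ℂ) * dd a ψ (x + t • a))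
        (((1 - t : ℝ) : ℂ) * dd a (dd a ψ) (x + t • a)) t := by
      intro t
      have e : HasDerivAt (fun t : ℝ => ((1 - t : ℝ) : ℂ)) (-1) t := by
        have := ((hasDerivAt_id t).const_sub 1).ofReal_comp
        simpa using! this
      refine ((hasDerivAt_line hψ x a t).add
        (e.mul (hasDerivAt_line (contDiff_dd hψ a) x a t))).congr_deriv ?_
      ring
    have ftc := intervalIntegral.integral_eq_sub_of_hasDerivAt (a := 0) (b := 1)
      (fun t _ => hd t) (Continuous.intervalIntegrable (by fun_prop) 0 1)
    have e : r x = -∫ t in (0 : ℝ)..1, ((1 - t : ℝ) : ℂ) * dd a (dd a ψ) (x + t • a) := by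
      rw [ftc]; simp [hr]; ring
    rw [e, enorm_neg, intervalIntegral.integral_of_le zero_le_one]
    refine (enorm_integral_le_lintegral_enorm _).trans ?_
    refine lintegral_mono_ae ?_
    filter_upwards [ae_restrict_mem measurableSet_Ioc] with t ht
    rw [sub_neg_eq_add, enorm_mul]
    refine mul_le_of_le_one_left (zero_le) ?_
    rw [← ofReal_norm, ENNReal.ofReal_le_one, Complex.norm_real, Real.norm_eq_abs, abs_le]
    constructor <;> linarith [ht.1, ht.2]
  have htr : eLpNorm (fun x => ψ (x + a)) (ENNReal.ofReal p) volume
      = eLpNorm ψ (ENNReal.ofReal p) volume :=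
    eLpNorm_comp_measurePreserving c0.aestronglyMeasurable (measurePreserving_add_right volume a)
  have e : dd a ψ = ((fun x => ψ (x + a)) - ψ) + r := by funext x; simp [hr]
  have m1 : AEStronglyMeasurable (fun x => ψ (x + a)) volume :=
    Continuous.aestronglyMeasurable (by fun_prop)
  calc eLpNorm (dd a ψ) (ENNReal.ofReal p) volume
      ≤ eLpNorm ((fun x => ψ (x + a)) - ψ) (ENNReal.ofReal p) volume +
        eLpNorm r (ENNReal.ofReal p) volume := by
        conv_lhs => rw [e]
        exact eLpNorm_add_le (m1.sub c0.aestronglyMeasurable)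
          (Continuous.aestronglyMeasurable (by fun_prop)) hp1
    _ ≤ _ := by
        refine add_le_add ((eLpNorm_sub_le m1 c0.aestronglyMeasurable hp1).trans_eq ?_) hrbd
        rw [htr, two_mul]

/-- Integration by parts against a compactly supported function. -/
lemma integral_mul_dd {f φ : E3 → ℂ} (hf : ContDiff ℝ (⊤ : ℕ∞) f) (hφ : ContDiff ℝ (⊤ : ℕ∞) φ)
    (hs : HasCompactSupport φ) (a : E3) : ∫ x, f x * dd a φ x = -∫ x, dd a f x * φ x := by
  have hs' := hasCompactSupport_dd hs a
  refine integral_mul_fderiv_eq_neg_fderiv_mul_of_integrable ?_ ?_ ?_ ?_ ?_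
  · exact ((contDiff_dd hf a).continuous.mul hφ.continuous).integrable_of_hasCompactSupport
      hs.mul_left
  · exact (hf.continuous.mul (contDiff_dd hφ a).continuous).integrable_of_hasCompactSupport
      hs'.mul_left
  · exact (hf.continuous.mul hφ.continuous).integrable_of_hasCompactSupport hs.mul_left
  · exact fun x _ => (hf.differentiable (by simp)) x
  · exact fun x _ => (hφ.differentiable (by simp)) x

lemma integral_mul_lap {f φ : E3 → ℂ} (hf : ContDiff ℝ (⊤ : ℕ∞) f) (hφ : ContDiff ℝ (⊤ : ℕ∞) φ)
    (hs : HasCompactSupport φ) : ∫ x, f x * lap φ x = ∫ x, lap f x * φ x := by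
  have h1 : ∀ i, ∫ x, f x * pd i (pd i φ) x = ∫ x, pd i (pd i f) x * φ x := by
    intro i
    simp only [pd_eq_dd]
    rw [integral_mul_dd hf (contDiff_dd hφ _) (hasCompactSupport_dd hs _),
      integral_mul_dd (contDiff_dd hf _) hφ hs, neg_neg]
  have i1 : ∀ i, Integrable fun x => f x * pd i (pd i φ) x := fun i =>
    (hf.continuous.mul (contDiff_pd (contDiff_pd hφ i) i).continuous).integrable_of_hasCompactSupport
      (hasCompactSupport_pd (hasCompactSupport_pd hs i) i).mul_left
  have i2 : ∀ i, Integrable fun x => pd i (pd i f) x * φ x := fun i =>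
    ((contDiff_pd (contDiff_pd hf i) i).continuous.mul hφ.continuous).integrable_of_hasCompactSupport
      hs.mul_left
  simp only [lap, Finset.mul_sum, Finset.sum_mul]
  rw [integral_finsetSum _ fun i _ => i1 i, integral_finsetSum _ fun i _ => i2 i]
  exact Finset.sum_congr rfl fun i _ => h1 i

/-! ### The fundamental solution of the Helmholtz operator -/

/-- The regularized distance `√(‖x‖² + ε²)`. -/
def regNorm (ε : ℝ) (x : E3) : ℝ := √(‖x‖ ^ 2 + ε ^ 2)

/-- The regularized fundamental solution. -/
def thetaReg (α : ℂ) (ε : ℝ) (x : E3) : ℂ :=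
  -Complex.exp (Complex.I * α * (regNorm ε x : ℂ)) / (4 * (Real.pi : ℂ) * (regNorm ε x : ℂ))

lemma regNorm_pos {ε : ℝ} (hε : 0 < ε) (x : E3) : 0 < regNorm ε x :=
  Real.sqrt_pos.2 (by positivity)

lemma regNorm_sq (ε : ℝ) (x : E3) : regNorm ε x ^ 2 = ‖x‖ ^ 2 + ε ^ 2 :=
  Real.sq_sqrt (by positivity)

lemma contDiff_regNorm {ε : ℝ} (hε : 0 < ε) : ContDiff ℝ (⊤ : ℕ∞) (regNorm ε) :=
  ((contDiff_norm_sq ℝ).add contDiff_const).sqrt fun x => by positivity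

lemma hasFDerivAt_regNorm {ε : ℝ} (hε : 0 < ε) (x : E3) :
    HasFDerivAt (regNorm ε) ((regNorm ε x)⁻¹ • innerSL ℝ x) x := by
  have := ((hasStrictFDerivAt_norm_sq x).hasFDerivAt.add_const (ε ^ 2)).sqrt
    (by positivity)
  refine this.congr_fderiv ?_
  ext v
  change 1 / (2 * regNorm ε x) * _ = _
  have := (regNorm_pos hε x).ne'
  simp
  field_simp

lemma hasFDerivAt_comp_regNorm {ε : ℝ} (hε : 0 < ε) {G : ℝ → ℂ} {G' : ℂ} (x : E3)
    (hG : HasDerivAt G G' (regNorm ε x)) :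
    HasFDerivAt (fun y => G (regNorm ε y))
      (((regNorm ε x)⁻¹ • innerSL ℝ x).smulRight G') x :=
  hG.hasFDerivAt.comp x (hasFDerivAt_regNorm hε x)

lemma pd_comp_regNorm {ε : ℝ} (hε : 0 < ε) {G : ℝ → ℂ} {G' : ℂ} (x : E3)
    (hG : HasDerivAt G G' (regNorm ε x)) (i : Fin 3) :
    pd i (fun y => G (regNorm ε y)) x = (x i : ℂ) * (G' / regNorm ε x) := by
  rw [pd, (hasFDerivAt_comp_regNorm hε x hG).fderiv]
  simp [EuclideanSpace.inner_single_right]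
  ring

lemma hasDerivAt_exp_mul_ofReal (α : ℂ) (s : ℝ) :
    HasDerivAt (fun s : ℝ => Complex.exp (Complex.I * α * s))
      (Complex.I * α * Complex.exp (Complex.I * α * s)) s := by
  have h1 : HasDerivAt (fun s : ℝ => Complex.I * α * (s : ℂ)) (Complex.I * α) s := by
    simpa using! (Complex.ofRealCLM.hasDerivAt (x := s)).const_mul (Complex.I * α)
  simpa [mul_comm] using h1.cexp

/-- With `F' = s F₁` and `F₁' = s F₂`, a function `F` of the regularized distance `s` has Laplacian
`3 F₁ + ‖x‖² F₂`. If `‖x‖²` were `s²`, the radial Helmholtz equation for `e^{iαs}/s` would give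
zero; since `‖x‖² = s² - ε²`, the defect is `-ε² F₂`. -/
lemma lap_exp_div_regNorm (α : ℂ) {ε : ℝ} (hε : 0 < ε) (x : E3) :
    lap (fun y => Complex.exp (Complex.I * α * (regNorm ε y : ℂ)) / (regNorm ε y : ℂ)) x
      + α ^ 2 * (Complex.exp (Complex.I * α * (regNorm ε x : ℂ)) / (regNorm ε x : ℂ)) =
    -(ε : ℂ) ^ 2 * (Complex.exp (Complex.I * α * (regNorm ε x : ℂ)) *
      (3 - 3 * Complex.I * α * regNorm ε x - α ^ 2 * (regNorm ε x : ℂ) ^ 2)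
        / (regNorm ε x : ℂ) ^ 5) := by
  set e : ℝ → ℂ := fun s => Complex.exp (Complex.I * α * s)
  set F1 : ℝ → ℂ := fun s => e s * (Complex.I * α * s - 1) / (s : ℂ) ^ 3
  set F2 : ℝ → ℂ := fun s => e s * (3 - 3 * Complex.I * α * s - α ^ 2 * (s : ℂ) ^ 2) / (s : ℂ) ^ 5
  have he := hasDerivAt_exp_mul_ofReal α
  have hid : ∀ s : ℝ, HasDerivAt (fun s : ℝ => (s : ℂ)) 1 s := fun s =>
    Complex.ofRealCLM.hasDerivAt
  have h0 : ∀ s : ℝ, 0 < s → HasDerivAt (fun s : ℝ => e s / (s : ℂ)) ((s : ℂ) * F1 s) s := by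
    intro s hs
    have hs' : (s : ℂ) ≠ 0 := by exact_mod_cast hs.ne'
    refine ((he s).div (hid s) hs').congr_deriv ?_
    simp only [F1]
    field_simp
    ring
  have h1 : ∀ s : ℝ, 0 < s → HasDerivAt F1 ((s : ℂ) * F2 s) s := by
    intro s hs
    have hs' : (s : ℂ) ≠ 0 := by exact_mod_cast hs.ne'
    refine (((he s).mul (((hid s).const_mul (Complex.I * α)).sub_const 1)).div ((hid s).pow 3)
      (pow_ne_zero 3 hs')).congr_deriv ?_
    simp only [F2, e]
    field_simp
    simp only [Pi.pow_apply, Pi.mul_apply]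
    have hI : Complex.I ^ 2 = -1 := Complex.I_sq
    push_cast
    linear_combination (norm := ring_nf) (Complex.exp (Complex.I * α * s) * (s : ℂ) ^ 8 * α ^ 2) * hI
  have p1 : ∀ i, pd i (fun y => e (regNorm ε y) / (regNorm ε y : ℂ)) =
      fun y => (y i : ℂ) * F1 (regNorm ε y) := by
    intro i
    funext y
    rw [pd_comp_regNorm hε y (h0 _ (regNorm_pos hε y))]
    have : (regNorm ε y : ℂ) ≠ 0 := by exact_mod_cast (regNorm_pos hε y).ne'
    field_simp
  have p2 : ∀ i, pd i (pd i (fun y => e (regNorm ε y) / (regNorm ε y : ℂ))) x =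
      F1 (regNorm ε x) + (x i : ℂ) ^ 2 * F2 (regNorm ε x) := by
    intro i
    rw [p1]
    have d1 : HasFDerivAt (fun y : E3 => ((y i : ℝ) : ℂ))
        (Complex.ofRealCLM.comp (EuclideanSpace.proj i)) x :=
      (Complex.ofRealCLM.comp (EuclideanSpace.proj i : E3 →L[ℝ] ℝ)).hasFDerivAt
    have d2 := hasFDerivAt_comp_regNorm hε x (h1 _ (regNorm_pos hε x))
    have : (regNorm ε x : ℂ) ≠ 0 := by exact_mod_cast (regNorm_pos hε x).ne'
    change fderiv ℝ ((fun y : E3 => ((y i : ℝ) : ℂ)) * fun y => F1 (regNorm ε y)) x _ = _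
    rw [(d1.mul d2).fderiv]
    simp [EuclideanSpace.inner_single_right]
    field_simp
    ring
  have hs : (regNorm ε x : ℂ) ≠ 0 := by exact_mod_cast (regNorm_pos hε x).ne'
  have hn : (regNorm ε x : ℂ) ^ 2 = (x 0 : ℂ) ^ 2 + (x 1 : ℂ) ^ 2 + (x 2 : ℂ) ^ 2 + (ε : ℂ) ^ 2 := by
    have := regNorm_sq ε x
    rw [EuclideanSpace.real_norm_sq_eq, Fin.sum_univ_three] at this
    exact_mod_cast this
  change lap (fun y => e (regNorm ε y) / (regNorm ε y : ℂ)) x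
      + α ^ 2 * (e (regNorm ε x) / (regNorm ε x : ℂ)) = -(ε : ℂ) ^ 2 * F2 (regNorm ε x)
  simp only [lap, p2, Fin.sum_univ_three]
  have key : 3 * F1 (regNorm ε x) + (regNorm ε x : ℂ) ^ 2 * F2 (regNorm ε x)
      + α ^ 2 * (e (regNorm ε x) / (regNorm ε x : ℂ)) = 0 := by
    simp only [F1, F2]
    field_simp
    ring
  linear_combination key - F2 (regNorm ε x) * hn

lemma contDiff_thetaReg (α : ℂ) {ε : ℝ} (hε : 0 < ε) :
    ContDiff ℝ (⊤ : ℕ∞) (thetaReg α ε) := by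
  have h1 : ContDiff ℝ (⊤ : ℕ∞) fun x => (regNorm ε x : ℂ) :=
    Complex.ofRealCLM.contDiff.comp (contDiff_regNorm hε)
  refine (contDiff_const.mul h1).cexp.neg.mul ((contDiff_const.mul h1).inv fun x => ?_)
  have h2 : (regNorm ε x : ℂ) ≠ 0 := by exact_mod_cast (regNorm_pos hε x).ne'
  have h3 : (Real.pi : ℂ) ≠ 0 := by exact_mod_cast Real.pi_ne_zero
  exact mul_ne_zero (mul_ne_zero (by norm_num) h3) h2

lemma lap_thetaReg (α : ℂ) {ε : ℝ} (hε : 0 < ε) (x : E3) :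
    lap (thetaReg α ε) x + α ^ 2 * thetaReg α ε x =
      (ε : ℂ) ^ 2 * (Complex.exp (Complex.I * α * (regNorm ε x : ℂ)) *
      (3 - 3 * Complex.I * α * regNorm ε x - α ^ 2 * (regNorm ε x : ℂ) ^ 2)
        / (4 * Real.pi * (regNorm ε x : ℂ) ^ 5)) := by
  have hpi : (Real.pi : ℂ) ≠ 0 := by exact_mod_cast Real.pi_ne_zero
  have hs : ∀ x, (regNorm ε x : ℂ) ≠ 0 := fun x => by exact_mod_cast (regNorm_pos hε x).ne'
  set c : ℂ := -1 / (4 * Real.pi) with hc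
  set g : E3 → ℂ := fun y => Complex.exp (Complex.I * α * (regNorm ε y : ℂ)) / (regNorm ε y : ℂ)
  have h1 : ContDiff ℝ (⊤ : ℕ∞) fun x => (regNorm ε x : ℂ) :=
    Complex.ofRealCLM.contDiff.comp (contDiff_regNorm hε)
  have hg : ContDiff ℝ (⊤ : ℕ∞) g := (contDiff_const.mul h1).cexp.mul (h1.inv hs)
  have e : thetaReg α ε = fun x => c * g x := by
    funext x
    simp only [thetaReg, g, hc]
    have := hs x
    field_simp
  have hmul : ∀ (f : E3 → ℂ), Differentiable ℝ f → ∀ i, pd i (fun x => c * f x) = fun x => c * pd i f x := by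
    intro f hf i
    funext x
    simp only [pd]
    rw [fderiv_const_mul (hf x)]
    rfl
  have key := lap_exp_div_regNorm α hε x
  change lap g x + α ^ 2 * g x = _ at key
  have e2 : lap (thetaReg α ε) x = c * lap g x := by
    rw [e]
    simp only [lap, Finset.mul_sum]
    refine Finset.sum_congr rfl fun i _ => ?_
    rw [hmul g (hg.differentiable (by simp)), hmul _ ((contDiff_pd hg i).differentiable (by simp))]
  have e3 : thetaReg α ε x = c * g x := by rw [e]
  rw [e2, e3, show c * lap g x + α ^ 2 * (c * g x) = c * (lap g x + α ^ 2 * g x) by ring, key, hc]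
  have := hs x
  field_simp

/-- In polar coordinates the density `r²` cancels the singularity. -/
lemma integrableOn_inv_norm (R : ℝ) :
    Integrable (fun x : E3 => (Metric.closedBall (0 : E3) R).indicator (fun x => ‖x‖⁻¹) x) := by
  have e : (fun x : E3 => (Metric.closedBall (0 : E3) R).indicator (fun x => ‖x‖⁻¹) x) =
      fun x => (Set.Iic R).indicator (fun r => r⁻¹) ‖x‖ := by
    funext x
    by_cases h : ‖x‖ ≤ R <;> simp [Set.indicator, h]
  rw [e, integrable_fun_norm_addHaar volume (f := (Set.Iic R).indicator (fun r => r⁻¹))]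
  have e2 : Set.EqOn (fun r : ℝ => (Set.Ioc 0 R).indicator (fun r => r) r)
      (fun y : ℝ => y ^ (Module.finrank ℝ E3 - 1) • (Set.Iic R).indicator (fun r => r⁻¹) y)
      (Set.Ioi 0) := by
    intro r hr
    have hr' : (0 : ℝ) < r := hr
    by_cases h : r ≤ R
    · simp [Set.indicator, h, hr']
      field_simp
    · simp [Set.indicator, h]
  refine IntegrableOn.congr_fun ?_ e2 measurableSet_Ioi
  refine Integrable.integrableOn ?_
  rw [integrable_indicator_iff measurableSet_Ioc]
  exact (continuous_id.integrableOn_Icc).mono_set Set.Ioc_subset_Icc_self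

/-- The mass of the limiting kernel, which fixes the constant `4π` in `theta`. The radial integrand
has the primitive `r³ / (3 (1 + r²)^{3/2})`. -/
lemma integral_inv_one_add_sq_pow :
    ∫ x : E3, ((√(1 + ‖x‖ ^ 2)) ^ 5)⁻¹ = 4 * Real.pi / 3 := by
  have h1 : ∫ r in Set.Ioi (0 : ℝ), r ^ 2 * ((√(1 + r ^ 2)) ^ 5)⁻¹ = 1 / 3 - 0 := by
    have hd : ∀ r : ℝ, HasDerivAt (fun r => r ^ 3 / (3 * √(1 + r ^ 2) ^ 3))
        (r ^ 2 * ((√(1 + r ^ 2)) ^ 5)⁻¹) r := by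
      intro r
      have hp : 0 < 1 + r ^ 2 := by positivity
      have hs : HasDerivAt (fun r : ℝ => √(1 + r ^ 2)) (r / √(1 + r ^ 2)) r := by
        have := (((hasDerivAt_id r).pow 2).const_add 1).sqrt hp.ne'
        refine this.congr_deriv ?_
        simp
        field_simp
      have hq := Real.sq_sqrt hp.le
      set s := √(1 + r ^ 2) with hsdef
      have hs0 : 0 < s := Real.sqrt_pos.2 hp
      refine (((hasDerivAt_id r).pow 3).div ((hs.pow 3).const_mul 3) (by
        simp only [Pi.pow_apply]; positivity)).congr_deriv ?_
      simp only [id, Pi.pow_apply, ← hsdef]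
      field_simp
      simp
      linear_combination (3 * r ^ 2 * s ^ 2) * hq
    have hlim : Tendsto (fun r : ℝ => r ^ 3 / (3 * √(1 + r ^ 2) ^ 3)) atTop (𝓝 (1 / 3)) := by
      have e : ∀ᶠ r : ℝ in atTop, 1 / 3 * ((√(1 + (r⁻¹) ^ 2))⁻¹) ^ 3 = r ^ 3 / (3 * √(1 + r ^ 2) ^ 3) := by
        filter_upwards [eventually_gt_atTop 0] with r hr
        have : √(1 + r ^ 2) = r * √(1 + (r⁻¹) ^ 2) := by
          rw [← Real.sqrt_sq hr.le, ← Real.sqrt_mul (by positivity), Real.sqrt_sq hr.le]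
          congr 1; field_simp; ring
        rw [this]
        have : 0 < √(1 + (r⁻¹) ^ 2) := Real.sqrt_pos.2 (by positivity)
        generalize √(1 + (r⁻¹) ^ 2) = u at *
        field_simp
      refine Tendsto.congr' e ?_
      have hc : ContinuousAt (fun t : ℝ => 1 / 3 * ((√(1 + t ^ 2))⁻¹) ^ 3) 0 := by
        have : √(1 + (0 : ℝ) ^ 2) ≠ 0 := by simp
        have h : ContinuousAt (fun t : ℝ => √(1 + t ^ 2)) 0 := by fun_prop
        exact continuousAt_const.mul ((h.inv₀ this).pow 3)
      have := hc.tendsto.comp tendsto_inv_atTop_zero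
      have h0 : (1 : ℝ) / 3 * ((√(1 + (0 : ℝ) ^ 2))⁻¹) ^ 3 = 1 / 3 := by simp
      rw [h0] at this
      exact this
    have := integral_Ioi_of_hasDerivAt_of_nonneg' (a := 0) (fun r _ => hd r)
      (fun r _ => by positivity) hlim
    simpa using this
  have := integral_fun_norm_addHaar (volume : Measure E3) (fun r : ℝ => ((√(1 + r ^ 2)) ^ 5)⁻¹)
  rw [this]
  have hv : (volume : Measure E3).real (Metric.ball 0 1) = Real.pi * 4 / 3 := by
    rw [Measure.real, EuclideanSpace.volume_ball_fin_three]
    simp [ENNReal.toReal_ofReal (show 0 ≤ Real.pi * 4 / 3 by positivity)]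
  have hf : Module.finrank ℝ E3 = 3 := by simp
  rw [hv, hf]
  simp only [smul_eq_mul, nsmul_eq_mul, Nat.add_one_sub_one] at *
  rw [h1]
  push_cast
  ring

lemma integrable_inv_one_add_sq_pow :
    Integrable fun x : E3 => ((√(1 + ‖x‖ ^ 2)) ^ 5)⁻¹ := by
  by_contra h
  have := integral_inv_one_add_sq_pow
  rw [integral_undef h] at this
  have := Real.pi_pos
  linarith

lemma norm_theta_le (α : ℂ) (x : E3) : ‖theta α x‖ ≤ Real.exp (‖α‖ * ‖x‖) * ‖x‖⁻¹ := by
  have h1 : ‖Complex.exp (Complex.I * α * (‖x‖ : ℂ))‖ ≤ Real.exp (‖α‖ * ‖x‖) := by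
    refine (Complex.norm_exp_le_exp_norm _).trans_eq ?_
    simp
  rw [theta, norm_div, norm_neg, norm_mul, norm_mul]
  simp only [Complex.norm_ofNat, Complex.norm_real, Real.norm_eq_abs, abs_norm,
    abs_of_pos Real.pi_pos]
  rw [div_eq_mul_inv, mul_inv]
  have h2 : (4 * Real.pi)⁻¹ ≤ 1 := inv_le_one_of_one_le₀ (by nlinarith [Real.pi_gt_three])
  have h3 : 0 ≤ ‖x‖⁻¹ := by positivity
  calc _ ≤ Real.exp (‖α‖ * ‖x‖) * (1 * ‖x‖⁻¹) := by gcongr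
    _ = _ := by rw [one_mul]

lemma norm_thetaReg_le (α : ℂ) {ε : ℝ} (hε : 0 < ε) (hε1 : ε ≤ 1) (x : E3) (hx : x ≠ 0) :
    ‖thetaReg α ε x‖ ≤ Real.exp (‖α‖ * (‖x‖ + 1)) * ‖x‖⁻¹ := by
  have hs := regNorm_pos hε x
  have hq := regNorm_sq ε x
  have hx0 : 0 < ‖x‖ := norm_pos_iff.2 hx
  have hle : regNorm ε x ≤ ‖x‖ + 1 := by nlinarith
  have hge : ‖x‖ ≤ regNorm ε x := by nlinarith
  have h1 : ‖Complex.exp (Complex.I * α * (regNorm ε x : ℂ))‖ ≤ Real.exp (‖α‖ * (‖x‖ + 1)) := by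
    refine (Complex.norm_exp_le_exp_norm _).trans ?_
    simp only [norm_mul, Complex.norm_I, one_mul, Complex.norm_real, Real.norm_eq_abs,
      abs_of_pos hs]
    gcongr
  rw [thetaReg, norm_div, norm_neg, norm_mul, norm_mul]
  simp only [Complex.norm_ofNat, Complex.norm_real, Real.norm_eq_abs, abs_of_pos hs,
    abs_of_pos Real.pi_pos]
  rw [div_eq_mul_inv, mul_inv]
  have h2 : (4 * Real.pi)⁻¹ ≤ 1 := inv_le_one_of_one_le₀ (by nlinarith [Real.pi_gt_three])
  have h3 : (regNorm ε x)⁻¹ ≤ ‖x‖⁻¹ := by gcongr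
  calc _ ≤ Real.exp (‖α‖ * (‖x‖ + 1)) * (1 * ‖x‖⁻¹) := by gcongr
    _ = _ := by rw [one_mul]

lemma measurable_theta (α : ℂ) : Measurable (theta α) := by
  unfold theta
  fun_prop

lemma integrableOn_theta (α : ℂ) (R : ℝ) : IntegrableOn (theta α) (Metric.closedBall 0 R) := by
  rw [← integrable_indicator_iff measurableSet_closedBall]
  refine ((integrableOn_inv_norm R).const_mul (Real.exp (‖α‖ * R))).mono'
    ((measurable_theta α).indicator measurableSet_closedBall).aestronglyMeasurable ?_
  refine Eventually.of_forall fun x => ?_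
  by_cases hx : x ∈ Metric.closedBall (0 : E3) R
  · simp only [Set.indicator_of_mem hx]
    refine (norm_theta_le α x).trans ?_
    have : ‖x‖ ≤ R := by simpa using hx
    gcongr
  · simp [Set.indicator_of_notMem hx]

lemma tendsto_regNorm (x : E3) : Tendsto (fun ε => regNorm ε x) (𝓝[>] 0) (𝓝 ‖x‖) := by
  have : Continuous fun ε => regNorm ε x := by unfold regNorm; fun_prop
  have h := (this.tendsto 0).mono_left (nhdsWithin_le_nhds (s := Set.Ioi 0))
  simpa [regNorm] using h

lemma tendsto_integral_thetaReg_mul (α : ℂ) {g : E3 → ℂ} (hg : Continuous g)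
    (hs : HasCompactSupport g) :
    Tendsto (fun ε => ∫ x, thetaReg α ε x * g x) (𝓝[>] 0) (𝓝 (∫ x, theta α x * g x)) := by
  obtain ⟨M, hM⟩ := hg.bounded_above_of_compact_support hs
  obtain ⟨R, hR⟩ := hs.isCompact.isBounded.subset_closedBall 0
  have hM0 : 0 ≤ M := (norm_nonneg _).trans (hM 0)
  refine tendsto_integral_filter_of_dominated_convergence (fun x =>
    Real.exp (‖α‖ * (R + 1)) * M * (Metric.closedBall (0 : E3) R).indicator (fun x => ‖x‖⁻¹) x)
    ?_ ?_ ((integrableOn_inv_norm R).const_mul _) ?_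
  · filter_upwards [self_mem_nhdsWithin] with ε hε
    exact ((contDiff_thetaReg α hε).continuous.mul hg).aestronglyMeasurable
  · filter_upwards [Ioc_mem_nhdsGT (show (0 : ℝ) < 1 by norm_num)] with ε hε
    have hne : ∀ᵐ x : E3, x ≠ 0 := by
      rw [ae_iff]; simp
    filter_upwards [hne] with x hx
    by_cases hxR : x ∈ Metric.closedBall (0 : E3) R
    · rw [Set.indicator_of_mem hxR, norm_mul]
      have h1 := norm_thetaReg_le α hε.1 hε.2 x hx
      have h2 : ‖x‖ ≤ R := by simpa using hxR
      calc _ ≤ (Real.exp (‖α‖ * (‖x‖ + 1)) * ‖x‖⁻¹) * M := by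
            gcongr
            exact hM x
        _ ≤ (Real.exp (‖α‖ * (R + 1)) * ‖x‖⁻¹) * M := by gcongr
        _ = _ := by ring
    · have : g x = 0 := by
        by_contra h
        exact hxR (hR (subset_tsupport g h))
      simp [this, Set.indicator_of_notMem hxR]
  · have hne : ∀ᵐ x : E3, x ≠ 0 := by
      rw [ae_iff]; simp
    filter_upwards [hne] with x hx
    refine Tendsto.mul_const _ ?_
    have h1 : Tendsto (fun ε => (regNorm ε x : ℂ)) (𝓝[>] 0) (𝓝 (‖x‖ : ℂ)) :=
      (Complex.continuous_ofReal.tendsto _).comp (tendsto_regNorm x)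
    unfold thetaReg theta
    refine Tendsto.div (Tendsto.neg ?_) (h1.const_mul _) ?_
    · exact (Complex.continuous_exp.tendsto _).comp (h1.const_mul _)
    · have : (‖x‖ : ℂ) ≠ 0 := by exact_mod_cast (norm_pos_iff.2 hx).ne'
      have h3 : (Real.pi : ℂ) ≠ 0 := by exact_mod_cast Real.pi_ne_zero
      exact mul_ne_zero (mul_ne_zero (by norm_num) h3) this

/-- The kernel obtained by rescaling `(Δ + α²) θ_ε`. -/
def deltaKernel (α : ℂ) (s z : ℝ) : ℂ :=
  Complex.exp (Complex.I * α * s) * (3 - 3 * Complex.I * α * s - α ^ 2 * (s : ℂ) ^ 2)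
    / (4 * Real.pi * (z : ℂ) ^ 5)

/-- The substitution `x = ε z` contributes `ε³` and `(regNorm ε x)⁵` scales by `ε⁵`; with the
prefactor `ε²` all powers cancel, which exhibits an approximate identity. -/
lemma integral_lap_thetaReg_mul (α : ℂ) {ε : ℝ} (hε : 0 < ε) (φ : E3 → ℂ) :
    ∫ x, (lap (thetaReg α ε) x + α ^ 2 * thetaReg α ε x) * φ x =
      ∫ z : E3, deltaKernel α (ε * √(1 + ‖z‖ ^ 2)) (√(1 + ‖z‖ ^ 2)) * φ (ε • z) := by
  have h := Measure.integral_comp_smul (volume : Measure E3)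
    (fun x => (lap (thetaReg α ε) x + α ^ 2 * thetaReg α ε x) * φ x) ε
  have hf : Module.finrank ℝ E3 = 3 := by simp
  rw [hf, abs_of_pos (by positivity)] at h
  have h' : ∫ x, (lap (thetaReg α ε) x + α ^ 2 * thetaReg α ε x) * φ x =
      (ε ^ 3) • ∫ z, (lap (thetaReg α ε) (ε • z) + α ^ 2 * thetaReg α ε (ε • z)) * φ (ε • z) := by
    rw [h, smul_smul, mul_inv_cancel₀ (by positivity), one_smul]
  rw [h', ← integral_smul]
  congr 1
  funext z
  have hr : regNorm ε (ε • z) = ε * √(1 + ‖z‖ ^ 2) := by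
    rw [regNorm, norm_smul, Real.norm_eq_abs, abs_of_pos hε]
    rw [show (ε * ‖z‖) ^ 2 + ε ^ 2 = ε ^ 2 * (1 + ‖z‖ ^ 2) by ring,
      Real.sqrt_mul (sq_nonneg ε), Real.sqrt_sq hε.le]
  rw [lap_thetaReg α hε, hr]
  have hz : (√(1 + ‖z‖ ^ 2) : ℂ) ≠ 0 := by
    exact_mod_cast (Real.sqrt_pos.2 (by positivity)).ne'
  have he : (ε : ℂ) ≠ 0 := by exact_mod_cast hε.ne'
  have hpi : (Real.pi : ℂ) ≠ 0 := by exact_mod_cast Real.pi_ne_zero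
  rw [Complex.real_smul, deltaKernel]
  push_cast
  field_simp

/-- On the support of `φ(ε ·)` the argument `ε √(1 + ‖z‖²)` stays bounded for `ε ≤ 1`, so a multiple
of `(1 + ‖z‖²)^{-5/2}` dominates. The limit kernel is `3 / (4π)` times this function and has mass
one. -/
lemma tendsto_integral_lap_thetaReg_mul (α : ℂ) {φ : E3 → ℂ} (hφ : Continuous φ)
    (hs : HasCompactSupport φ) :
    Tendsto (fun ε => ∫ x, (lap (thetaReg α ε) x + α ^ 2 * thetaReg α ε x) * φ x)
      (𝓝[>] 0) (𝓝 (φ 0)) := by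
  obtain ⟨M, hM⟩ := hφ.bounded_above_of_compact_support hs
  obtain ⟨R, hR⟩ := hs.isCompact.isBounded.subset_closedBall 0
  have hM0 : 0 ≤ M := (norm_nonneg _).trans (hM 0)
  set B : ℝ := Real.exp (‖α‖ * (R + 1)) * (3 + 3 * ‖α‖ * (R + 1) + ‖α‖ ^ 2 * (R + 1) ^ 2) * M with hB
  have hlim : Tendsto (fun ε : ℝ => ∫ z : E3,
      deltaKernel α (ε * √(1 + ‖z‖ ^ 2)) (√(1 + ‖z‖ ^ 2)) * φ (ε • z)) (𝓝[>] 0)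
      (𝓝 (∫ z : E3, deltaKernel α 0 (√(1 + ‖z‖ ^ 2)) * φ 0)) := by
    refine tendsto_integral_filter_of_dominated_convergence
      (fun z => B * ((√(1 + ‖z‖ ^ 2)) ^ 5)⁻¹) ?_ ?_ (integrable_inv_one_add_sq_pow.const_mul B) ?_
    · refine Eventually.of_forall fun ε => Measurable.aestronglyMeasurable ?_
      have := hφ.measurable
      unfold deltaKernel
      fun_prop
    · filter_upwards [Ioc_mem_nhdsGT (show (0 : ℝ) < 1 by norm_num)] with ε hε
      refine Eventually.of_forall fun z => ?_
      set s := √(1 + ‖z‖ ^ 2) with hsdef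
      have hs0 : 0 < s := Real.sqrt_pos.2 (by positivity)
      have hsq : s ^ 2 = 1 + ‖z‖ ^ 2 := Real.sq_sqrt (by positivity)
      by_cases hz : ε • z ∈ Metric.closedBall (0 : E3) R
      · have h1 : ε * ‖z‖ ≤ R := by
          simpa [norm_smul, abs_of_pos hε.1] using hz
        have h2 : s ≤ 1 + ‖z‖ := by nlinarith [norm_nonneg z]
        have h3 : ε * s ≤ R + 1 := by nlinarith [hε.1, hε.2, norm_nonneg z]
        have h4 : 0 ≤ ε * s := by have := hε.1; positivity
        have h5 : ‖Complex.exp (Complex.I * α * ((ε * s : ℝ) : ℂ))‖ ≤ Real.exp (‖α‖ * (R + 1)) := by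
          refine (Complex.norm_exp_le_exp_norm _).trans ?_
          simp only [norm_mul, Complex.norm_I, one_mul, Complex.norm_real, Real.norm_eq_abs,
            abs_of_pos hε.1, abs_of_pos hs0]
          gcongr
        have h6 : ‖3 - 3 * Complex.I * α * ((ε * s : ℝ) : ℂ) - α ^ 2 * ((ε * s : ℝ) : ℂ) ^ 2‖ ≤
            3 + 3 * ‖α‖ * (R + 1) + ‖α‖ ^ 2 * (R + 1) ^ 2 := by
          refine (norm_sub_le _ _).trans (add_le_add ((norm_sub_le _ _).trans (add_le_add ?_ ?_)) ?_)
          · simp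
          · simp only [norm_mul, Complex.norm_I, mul_one, Complex.norm_real, Real.norm_eq_abs,
              abs_of_pos hε.1, abs_of_pos hs0, Complex.norm_ofNat]
            gcongr
          · simp only [norm_mul, norm_pow, Complex.norm_real, Real.norm_eq_abs,
              abs_of_pos hε.1, abs_of_pos hs0]
            gcongr
        have h7 : (4 * Real.pi)⁻¹ ≤ 1 := inv_le_one_of_one_le₀ (by nlinarith [Real.pi_gt_three])
        rw [deltaKernel, norm_mul, norm_div, norm_mul]
        have h8 : ‖(4 * Real.pi * (s : ℂ) ^ 5 : ℂ)‖ = 4 * Real.pi * s ^ 5 := by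
          simp [abs_of_pos hs0, abs_of_pos Real.pi_pos]
        rw [h8, div_eq_mul_inv, mul_inv]
        have h9 : 0 ≤ R + 1 := h4.trans h3
        calc _ ≤ Real.exp (‖α‖ * (R + 1)) * (3 + 3 * ‖α‖ * (R + 1) + ‖α‖ ^ 2 * (R + 1) ^ 2) *
              (1 * (s ^ 5)⁻¹) * M := by
              gcongr
              exact hM _
          _ = _ := by rw [hB]; ring
      · have h0 : φ (ε • z) = 0 := by
          by_contra h
          exact hz (hR (subset_tsupport φ h))
        -- The radius may be negative when the support is empty. The bound is nonnegative even then,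
        -- because `3 + 3t + t²` is positive for all real `t`.
        by_cases hR0 : 0 ≤ R
        · rw [h0, mul_zero, norm_zero]; positivity
        · have hM' : M = 0 ∨ 0 ≤ B := by
            right
            have hsup : ∀ x, φ x = 0 := fun x => by
              by_contra h
              have := hR (subset_tsupport φ h)
              rw [mem_closedBall_zero_iff] at this
              exact hR0 ((norm_nonneg x).trans this)
            have : 0 ≤ 3 + 3 * ‖α‖ * (R + 1) + ‖α‖ ^ 2 * (R + 1) ^ 2 := by
              nlinarith [sq_nonneg (‖α‖ * (R + 1) + 3 / 2)]
            positivity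
          rw [h0, mul_zero, norm_zero]
          rcases hM' with h | h
          · rw [hB, h]; simp
          · positivity
    · refine Eventually.of_forall fun z => ?_
      have hc1 : Continuous fun ε : ℝ => deltaKernel α (ε * √(1 + ‖z‖ ^ 2)) (√(1 + ‖z‖ ^ 2)) := by
        unfold deltaKernel
        fun_prop
      have hc2 : Continuous fun ε : ℝ => φ (ε • z) := by fun_prop
      have := ((hc1.mul hc2).tendsto 0).mono_left (nhdsWithin_le_nhds (s := Set.Ioi 0))
      simpa using! this
  have hval : ∫ z : E3, deltaKernel α 0 (√(1 + ‖z‖ ^ 2)) * φ 0 = φ 0 := by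
    have e : ∀ z : E3, deltaKernel α 0 (√(1 + ‖z‖ ^ 2)) * φ 0 =
        (((√(1 + ‖z‖ ^ 2)) ^ 5)⁻¹ : ℝ) * (3 / (4 * Real.pi) * φ 0) := by
      intro z
      simp only [deltaKernel]
      push_cast
      simp
      ring
    simp_rw [e]
    rw [integral_mul_const, integral_complex_ofReal, integral_inv_one_add_sq_pow]
    have hpi : (Real.pi : ℂ) ≠ 0 := by exact_mod_cast Real.pi_ne_zero
    push_cast
    field_simp
  rw [hval] at hlim
  refine hlim.congr' ?_
  filter_upwards [self_mem_nhdsWithin] with ε hε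
  exact (integral_lap_thetaReg_mul α hε φ).symm

/-- `θ` is a fundamental solution of the Helmholtz operator `Δ + α²`. -/
theorem integral_theta_mul_helmholtz (α : ℂ) {φ : E3 → ℂ} (hφ : ContDiff ℝ (⊤ : ℕ∞) φ)
    (hs : HasCompactSupport φ) :
    ∫ x, theta α x * (lap φ x + α ^ 2 * φ x) = φ 0 := by
  have hl : HasCompactSupport (lap φ) := by
    refine HasCompactSupport.intro hs.isCompact fun x hx => ?_
    refine Finset.sum_eq_zero fun i _ => ?_
    exact image_eq_zero_of_notMem_tsupport fun h =>
      hx ((tsupport_pd_subset i φ) ((tsupport_pd_subset i _) h))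
  have hc := (contDiff_lap hφ).continuous
  have hsum : HasCompactSupport fun x => lap φ x + α ^ 2 * φ x := hl.add hs.mul_left
  have h1 := tendsto_integral_thetaReg_mul α (g := fun x => lap φ x + α ^ 2 * φ x)
    (hc.add (continuous_const.mul hφ.continuous)) hsum
  refine tendsto_nhds_unique h1 ((tendsto_integral_lap_thetaReg_mul α hφ.continuous hs).congr' ?_)
  filter_upwards [self_mem_nhdsWithin] with ε hε
  have ht := contDiff_thetaReg α hε
  have i1 : Integrable fun x => thetaReg α ε x * lap φ x :=
    (ht.continuous.mul hc).integrable_of_hasCompactSupport hl.mul_left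
  have i2 : Integrable fun x => thetaReg α ε x * (α ^ 2 * φ x) :=
    (ht.continuous.mul (continuous_const.mul hφ.continuous)).integrable_of_hasCompactSupport
      hs.mul_left.mul_left
  have i3 : Integrable fun x => lap (thetaReg α ε) x * φ x :=
    ((contDiff_lap ht).continuous.mul hφ.continuous).integrable_of_hasCompactSupport hs.mul_left
  have i4 : Integrable fun x => α ^ 2 * thetaReg α ε x * φ x :=
    ((continuous_const.mul ht.continuous).mul hφ.continuous).integrable_of_hasCompactSupport
      hs.mul_left
  simp_rw [mul_add, add_mul]
  rw [integral_add i1 i2, integral_add i3 i4, integral_mul_lap ht hφ hs]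
  congr 2
  funext x; ring

/-! ### The parametrix -/

lemma pd_mul {f g : E3 → ℂ} (hf : Differentiable ℝ f) (hg : Differentiable ℝ g) (i : Fin 3) :
    pd i (fun x => f x * g x) = fun x => f x * pd i g x + pd i f x * g x := by
  funext x
  simp only [pd]
  rw [fderiv_fun_mul (hf x) (hg x)]
  simp
  ring

lemma pd_fun_add {f g : E3 → ℂ} (hf : Differentiable ℝ f) (hg : Differentiable ℝ g) (i : Fin 3) :
    pd i (fun x => f x + g x) = fun x => pd i f x + pd i g x := dd_fun_add hf hg _

lemma lap_mul {f g : E3 → ℂ} (hf : ContDiff ℝ (⊤ : ℕ∞) f) (hg : ContDiff ℝ (⊤ : ℕ∞) g) (x : E3) :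
    lap (fun x => f x * g x) x =
      f x * lap g x + (∑ i, 2 * (pd i f x * pd i g x)) + lap f x * g x := by
  have hd : ∀ {f : E3 → ℂ}, ContDiff ℝ (⊤ : ℕ∞) f → Differentiable ℝ f := fun h =>
    h.differentiable (by simp)
  have h1 : ∀ i, pd i (pd i fun x => f x * g x) x =
      f x * pd i (pd i g) x + 2 * (pd i f x * pd i g x) + pd i (pd i f) x * g x := by
    intro i
    rw [pd_mul (hd hf) (hd hg), pd_fun_add (f := fun x => f x * pd i g x) (g := fun x => pd i f x * g x)
      ((hd hf).mul (hd (contDiff_pd hg i))) ((hd (contDiff_pd hf i)).mul (hd hg)), pd_mul (hd hf) (hd (contDiff_pd hg i)),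
      pd_mul (hd (contDiff_pd hf i)) (hd hg)]
    ring
  simp only [lap, h1, Finset.sum_add_distrib, Finset.mul_sum, Finset.sum_mul]

lemma hasCompactSupport_lap {φ : E3 → ℂ} (hs : HasCompactSupport φ) :
    HasCompactSupport (lap φ) := by
  refine HasCompactSupport.intro hs.isCompact fun x hx => ?_
  refine Finset.sum_eq_zero fun i _ => ?_
  exact image_eq_zero_of_notMem_tsupport fun h =>
    hx ((tsupport_pd_subset i φ) ((tsupport_pd_subset i _) h))

lemma pd_eq_zero_of_eventuallyEq {f : E3 → ℂ} {c : ℂ} {x : E3} (h : f =ᶠ[𝓝 x] fun _ => c)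
    (i : Fin 3) : pd i f =ᶠ[𝓝 x] 0 := by
  filter_upwards [h.eventuallyEq_nhds] with y hy
  simp [pd, hy.fderiv_eq]

lemma lap_eq_zero_of_eventuallyEq {f : E3 → ℂ} {c : ℂ} {x : E3} (h : f =ᶠ[𝓝 x] fun _ => c) :
    lap f =ᶠ[𝓝 x] 0 := by
  have h1 : ∀ i, pd i (pd i f) =ᶠ[𝓝 x] 0 := fun i =>
    pd_eq_zero_of_eventuallyEq (c := 0) (pd_eq_zero_of_eventuallyEq h i) i
  filter_upwards [h1 0, h1 1, h1 2] with y h0 h1 h2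
  simp [lap, Fin.sum_univ_three, h0, h1, h2]

lemma contDiffAt_theta (α : ℂ) {x : E3} (hx : x ≠ 0) : ContDiffAt ℝ (⊤ : ℕ∞) (theta α) x := by
  have h1 : ContDiffAt ℝ (⊤ : ℕ∞) (fun x : E3 => (‖x‖ : ℂ)) x :=
    Complex.ofRealCLM.contDiff.contDiffAt.comp x (contDiffAt_norm ℝ hx)
  refine (contDiffAt_const.mul h1).cexp.neg.mul ((contDiffAt_const.mul h1).inv ?_)
  have h2 : (‖x‖ : ℂ) ≠ 0 := by exact_mod_cast (norm_pos_iff.2 hx).ne'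
  have h3 : (Real.pi : ℂ) ≠ 0 := by exact_mod_cast Real.pi_ne_zero
  exact mul_ne_zero (mul_ne_zero (by norm_num) h3) h2

/-- Only the origin is singular, and the product vanishes near it; this applies to derivatives of a
cutoff that is constant there. -/
lemma contDiff_theta_mul (α : ℂ) {g : E3 → ℂ} (hg : ContDiff ℝ (⊤ : ℕ∞) g) (h0 : g =ᶠ[𝓝 0] 0) :
    ContDiff ℝ (⊤ : ℕ∞) fun x => theta α x * g x := by
  rw [contDiff_iff_contDiffAt]
  intro x
  rcases eq_or_ne x 0 with rfl | hx
  · have : (fun x => theta α x * g x) =ᶠ[𝓝 0] fun _ => 0 := by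
      filter_upwards [h0] with y hy
      simp [hy]
    exact contDiffAt_const.congr_of_eventuallyEq this
  · exact (contDiffAt_theta α hx).mul hg.contDiffAt

lemma integrable_theta_mul (α : ℂ) {g : E3 → ℂ} (hg : Continuous g) (hs : HasCompactSupport g) :
    Integrable fun x => theta α x * g x := by
  obtain ⟨M, hM⟩ := hg.bounded_above_of_compact_support hs
  obtain ⟨R, hR⟩ := hs.isCompact.isBounded.subset_closedBall 0
  have h1 : IntegrableOn (fun x => theta α x * g x) (Metric.closedBall 0 R) :=
    (integrableOn_theta α R).mul_bdd hg.aestronglyMeasurable (Eventually.of_forall hM)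
  rw [← integrableOn_univ]
  refine h1.of_forall_sdiff_eq_zero MeasurableSet.univ fun x hx => ?_
  have : g x = 0 := by
    by_contra h
    exact hx.2 (hR (subset_tsupport g h))
  simp [this]

/-- A compactly supported parametrix of the Helmholtz operator: it agrees with `θ` near the origin
and inverts `Δ + α²` up to a smooth remainder with compact support. -/
theorem exists_parametrix (α : ℂ) {r R : ℝ} (hr : 0 < r) (hrR : r < R) :
    ∃ κ m : E3 → ℂ, Measurable κ ∧ Integrable κ ∧ (∀ x, R ≤ ‖x‖ → κ x = 0) ∧
      (∀ x, ‖x‖ ≤ r → κ x = theta α x) ∧ ContDiff ℝ (⊤ : ℕ∞) m ∧ (∀ x, R < ‖x‖ → m x = 0) ∧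
      ∀ φ : E3 → ℂ, ContDiff ℝ (⊤ : ℕ∞) φ → HasCompactSupport φ →
        ∫ x, κ x * (lap φ x + α ^ 2 * φ x) = φ 0 + ∫ x, m x * φ x := by
  set b : ContDiffBump (0 : E3) := ⟨r, R, hr, hrR⟩
  set χ : E3 → ℂ := fun x => (b x : ℂ) with hχ
  have hχc : ContDiff ℝ (⊤ : ℕ∞) χ := Complex.ofRealCLM.contDiff.comp b.contDiff
  have hχs : HasCompactSupport χ := b.hasCompactSupport.comp_left Complex.ofReal_zero
  have hχR : ∀ x, R ≤ ‖x‖ → χ x = 0 := fun x hx => by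
    simp [hχ, b.zero_of_le_dist (x := x) (by simpa using hx)]
  have hχ1 : ∀ x, ‖x‖ ≤ r → χ x = 1 := fun x hx => by
    simp [hχ, b.one_of_mem_closedBall (x := x) (by simpa using hx)]
  have hχn : χ =ᶠ[𝓝 0] fun _ => 1 := by
    filter_upwards [Metric.ball_mem_nhds (0 : E3) hr] with x hx
    exact hχ1 x (by simpa using (Metric.mem_ball.1 hx).le)
  have hχo : ∀ x, R < ‖x‖ → χ =ᶠ[𝓝 x] fun _ => 0 := fun x hx => by
    filter_upwards [(isOpen_lt continuous_const continuous_norm).mem_nhds hx] with y hy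
    exact hχR y (le_of_lt hy)
  set G : Fin 3 → E3 → ℂ := fun i x => theta α x * pd i χ x with hG
  have hGc : ∀ i, ContDiff ℝ (⊤ : ℕ∞) (G i) := fun i =>
    contDiff_theta_mul α (contDiff_pd hχc i) (pd_eq_zero_of_eventuallyEq hχn i)
  have hLc : ContDiff ℝ (⊤ : ℕ∞) fun x => theta α x * lap χ x :=
    contDiff_theta_mul α (contDiff_lap hχc) (lap_eq_zero_of_eventuallyEq hχn)
  -- The commutator of the Helmholtz operator with the cutoff, applied to `θ`. It is smooth because
  -- the derivatives of `χ` vanish near the origin.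
  set m : E3 → ℂ := fun x => (∑ i, 2 * pd i (G i) x) - theta α x * lap χ x with hm
  have hmc : ContDiff ℝ (⊤ : ℕ∞) m :=
    (ContDiff.sum fun i _ => contDiff_const.mul (contDiff_pd (hGc i) i)).sub hLc
  have hκi : Integrable fun x => theta α x * χ x := integrable_theta_mul α hχc.continuous hχs
  refine ⟨fun x => theta α x * χ x, m, (measurable_theta α).mul hχc.continuous.measurable, hκi,
    fun x hx => by simp [hχR x hx], fun x hx => by simp [hχ1 x hx], hmc, ?_, ?_⟩
  · intro x hx
    have h1 : ∀ i, G i =ᶠ[𝓝 x] fun _ => 0 := fun i => by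
      filter_upwards [pd_eq_zero_of_eventuallyEq (hχo x hx) i] with y hy
      simp [hG, hy]
    have h2 : ∀ i, pd i (G i) x = 0 := fun i =>
      (pd_eq_zero_of_eventuallyEq (h1 i) i).self_of_nhds
    have h3 := (lap_eq_zero_of_eventuallyEq (hχo x hx)).self_of_nhds
    simp [hm, h2, h3]
  · intro φ hφ hs
    -- The fundamental solution is tested against `χ φ`. The product rule produces `2 θ ∇χ · ∇φ + θ
    -- φ Δχ` beside the wanted term, and an integration by parts frees `φ` of its derivatives.
    have hfs := integral_theta_mul_helmholtz α (hχc.mul hφ) hs.mul_left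
    have h0 : χ 0 = 1 := hχ1 0 (by simpa using hr.le)
    rw [h0, one_mul] at hfs
    have hls := hasCompactSupport_lap hs
    have hlc := (contDiff_lap hφ).continuous
    have i1 : Integrable fun x => theta α x * χ x * (lap φ x + α ^ 2 * φ x) := by
      simp_rw [mul_assoc]
      refine integrable_theta_mul α (hχc.continuous.mul (hlc.add
        (continuous_const.mul hφ.continuous))) hχs.mul_right
    have i2 : ∀ i, Integrable fun x => 2 * (G i x * pd i φ x) := fun i =>
      (((hGc i).continuous.mul (contDiff_pd hφ i).continuous).integrable_of_hasCompactSupport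
        (hasCompactSupport_pd hs i).mul_left).const_mul 2
    have i2' : ∀ i, Integrable fun x => 2 * (pd i (G i) x * φ x) := fun i =>
      (((contDiff_pd (hGc i) i).continuous.mul hφ.continuous).integrable_of_hasCompactSupport
        hs.mul_left).const_mul 2
    have i3 : Integrable fun x => theta α x * lap χ x * φ x :=
      (hLc.continuous.mul hφ.continuous).integrable_of_hasCompactSupport hs.mul_left
    have e1 : ∀ x, theta α x * (lap (fun x => χ x * φ x) x + α ^ 2 * (χ x * φ x)) =
        (theta α x * χ x * (lap φ x + α ^ 2 * φ x) + ∑ i, 2 * (G i x * pd i φ x)) +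
          theta α x * lap χ x * φ x := by
      intro x
      rw [lap_mul hχc hφ]
      simp only [hG, Fin.sum_univ_three]
      ring
    have e2 : ∀ x, m x * φ x = (∑ i, 2 * (pd i (G i) x * φ x)) - theta α x * lap χ x * φ x := by
      intro x
      simp only [hm, sub_mul, Finset.sum_mul, mul_assoc]
    change ∫ x, theta α x * (lap (fun x => χ x * φ x) x + α ^ 2 * (χ x * φ x)) = φ 0 at hfs
    simp_rw [e1] at hfs
    have i12 : Integrable fun x => theta α x * χ x * (lap φ x + α ^ 2 * φ x) +
        ∑ i, 2 * (G i x * pd i φ x) := i1.add (integrable_finsetSum _ fun i _ => i2 i)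
    rw [integral_add i12 i3,
      integral_add i1 (integrable_finsetSum _ fun i _ => i2 i),
      integral_finsetSum _ fun i _ => i2 i] at hfs
    simp_rw [e2]
    rw [integral_sub (integrable_finsetSum _ fun i _ => i2' i) i3,
      integral_finsetSum _ fun i _ => i2' i]
    have e3 : ∀ i, ∫ x, 2 * (G i x * pd i φ x) = -∫ x, 2 * (pd i (G i) x * φ x) := by
      intro i
      rw [integral_const_mul, integral_const_mul, pd_eq_dd, integral_mul_dd (hGc i) hφ hs, mul_neg]
      rfl
    simp only [e3, Finset.sum_neg_distrib] at hfs
    linear_combination hfs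

/-! ### Convolution with the parametrix -/

/-- Convolution of complex-valued functions. -/
def conv (κ φ : E3 → ℂ) (x : E3) : ℂ := ∫ y, κ y * φ (x - y)

lemma conv_eq_convolution (κ φ : E3 → ℂ) :
    conv κ φ = convolution κ φ (ContinuousLinearMap.mul ℝ ℂ) volume := by
  funext x; simp [conv, convolution]

section conv

variable {κ φ : E3 → ℂ}

lemma contDiff_conv (hκ : LocallyIntegrable κ) (hφ : ContDiff ℝ (⊤ : ℕ∞) φ)
    (hs : HasCompactSupport φ) : ContDiff ℝ (⊤ : ℕ∞) (conv κ φ) := by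
  rw [conv_eq_convolution]
  exact hs.contDiff_convolution_right _ hκ hφ

lemma dd_conv (hκ : LocallyIntegrable κ) (hφ : ContDiff ℝ (⊤ : ℕ∞) φ)
    (hs : HasCompactSupport φ) (a : E3) : dd a (conv κ φ) = conv κ (dd a φ) := by
  funext x
  have h := hs.hasFDerivAt_convolution_right (ContinuousLinearMap.mul ℝ ℂ) hκ
    (hφ.of_le (by simp)) x
  rw [dd, conv_eq_convolution, h.fderiv, conv_eq_convolution,
    convolution_precompR_apply _ hκ (hs.fderiv ℝ) (hφ.continuous_fderiv (by simp))]
  rfl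

lemma pd_conv (hκ : LocallyIntegrable κ) (hφ : ContDiff ℝ (⊤ : ℕ∞) φ)
    (hs : HasCompactSupport φ) (i : Fin 3) : pd i (conv κ φ) = conv κ (pd i φ) :=
  dd_conv hκ hφ hs _

lemma integrable_mul_comp_sub (hκ : LocallyIntegrable κ) (hφ : Continuous φ)
    (hs : HasCompactSupport φ) (x : E3) : Integrable fun y => κ y * φ (x - y) := by
  have := hs.convolutionExists_right (ContinuousLinearMap.mul ℝ ℂ) hκ hφ x
  simpa [ConvolutionExistsAt] using this

lemma lap_conv (hκ : LocallyIntegrable κ) (hφ : ContDiff ℝ (⊤ : ℕ∞) φ)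
    (hs : HasCompactSupport φ) : lap (conv κ φ) = conv κ (lap φ) := by
  funext x
  simp only [lap, pd_conv hκ hφ hs]
  simp only [pd_conv hκ (contDiff_pd hφ _) (hasCompactSupport_pd hs _)]
  simp only [conv]
  rw [← integral_finsetSum]
  · simp [lap, Finset.mul_sum]
  · exact fun i _ => integrable_mul_comp_sub hκ (contDiff_pd (contDiff_pd hφ i) i).continuous
      (hasCompactSupport_pd (hasCompactSupport_pd hs i) i) x

lemma conv_eq_zero {R r : ℝ} (hκ : ∀ x, R < ‖x‖ → κ x = 0) {x₀ : E3}
    (hφ : ∀ x, r < dist x x₀ → φ x = 0) {x : E3} (hx : R + r < dist x x₀) : conv κ φ x = 0 := by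
  have : ∀ y, κ y * φ (x - y) = 0 := by
    intro y
    by_cases h : R < ‖y‖
    · rw [hκ y h, zero_mul]
    · have : r < dist (x - y) x₀ := by
        have h1 := dist_triangle x (x - y) x₀
        have h2 : dist x (x - y) = ‖y‖ := by rw [dist_eq_norm]; congr 1; abel
        linarith
      rw [hφ _ this, mul_zero]
  simp [conv, this]

lemma hasCompactSupport_conv {R : ℝ} (hκ : ∀ x, R < ‖x‖ → κ x = 0) (hs : HasCompactSupport φ) :
    HasCompactSupport (conv κ φ) := by
  obtain ⟨r, hr⟩ := hs.isCompact.isBounded.subset_closedBall 0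
  refine HasCompactSupport.intro (isCompact_closedBall 0 (R + r)) fun x hx => ?_
  refine conv_eq_zero hκ (r := r) (x₀ := 0) (fun y hy => ?_) (by simpa using hx)
  by_contra h
  have := hr (subset_tsupport φ h)
  rw [Metric.mem_closedBall] at this
  linarith

end conv

lemma pd_comp_const_sub {φ : E3 → ℂ} (hφ : Differentiable ℝ φ) (x : E3) (i : Fin 3) :
    pd i (fun y => φ (x - y)) = fun y => -pd i φ (x - y) := by
  funext y
  have h := (hφ (x - y)).hasFDerivAt.comp y ((hasFDerivAt_id y).const_sub x)
  change fderiv ℝ (φ ∘ HSub.hSub x) y _ = _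
  rw [h.fderiv]
  simp [pd]

lemma lap_comp_const_sub {φ : E3 → ℂ} (hφ : ContDiff ℝ (⊤ : ℕ∞) φ) (x y : E3) :
    lap (fun y => φ (x - y)) y = lap φ (x - y) := by
  simp only [lap]
  refine Finset.sum_congr rfl fun i _ => ?_
  rw [pd_comp_const_sub (hφ.differentiable (by simp))]
  have h := pd_comp_const_sub ((contDiff_pd hφ i).differentiable (by simp)) x i
  have hd : Differentiable ℝ fun y => pd i φ (x - y) :=
    ((contDiff_pd hφ i).differentiable (by simp)).comp (differentiable_id.const_sub x)
  have : pd i (fun y => -pd i φ (x - y)) y = -pd i (fun y => pd i φ (x - y)) y := by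
    simp only [pd]
    rw [fderiv_fun_neg]
    rfl
  rw [this, h, neg_neg]

/-- The parametrix inverts the Helmholtz operator under convolution. -/
lemma helmholtz_conv {α : ℂ} {κ m : E3 → ℂ} (hκ : LocallyIntegrable κ)
    (H : ∀ φ : E3 → ℂ, ContDiff ℝ (⊤ : ℕ∞) φ → HasCompactSupport φ →
        ∫ x, κ x * (lap φ x + α ^ 2 * φ x) = φ 0 + ∫ x, m x * φ x)
    {φ : E3 → ℂ} (hφ : ContDiff ℝ (⊤ : ℕ∞) φ) (hs : HasCompactSupport φ) (x : E3) :
    lap (conv κ φ) x + α ^ 2 * conv κ φ x = φ x + conv m φ x := by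
  have h := H (fun y => φ (x - y)) (hφ.comp (contDiff_const.sub contDiff_id))
    (hs.comp_homeomorph (Homeomorph.subLeft x))
  simp only [lap_comp_const_sub hφ, sub_zero] at h
  rw [lap_conv hκ hφ hs]
  change _ = φ x + ∫ y, m y * φ (x - y)
  rw [← h]
  simp only [conv, mul_add]
  have i1 := integrable_mul_comp_sub hκ (contDiff_lap hφ).continuous (hasCompactSupport_lap hs) x
  have i2 := (integrable_mul_comp_sub hκ hφ.continuous hs x).const_mul (α ^ 2)
  have e : ∀ y, κ y * (α ^ 2 * φ (x - y)) = α ^ 2 * (κ y * φ (x - y)) := fun y => by ring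
  simp only [e]
  rw [integral_add i1 i2, integral_const_mul]

/-! ### Weyl's lemma, local form -/

lemma IsTest.pd {Ω : Set E3} {φ : E3 → ℂ} (h : IsTest Ω φ) (i : Fin 3) : IsTest Ω (pd i φ) :=
  ⟨contDiff_pd h.1 i, hasCompactSupport_pd h.2.1 i, (tsupport_pd_subset i φ).trans h.2.2⟩

lemma contDiff_integral_mul_comp_sub {F m : E3 → ℂ} (hF : LocallyIntegrable F)
    (hm : ContDiff ℝ (⊤ : ℕ∞) m) (hs : HasCompactSupport m) :
    ContDiff ℝ (⊤ : ℕ∞) fun z => ∫ x, F x * m (x - z) := by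
  have e : (fun z => ∫ x, F x * m (x - z)) = conv F (fun y => m (-y)) := by
    funext z; simp [conv]
  rw [e]
  exact contDiff_conv hF (hm.comp contDiff_neg) (hs.comp_homeomorph (Homeomorph.neg E3))

/-- Fubini moves the convolution with `m` onto `F`; the double integrand is integrable, being a
product of integrable functions times a bounded kernel. -/
lemma integral_mul_conv {F m φ : E3 → ℂ} (hF : Integrable F) (hm : Continuous m)
    (hms : HasCompactSupport m) (hφ : Integrable φ) :
    ∫ x, F x * conv m φ x = ∫ z, (∫ x, F x * m (x - z)) * φ z := by
  obtain ⟨M, hM⟩ := hm.bounded_above_of_compact_support hms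
  have h1 : ∀ x, conv m φ x = ∫ z, m (x - z) * φ z := by
    intro x
    rw [conv, ← integral_sub_left_eq_self _ _ x]
    simp
  simp_rw [h1, ← integral_const_mul, ← integral_mul_const]
  rw [integral_integral_swap]
  · congr 1 with z
    congr 1 with x
    ring
  · have h2 : Integrable (fun z : E3 × E3 => (F z.1 * φ z.2) * m (z.1 - z.2))
        (volume.prod volume) :=
      (hF.mul_prod hφ).mul_bdd (c := M)
        (Continuous.aestronglyMeasurable (by fun_prop)) (Eventually.of_forall fun z => hM _)
    refine h2.congr (Eventually.of_forall fun z => ?_)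
    simp only [Function.uncurry]
    ring

/-- **Weyl's lemma** for the Helmholtz operator, local form. -/
lemma exists_contDiff_ae_eq_of_weak_helmholtz {Ω : Set E3} (hΩ : IsOpen Ω) {α : ℂ} {F : E3 → ℂ}
    (hF : LocallyIntegrableOn F Ω)
    (h : ∀ φ, IsTest Ω φ → ∫ x in Ω, F x * (lap φ x + α ^ 2 * φ x) = 0) {x₀ : E3} (hx₀ : x₀ ∈ Ω) :
    ∃ r > 0, Metric.ball x₀ r ⊆ Ω ∧ ∃ g : E3 → ℂ, ContDiff ℝ (⊤ : ℕ∞) g ∧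
      ∀ᵐ x, x ∈ Metric.ball x₀ r → F x = g x := by
  obtain ⟨δ₀, hδ₀, hb⟩ := Metric.isOpen_iff.1 hΩ x₀ hx₀
  set δ := δ₀ / 4 with hδ
  have hδ0 : 0 < δ := by positivity
  have hK : Metric.closedBall x₀ (2 * δ) ⊆ Ω :=
    (Metric.closedBall_subset_ball (by rw [hδ]; linarith)).trans hb
  obtain ⟨κ, m, -, hκi, hκ0, -, hm, hm0, H⟩ := exists_parametrix α (r := δ / 2) (R := δ)
    (by positivity) (by linarith)
  have hms : HasCompactSupport m :=
    HasCompactSupport.intro (isCompact_closedBall 0 δ) fun x hx => hm0 x (by simpa using hx)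
  set K := Metric.closedBall x₀ (2 * δ) with hKdef
  set F' : E3 → ℂ := K.indicator F with hF'
  have hF'i : Integrable F' := by
    rw [integrable_indicator_iff measurableSet_closedBall]
    exact hF.integrableOn_compact_subset hK (isCompact_closedBall _ _)
  -- The candidate is forced: testing with `κ * φ` yields `∫ F' (φ + m * φ) = 0`, and Fubini reads
  -- this as `F' = g` on the small ball.
  set g : E3 → ℂ := fun z => -∫ x, F' x * m (x - z) with hg
  have hgc : ContDiff ℝ (⊤ : ℕ∞) g :=
    (contDiff_integral_mul_comp_sub hF'i.locallyIntegrable hm hms).neg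
  have hbΩ : Metric.ball x₀ δ ⊆ K := Metric.ball_subset_closedBall.trans
    (Metric.closedBall_subset_closedBall (by linarith))
  refine ⟨δ, hδ0, hbΩ.trans hK, g, hgc, ?_⟩
  have key := Metric.isOpen_ball.ae_eq_zero_of_integral_contDiff_smul_eq_zero
    (U := Metric.ball x₀ δ) (f := fun x => F' x - g x) (μ := volume)
    ((hF'i.locallyIntegrable.sub hgc.continuous.locallyIntegrable).locallyIntegrableOn _) ?_
  · filter_upwards [key] with x hx hxb
    have := hx hxb
    rw [hF', Set.indicator_of_mem (hbΩ hxb), sub_eq_zero] at this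
    exact this
  intro ψ hψ hψs hψb
  set φ : E3 → ℂ := fun x => (ψ x : ℂ) with hφdef
  have hφ : ContDiff ℝ (⊤ : ℕ∞) φ := Complex.ofRealCLM.contDiff.comp hψ
  have hφs : HasCompactSupport φ := hψs.comp_left Complex.ofReal_zero
  have hφ0 : ∀ x, δ < dist x x₀ → φ x = 0 := by
    intro x hx
    have : ψ x = 0 := by
      by_contra h
      have := hψb (subset_tsupport ψ h)
      rw [Metric.mem_ball] at this
      linarith
    simp [hφdef, this]
  have hφi : Integrable φ := hφ.continuous.integrable_of_hasCompactSupport hφs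
  have hκz : ∀ x, δ < ‖x‖ → κ x = 0 := fun x hx => hκ0 x hx.le
  have hc0 : ∀ x, x ∉ K → conv κ φ x = 0 := fun x hx =>
    conv_eq_zero hκz hφ0 (by rw [hKdef, Metric.mem_closedBall] at hx; linarith)
  have hcm0 : ∀ x, x ∉ K → conv m φ x = 0 := fun x hx =>
    conv_eq_zero hm0 hφ0 (by rw [hKdef, Metric.mem_closedBall] at hx; linarith)
  -- Both `κ` and `φ` live within radius `δ` (about the origin and `x₀`), so the convolution lives
  -- in `K ⊆ Ω` and is an admissible test function.
  have htest : IsTest Ω (conv κ φ) := by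
    refine ⟨contDiff_conv hκi.locallyIntegrable hφ hφs, hasCompactSupport_conv hκz hφs, ?_⟩
    refine (closure_minimal (fun x hx => ?_) Metric.isClosed_closedBall).trans hK
    by_contra hxK
    exact hx (hc0 x hxK)
  have h1 := h _ htest
  simp only [helmholtz_conv hκi.locallyIntegrable H hφ hφs] at h1
  have e1 : ∫ x in Ω, F x * (φ x + conv m φ x) = ∫ x, F' x * (φ x + conv m φ x) := by
    rw [← integral_indicator hΩ.measurableSet]
    congr 1 with x
    by_cases hxK : x ∈ K
    · rw [Set.indicator_of_mem (hK hxK), hF', Set.indicator_of_mem hxK]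
    · have hφx : φ x = 0 := hφ0 x (by
        rw [hKdef, Metric.mem_closedBall] at hxK; linarith)
      have : F x * (φ x + conv m φ x) = 0 := by rw [hφx, hcm0 x hxK]; simp
      by_cases hxΩ : x ∈ Ω
      · rw [Set.indicator_of_mem hxΩ, this, hF', Set.indicator_of_notMem hxK, zero_mul]
      · rw [Set.indicator_of_notMem hxΩ, hF', Set.indicator_of_notMem hxK, zero_mul]
  obtain ⟨M, hM⟩ := hφ.continuous.bounded_above_of_compact_support hφs
  have hcm := contDiff_conv hm.continuous.locallyIntegrable hφ hφs
  obtain ⟨M', hM'⟩ := hcm.continuous.bounded_above_of_compact_support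
    (hasCompactSupport_conv hm0 hφs)
  have i1 : Integrable fun x => F' x * φ x :=
    hF'i.mul_bdd hφ.continuous.aestronglyMeasurable (Eventually.of_forall hM)
  have i2 : Integrable fun x => F' x * conv m φ x :=
    hF'i.mul_bdd hcm.continuous.aestronglyMeasurable (Eventually.of_forall hM')
  rw [e1] at h1
  simp only [mul_add] at h1
  rw [integral_add i1 i2, integral_mul_conv hF'i hm.continuous hms hφi] at h1
  have i3 : Integrable fun x => g x * φ x :=
    (hgc.continuous.mul hφ.continuous).integrable_of_hasCompactSupport hφs.mul_left
  have e2 : ∀ x, ψ x • (F' x - g x) = F' x * φ x - g x * φ x := fun x => by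
    rw [Complex.real_smul]; simp only [hφdef]; ring
  simp only [e2]
  rw [integral_sub i1 i3]
  simp only [hg, neg_mul]
  rw [integral_neg, sub_neg_eq_add]
  exact h1

/-! ### Weak divergence and curl in components; Weyl's lemma on open sets -/

/-- The pairing `∫_Ω φ f`. -/
def pair (Ω : Set E3) (φ f : E3 → ℂ) : ℂ := ∫ x in Ω, φ x * f x

lemma integrableOn_mul_of_tsupport {Ω : Set E3} {φ f : E3 → ℂ} (hf : LocallyIntegrableOn f Ω)
    (hφ : Continuous φ) (hs : HasCompactSupport φ) (hφΩ : tsupport φ ⊆ Ω) :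
    IntegrableOn (fun x => φ x * f x) Ω := by
  obtain ⟨M, hM⟩ := hφ.bounded_above_of_compact_support hs
  have h1 : IntegrableOn f (tsupport φ) := hf.integrableOn_compact_subset hφΩ hs
  have h2 : IntegrableOn (fun x => φ x * f x) (tsupport φ) :=
    Integrable.bdd_mul (c := M) h1 hφ.aestronglyMeasurable (Eventually.of_forall hM)
  rw [integrableOn_iff_integrable_of_support_subset] at h2
  · exact h2.integrableOn
  · intro x hx
    refine subset_tsupport φ fun h => hx ?_
    simp [h]

lemma IsTest.integrableOn_mul {Ω : Set E3} {φ f : E3 → ℂ} (hφ : IsTest Ω φ)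
    (hf : LocallyIntegrableOn f Ω) : IntegrableOn (fun x => φ x * f x) Ω :=
  integrableOn_mul_of_tsupport hf hφ.1.continuous hφ.2.1 hφ.2.2

lemma locallyIntegrableOn_eval {Ω : Set E3} {F : E3 → C3} (hF : LocallyIntegrableOn F Ω)
    (i : Fin 3) : LocallyIntegrableOn (fun x => F x i) Ω := fun x hx => by
  obtain ⟨s, hs, h⟩ := hF x hx
  exact ⟨s, hs, h.eval i⟩

lemma integral_smul_apply {Ω : Set E3} {φ : E3 → ℂ} {F : E3 → C3}
    (h : ∀ i, IntegrableOn (fun x => φ x * F x i) Ω) (i : Fin 3) :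
    (∫ x in Ω, φ x • F x) i = pair Ω φ fun x => F x i :=
  eval_integral (f := fun x => φ x • F x) h i

lemma integral_dotProduct {Ω : Set E3} {g F : E3 → C3}
    (h : ∀ i, IntegrableOn (fun x => g x i * F x i) Ω) :
    ∫ x in Ω, dotProduct (g x) (F x) = ∑ i, pair Ω (fun x => g x i) fun x => F x i := by
  simp only [dotProduct, pair]
  exact integral_finsetSum _ fun i _ => h i

lemma integral_crossProduct {Ω : Set E3} {g F : E3 → C3}
    (h : ∀ i j, IntegrableOn (fun x => g x i * F x j) Ω) :
    ∫ x in Ω, crossProduct (g x) (F x) =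
      ![pair Ω (fun x => g x 1) (fun x => F x 2) - pair Ω (fun x => g x 2) (fun x => F x 1),
        pair Ω (fun x => g x 2) (fun x => F x 0) - pair Ω (fun x => g x 0) (fun x => F x 2),
        pair Ω (fun x => g x 0) (fun x => F x 1) - pair Ω (fun x => g x 1) (fun x => F x 0)] := by
  have hi : ∀ i, IntegrableOn (fun x => crossProduct (g x) (F x) i) Ω := by
    intro i
    fin_cases i <;> simp only [cross_apply] <;> exact (h _ _).sub (h _ _)
  funext i
  rw [eval_integral (f := fun x => crossProduct (g x) (F x)) hi]
  fin_cases i <;> simp only [cross_apply] <;> exact integral_sub (h _ _) (h _ _)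

lemma isWeakDiv_iff {Ω : Set E3} {F : E3 → C3} {d : E3 → ℂ} :
    IsWeakDiv Ω F d ↔ LocallyIntegrableOn F Ω ∧ LocallyIntegrableOn d Ω ∧ ∀ φ, IsTest Ω φ →
      pair Ω φ d = -∑ i, pair Ω (pd i φ) fun x => F x i := by
  refine and_congr_right fun hF => and_congr_right fun hd => forall₂_congr fun φ hφ => ?_
  rw [integral_dotProduct (g := grad φ) (F := F) fun i => (hφ.pd i).integrableOn_mul (locallyIntegrableOn_eval hF i)]
  rfl

lemma isWeakCurl_iff {Ω : Set E3} {F G : E3 → C3} :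
    IsWeakCurl Ω F G ↔ LocallyIntegrableOn F Ω ∧ LocallyIntegrableOn G Ω ∧ ∀ φ, IsTest Ω φ →
      pair Ω φ (fun x => G x 0) =
        -(pair Ω (pd 1 φ) (fun x => F x 2) - pair Ω (pd 2 φ) (fun x => F x 1)) ∧
      pair Ω φ (fun x => G x 1) =
        -(pair Ω (pd 2 φ) (fun x => F x 0) - pair Ω (pd 0 φ) (fun x => F x 2)) ∧
      pair Ω φ (fun x => G x 2) =
        -(pair Ω (pd 0 φ) (fun x => F x 1) - pair Ω (pd 1 φ) (fun x => F x 0)) := by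
  refine and_congr_right fun hF => and_congr_right fun hG => forall₂_congr fun φ hφ => ?_
  rw [integral_crossProduct (g := grad φ) (F := F) fun i j => (hφ.pd i).integrableOn_mul (locallyIntegrableOn_eval hF j),
    funext_iff, Fin.forall_fin_succ, Fin.forall_fin_succ, Fin.forall_fin_succ]
  simp only [integral_smul_apply fun i => hφ.integrableOn_mul (locallyIntegrableOn_eval hG i)]
  simp [grad]

/-- Real-valued test functions already suffice, by the fundamental lemma of the calculus of
variations. -/
lemma ae_eq_zero_of_pair_eq_zero {Ω : Set E3} (hΩ : IsOpen Ω) {f : E3 → ℂ}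
    (hf : LocallyIntegrableOn f Ω) (h : ∀ φ, IsTest Ω φ → pair Ω φ f = 0) :
    f =ᵐ[volume.restrict Ω] 0 := by
  rw [EventuallyEq, ae_restrict_iff' hΩ.measurableSet]
  refine hΩ.ae_eq_zero_of_integral_contDiff_smul_eq_zero hf fun ψ hψ hψs hψΩ => ?_
  have ht : tsupport (fun x => (ψ x : ℂ)) ⊆ tsupport ψ := by
    refine closure_mono fun x hx h => hx ?_
    simp [h]
  have h1 := h (fun x => (ψ x : ℂ)) ⟨Complex.ofRealCLM.contDiff.comp hψ,
    hψs.comp_left Complex.ofReal_zero, ht.trans hψΩ⟩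
  rw [pair, setIntegral_eq_integral_of_forall_compl_eq_zero] at h1
  · simpa [Complex.real_smul] using h1
  · intro x hx
    have : ψ x = 0 := by
      by_contra h
      exact hx (hψΩ (subset_tsupport ψ h))
    simp [this]

/-- **Weyl's lemma** for the Helmholtz operator. -/
lemma exists_contDiffOn_ae_eq_of_weak_helmholtz {Ω : Set E3} (hΩ : IsOpen Ω) {α : ℂ} {F : E3 → ℂ}
    (hF : LocallyIntegrableOn F Ω)
    (h : ∀ φ, IsTest Ω φ → ∫ x in Ω, F x * (lap φ x + α ^ 2 * φ x) = 0) :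
    ∃ u : E3 → ℂ, ContDiffOn ℝ 1 u Ω ∧ u =ᵐ[volume.restrict Ω] F := by
  choose! r hr hb g hg hFg using
    fun x₀ hx₀ => exists_contDiff_ae_eq_of_weak_helmholtz hΩ hF h (x₀ := x₀) hx₀
  -- Two local representatives are continuous and agree almost everywhere on the open overlap of
  -- their balls, hence everywhere there. So the diagonal choice `g y y` is locally one smooth
  -- function.
  have key : ∀ x ∈ Ω, Set.EqOn (fun y => g y y) (g x) (Metric.ball x (r x)) := by
    intro x hx y hy
    have hyΩ := hb x hx hy
    set U := Metric.ball x (r x) ∩ Metric.ball y (r y)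
    have hU : IsOpen U := Metric.isOpen_ball.inter Metric.isOpen_ball
    have he : g y =ᵐ[volume.restrict U] g x := by
      rw [EventuallyEq, ae_restrict_iff' hU.measurableSet]
      filter_upwards [hFg x hx, hFg y hyΩ] with z h1 h2 hz
      rw [← h1 hz.1, ← h2 hz.2]
    exact Measure.eqOn_open_of_ae_eq he hU (hg y hyΩ).continuous.continuousOn
      (hg x hx).continuous.continuousOn ⟨hy, Metric.mem_ball_self (hr y hyΩ)⟩
  refine ⟨fun y => g y y, fun x hx => ?_, ?_⟩
  · have : ContDiffAt ℝ 1 (g x) x := ((hg x hx).of_le (by simp)).contDiffAt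
    refine (this.congr_of_eventuallyEq ?_).contDiffWithinAt
    exact (key x hx).eventuallyEq_of_mem (Metric.ball_mem_nhds x (hr x hx))
  · rw [EventuallyEq, ae_restrict_iff' hΩ.measurableSet, ae_iff]
    refine measure_null_of_locally_null _ fun x hx => ?_
    simp only [Set.mem_ofPred_eq, Classical.not_imp] at hx
    refine ⟨Metric.ball x (r x) ∩ {a | ¬(a ∈ Ω → g a a = F a)},
      inter_mem (mem_nhdsWithin_of_mem_nhds (Metric.ball_mem_nhds x (hr x hx.1)))
        self_mem_nhdsWithin, ?_⟩
    · refine measure_mono_null ?_ (ae_iff.1 (hFg x hx.1))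
      rintro y ⟨hy1, hy2⟩ hy3
      exact hy2 fun _ => by rw [hy3 hy1]; exact key x hx.1 hy1

/-! ### Weak and classical force-free fields -/

/-- The components of a weak force-free field are weak solutions of the Helmholtz equation. -/
lemma pair_lap_of_weak_forceFree {Ω : Set E3} {κ : ℂ} {U : E3 → C3}
    (hc : IsWeakCurl Ω U fun x => -κ • U x) (hd : IsWeakDiv Ω U 0) (i : Fin 3) {φ : E3 → ℂ}
    (hφ : IsTest Ω φ) :
    ∫ x in Ω, U x i * (lap φ x + κ ^ 2 * φ x) = 0 := by
  obtain ⟨hU, -, hc⟩ := isWeakCurl_iff.1 hc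
  obtain ⟨-, -, hd⟩ := isWeakDiv_iff.1 hd
  have hUi := locallyIntegrableOn_eval hU
  have e : ∫ x in Ω, U x i * (lap φ x + κ ^ 2 * φ x) =
      pair Ω (pd 0 (pd 0 φ)) (fun x => U x i) + pair Ω (pd 1 (pd 1 φ)) (fun x => U x i) +
        pair Ω (pd 2 (pd 2 φ)) (fun x => U x i) + κ ^ 2 * pair Ω φ fun x => U x i := by
    have h0 := ((hφ.pd 0).pd 0).integrableOn_mul (hUi i)
    have h1 := ((hφ.pd 1).pd 1).integrableOn_mul (hUi i)
    have h2 := ((hφ.pd 2).pd 2).integrableOn_mul (hUi i)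
    have h3 := (hφ.integrableOn_mul (hUi i)).const_mul (κ ^ 2)
    have h01 : IntegrableOn (fun x => pd 0 (pd 0 φ) x * U x i + pd 1 (pd 1 φ) x * U x i) Ω :=
      h0.add h1
    have h02 : IntegrableOn (fun x => pd 0 (pd 0 φ) x * U x i + pd 1 (pd 1 φ) x * U x i +
      pd 2 (pd 2 φ) x * U x i) Ω := h01.add h2
    simp only [pair]
    rw [← integral_add h0 h1, ← integral_add h01 h2, ← integral_const_mul,
      ← integral_add h02 h3]
    congr 1 with x
    simp only [lap, Fin.sum_univ_three]
    ring
  have hk : ∀ (ψ : E3 → ℂ) (l : Fin 3), pair Ω ψ (fun x => (-κ • U x) l) =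
      -κ * pair Ω ψ fun x => U x l := by
    intro ψ l
    simp only [pair, ← integral_const_mul, Pi.smul_apply, smul_eq_mul]
    congr 1 with x
    ring
  have hz : ∀ ψ, pair Ω ψ 0 = 0 := fun ψ => by simp [pair]
  simp only [hk] at hc
  simp only [hz, Fin.sum_univ_three] at hd
  have hcomm : ∀ a b, pd a (pd b φ) = pd b (pd a φ) := fun a b => by
    simp only [pd_eq_dd]
    exact dd_comm hφ.1 _ _
  have c := hc φ hφ
  have c0 := hc _ (hφ.pd 0)
  have c1 := hc _ (hφ.pd 1)
  have c2 := hc _ (hφ.pd 2)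
  have d0 := hd _ (hφ.pd 0)
  have d1 := hd _ (hφ.pd 1)
  have d2 := hd _ (hφ.pd 2)
  rw [hcomm 1 0, hcomm 2 0] at *
  rw [hcomm 2 1] at *
  rw [e]
  -- The weak form of `curl curl = grad div - Δ`: the curl equation is tested with `κ φ` and with
  -- first derivatives of `φ`, the divergence equation with `∂ᵢφ`.
  fin_cases i <;> simp only [Fin.zero_eta, Fin.mk_one, Fin.reduceFinMk]
  · linear_combination (-κ) * c.1 - c1.2.2 + c2.2.1 + d0
  · linear_combination (-κ) * c.2.1 - c2.1 + c0.2.2 + d1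
  · linear_combination (-κ) * c.2.2 - c0.2.1 + c1.1 + d2

lemma pair_congr {Ω : Set E3} {f g : E3 → ℂ} (h : f =ᵐ[volume.restrict Ω] g) (φ : E3 → ℂ) :
    pair Ω φ f = pair Ω φ g :=
  integral_congr_ae (h.mono fun x hx => by simp only [hx])

lemma pair_const_mul (Ω : Set E3) (φ : E3 → ℂ) (c : ℂ) (f : E3 → ℂ) :
    pair Ω φ (fun x => c * f x) = c * pair Ω φ f := by
  simp only [pair, ← integral_const_mul]
  congr 1 with x
  ring

lemma IsTest.pair_add {Ω : Set E3} {φ f g : E3 → ℂ} (hφ : IsTest Ω φ)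
    (hf : LocallyIntegrableOn f Ω) (hg : LocallyIntegrableOn g Ω) :
    pair Ω φ (fun x => f x + g x) = pair Ω φ f + pair Ω φ g := by
  simp only [pair, mul_add]
  exact integral_add (hφ.integrableOn_mul hf) (hφ.integrableOn_mul hg)

lemma IsTest.pair_sub {Ω : Set E3} {φ f g : E3 → ℂ} (hφ : IsTest Ω φ)
    (hf : LocallyIntegrableOn f Ω) (hg : LocallyIntegrableOn g Ω) :
    pair Ω φ (fun x => f x - g x) = pair Ω φ f - pair Ω φ g := by
  simp only [pair, mul_sub]
  exact integral_sub (hφ.integrableOn_mul hf) (hφ.integrableOn_mul hg)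

lemma IsTest.eq_zero {Ω : Set E3} {φ : E3 → ℂ} (hφ : IsTest Ω φ) {x : E3} (hx : x ∉ Ω) :
    φ x = 0 := by
  by_contra h
  exact hx (hφ.2.2 (subset_tsupport φ h))

lemma IsTest.integrable_mul {Ω : Set E3} {φ f : E3 → ℂ} (hφ : IsTest Ω φ)
    (hf : LocallyIntegrableOn f Ω) : Integrable fun x => φ x * f x := by
  rw [← integrableOn_iff_integrable_of_support_subset (s := Ω)]
  · exact hφ.integrableOn_mul hf
  · intro x hx
    by_contra h
    exact hx (by simp [hφ.eq_zero h])

lemma IsTest.pair_eq {Ω : Set E3} {φ : E3 → ℂ} (hφ : IsTest Ω φ) (f : E3 → ℂ) :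
    pair Ω φ f = ∫ x, φ x * f x :=
  setIntegral_eq_integral_of_forall_compl_eq_zero fun x hx => by simp [hφ.eq_zero hx]

lemma continuousOn_pd {Ω : Set E3} (hΩ : IsOpen Ω) {f : E3 → ℂ} (hf : ContDiffOn ℝ 1 f Ω)
    (k : Fin 3) : ContinuousOn (pd k f) Ω :=
  (hf.continuousOn_fderiv_of_isOpen hΩ le_rfl).clm_apply continuousOn_const

lemma pair_pd_of_contDiffOn {Ω : Set E3} (hΩ : IsOpen Ω) {f φ : E3 → ℂ}
    (hf : ContDiffOn ℝ 1 f Ω) (hφ : IsTest Ω φ) (k : Fin 3) :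
    pair Ω (pd k φ) f = -pair Ω φ (pd k f) := by
  have hfl := hf.continuousOn.locallyIntegrableOn (μ := volume) hΩ.measurableSet
  have hdl := (continuousOn_pd hΩ hf k).locallyIntegrableOn (μ := volume) hΩ.measurableSet
  rw [hφ.pair_eq, (hφ.pd k).pair_eq]
  have e1 : (fun x => pd k φ x * f x) = fun x => f x * pd k φ x := by ext; ring
  have e2 : (fun x => φ x * pd k f x) = fun x => pd k f x * φ x := by ext; ring
  have e3 : (fun x => φ x * f x) = fun x => f x * φ x := by ext; ring
  rw [e1, e2]
  exact integral_mul_fderiv_eq_neg_fderiv_mul_of_integrable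
    (e2 ▸ hφ.integrable_mul hdl) (e1 ▸ (hφ.pd k).integrable_mul hfl) (e3 ▸ hφ.integrable_mul hfl)
    (fun x hx => (hf.contDiffAt (hΩ.mem_nhds (hφ.2.2 hx))).differentiableAt (by simp))
    (fun x _ => hφ.1.contDiffAt.differentiableAt (by simp))

lemma eqOn_zero_of_pair_eq_zero {Ω : Set E3} (hΩ : IsOpen Ω) {w : E3 → ℂ}
    (hw : ContinuousOn w Ω) (h : ∀ φ, IsTest Ω φ → pair Ω φ w = 0) : Set.EqOn w 0 Ω :=
  Measure.eqOn_open_of_ae_eq (ae_eq_zero_of_pair_eq_zero hΩ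
    (hw.locallyIntegrableOn hΩ.measurableSet) h) hΩ hw continuousOn_const

section classical

variable {Ω : Set E3} {u : E3 → C3}

lemma contDiffOn_eval (hu : ContDiffOn ℝ 1 u Ω) (i : Fin 3) :
    ContDiffOn ℝ 1 (fun x => u x i) Ω :=
  contDiffOn_pi.1 hu i

lemma continuousOn_divergence (hΩ : IsOpen Ω) (hu : ContDiffOn ℝ 1 u Ω) :
    ContinuousOn (divergence u) Ω :=
  continuousOn_finsetSum _ fun i _ => continuousOn_pd hΩ (contDiffOn_eval hu i) i

lemma continuousOn_curl (hΩ : IsOpen Ω) (hu : ContDiffOn ℝ 1 u Ω) : ContinuousOn (curl u) Ω := by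
  have h := fun i k => continuousOn_pd hΩ (contDiffOn_eval hu i) k
  refine continuousOn_pi.2 fun i => ?_
  fin_cases i
  · exact (h 2 1).sub (h 1 2)
  · exact (h 0 2).sub (h 2 0)
  · exact (h 1 0).sub (h 0 1)

lemma isWeakDiv_divergence (hΩ : IsOpen Ω) (hu : ContDiffOn ℝ 1 u Ω) :
    IsWeakDiv Ω u (divergence u) := by
  have hd := fun i k => (continuousOn_pd hΩ (contDiffOn_eval hu i) k).locallyIntegrableOn
    (μ := volume) hΩ.measurableSet
  refine isWeakDiv_iff.2 ⟨hu.continuousOn.locallyIntegrableOn hΩ.measurableSet,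
    (continuousOn_divergence hΩ hu).locallyIntegrableOn hΩ.measurableSet, fun φ hφ => ?_⟩
  have e : divergence u = fun x => pd 0 (fun y => u y 0) x + pd 1 (fun y => u y 1) x +
      pd 2 (fun y => u y 2) x := by
    ext x; simp [divergence, Fin.sum_univ_three]
  rw [e, hφ.pair_add (f := fun x => pd 0 (fun y => u y 0) x + pd 1 (fun y => u y 1) x)
    ((hd 0 0).add (hd 1 1)) (hd 2 2), hφ.pair_add (hd 0 0) (hd 1 1)]
  simp only [Fin.sum_univ_three, pair_pd_of_contDiffOn hΩ (contDiffOn_eval hu _) hφ]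
  ring

lemma isWeakCurl_curl (hΩ : IsOpen Ω) (hu : ContDiffOn ℝ 1 u Ω) : IsWeakCurl Ω u (curl u) := by
  have hd := fun i k => (continuousOn_pd hΩ (contDiffOn_eval hu i) k).locallyIntegrableOn
    (μ := volume) hΩ.measurableSet
  refine isWeakCurl_iff.2 ⟨hu.continuousOn.locallyIntegrableOn hΩ.measurableSet,
    (continuousOn_curl hΩ hu).locallyIntegrableOn hΩ.measurableSet, fun φ hφ => ?_⟩
  simp only [pair_pd_of_contDiffOn hΩ (contDiffOn_eval hu _) hφ, curl, Matrix.cons_val]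
  refine ⟨?_, ?_, ?_⟩
  · rw [hφ.pair_sub (hd 2 1) (hd 1 2)]; ring
  · rw [hφ.pair_sub (hd 0 2) (hd 2 0)]; ring
  · rw [hφ.pair_sub (hd 1 0) (hd 0 1)]; ring

end classical

lemma IsWeakDiv.unique {Ω : Set E3} (hΩ : IsOpen Ω) {F : E3 → C3} {d d' : E3 → ℂ}
    (h : IsWeakDiv Ω F d) (h' : IsWeakDiv Ω F d') : d =ᵐ[volume.restrict Ω] d' := by
  have := ae_eq_zero_of_pair_eq_zero hΩ (h.2.1.sub h'.2.1) fun φ hφ => by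
    rw [show d - d' = fun x => d x - d' x from rfl, hφ.pair_sub h.2.1 h'.2.1]
    exact sub_eq_zero.2 ((h.2.2 φ hφ).trans (h'.2.2 φ hφ).symm)
  exact this.mono fun x hx => sub_eq_zero.1 hx

lemma IsWeakCurl.unique {Ω : Set E3} (hΩ : IsOpen Ω) {F G G' : E3 → C3}
    (h : IsWeakCurl Ω F G) (h' : IsWeakCurl Ω F G') : G =ᵐ[volume.restrict Ω] G' := by
  have key : ∀ i, (fun x => G x i - G' x i) =ᵐ[volume.restrict Ω] 0 := fun i => by
    have h1 := locallyIntegrableOn_eval h.2.1 i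
    have h2 := locallyIntegrableOn_eval h'.2.1 i
    refine ae_eq_zero_of_pair_eq_zero hΩ (h1.sub h2) fun φ hφ => ?_
    rw [hφ.pair_sub h1 h2, sub_eq_zero]
    have := congrFun ((h.2.2 φ hφ).trans (h'.2.2 φ hφ).symm) i
    rwa [integral_smul_apply fun i => hφ.integrableOn_mul (locallyIntegrableOn_eval h.2.1 i),
      integral_smul_apply fun i => hφ.integrableOn_mul (locallyIntegrableOn_eval h'.2.1 i)] at this
  filter_upwards [key 0, key 1, key 2] with x h0 h1 h2
  ext i
  fin_cases i
  exacts [sub_eq_zero.1 h0, sub_eq_zero.1 h1, sub_eq_zero.1 h2]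

lemma IsForceFree.isWeakDiv {Ω : Set E3} (hΩ : IsOpen Ω) {κ : ℂ} {u : E3 → C3}
    (h : IsForceFree Ω κ u) : IsWeakDiv Ω u 0 := by
  have h0 := isWeakDiv_divergence hΩ h.1
  refine ⟨h0.1, continuousOn_const.locallyIntegrableOn hΩ.measurableSet, fun φ hφ => ?_⟩
  rw [← h0.2.2 φ hφ]
  exact setIntegral_congr_fun hΩ.measurableSet fun x hx => by simp [(h.2 x hx).1]

lemma IsForceFree.isWeakCurl {Ω : Set E3} (hΩ : IsOpen Ω) {κ : ℂ} {u : E3 → C3}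
    (h : IsForceFree Ω κ u) : IsWeakCurl Ω u fun x => -κ • u x := by
  have h0 := isWeakCurl_curl hΩ h.1
  refine ⟨h0.1, (h.1.continuousOn.const_smul (-κ)).locallyIntegrableOn hΩ.measurableSet,
    fun φ hφ => ?_⟩
  rw [← h0.2.2 φ hφ]
  refine setIntegral_congr_fun hΩ.measurableSet fun x hx => ?_
  simp only
  rw [eq_neg_of_add_eq_zero_left (h.2 x hx).2, neg_smul]

/-- A weak force-free field is almost everywhere equal to a classical one. -/
lemma exists_isForceFree_ae_eq {Ω : Set E3} (hΩ : IsOpen Ω) {κ : ℂ} {U : E3 → C3}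
    (hc : IsWeakCurl Ω U fun x => -κ • U x) (hd : IsWeakDiv Ω U 0) :
    ∃ u, IsForceFree Ω κ u ∧ u =ᵐ[volume.restrict Ω] U := by
  choose v hv hvU using fun i => exists_contDiffOn_ae_eq_of_weak_helmholtz hΩ
    (locallyIntegrableOn_eval hc.1 i) fun φ hφ => pair_lap_of_weak_forceFree hc hd i hφ
  set u : E3 → C3 := fun x i => v i x
  have hu : ContDiffOn ℝ 1 u Ω := contDiffOn_pi.2 hv
  have huU : u =ᵐ[volume.restrict Ω] U := by
    filter_upwards [hvU 0, hvU 1, hvU 2] with x h0 h1 h2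
    ext i
    fin_cases i
    exacts [h0, h1, h2]
  have hul : LocallyIntegrableOn u Ω := hu.continuousOn.locallyIntegrableOn hΩ.measurableSet
  have hdu : IsWeakDiv Ω u 0 := by
    refine ⟨hul, hd.2.1, fun φ hφ => ?_⟩
    rw [hd.2.2 φ hφ]
    congr 1
    exact integral_congr_ae (huU.mono fun x hx => by simp only [hx])
  have hcu : IsWeakCurl Ω u fun x => -κ • u x := by
    refine ⟨hul, (hu.continuousOn.const_smul (-κ)).locallyIntegrableOn hΩ.measurableSet,
      fun φ hφ => ?_⟩
    have e1 : ∫ x in Ω, φ x • -κ • u x = ∫ x in Ω, φ x • -κ • U x :=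
      integral_congr_ae (huU.mono fun x hx => by simp only [hx])
    have e2 : ∫ x in Ω, crossProduct (grad φ x) (u x) = ∫ x in Ω, crossProduct (grad φ x) (U x) :=
      integral_congr_ae (huU.mono fun x hx => by simp only [hx])
    rw [e1, e2]
    exact hc.2.2 φ hφ
  refine ⟨u, ⟨hu, fun x hx => ⟨?_, ?_⟩⟩, huU⟩
  · exact Measure.eqOn_open_of_ae_eq ((isWeakDiv_divergence hΩ hu).unique hΩ hdu) hΩ
      (continuousOn_divergence hΩ hu) continuousOn_const hx
  · have := Measure.eqOn_open_of_ae_eq ((isWeakCurl_curl hΩ hu).unique hΩ hcu) hΩ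
      (continuousOn_curl hΩ hu) (hu.continuousOn.const_smul (-κ)) hx
    simp only at this
    rw [this, neg_smul, neg_add_cancel]

/-! ### Duality, approximation and completeness in `L^p` -/

section Hoelder

variable {X : Type*} [MeasurableSpace X] {ν : Measure X} {p q : ENNReal}

lemma integrable_mul_of_memLp [ENNReal.HolderConjugate p q] {a b : X → ℂ} (ha : MemLp a p ν)
    (hb : MemLp b q ν) : Integrable (fun x => a x * b x) ν :=
  memLp_one_iff_integrable.1 (MemLp.mul hb ha (hpqr := inferInstanceAs (ENNReal.HolderTriple p q 1)))

/-- The pairing of `L^p` and `L^q` is continuous in the first argument. -/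
lemma tendsto_integral_mul_of_eLpNorm [ENNReal.HolderConjugate p q] {a : ℕ → X → ℂ} {a' b : X → ℂ}
    (ha : ∀ n, MemLp (a n) p ν) (ha' : MemLp a' p ν) (hb : MemLp b q ν)
    (h : Tendsto (fun n => eLpNorm (a n - a') p ν) atTop (𝓝 0)) :
    Tendsto (fun n => ∫ x, a n x * b x ∂ν) atTop (𝓝 (∫ x, a' x * b x ∂ν)) := by
  refine tendsto_integral_of_L1 _ (integrable_mul_of_memLp ha' hb).aestronglyMeasurable
    (Eventually.of_forall fun n => integrable_mul_of_memLp (ha n) hb) ?_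
  have h1 : Tendsto (fun n => eLpNorm (a n - a') p ν * eLpNorm b q ν) atTop (𝓝 0) := by
    simpa using ENNReal.Tendsto.mul_const h (Or.inr hb.2.ne)
  refine tendsto_of_tendsto_of_tendsto_of_le_of_le tendsto_const_nhds h1 (fun _ => zero_le)
    fun n => ?_
  have h2 := eLpNorm_smul_le_mul_eLpNorm (p := p) (q := q) (r := 1) hb.1 ((ha n).sub ha').1
  rw [eLpNorm_one_eq_lintegral_enorm] at h2
  refine le_trans (le_of_eq ?_) h2
  refine lintegral_congr fun x => ?_
  simp [sub_mul]

end Hoelder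

lemma conv_eq_integral (κ f : E3 → ℂ) (x : E3) : conv κ f x = ∫ y, κ (x - y) * f y := by
  rw [conv, ← integral_sub_left_eq_self _ _ x]
  simp

lemma eLpNorm_conv_le {κ f : E3 → ℂ} (hκ : Measurable κ) (hf : Measurable f) {p : ℝ} (hp : 1 < p) :
    eLpNorm (conv κ f) (ENNReal.ofReal p) volume ≤
      (∫⁻ x, ‖κ x‖ₑ) * eLpNorm f (ENNReal.ofReal p) volume := by
  have : conv κ f = fun x => ∫ y, κ (x - y) * f y := funext (conv_eq_integral κ f)
  rw [this]
  exact eLpNorm_integral_kernel_mul_le hκ hf hp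

lemma ae_integrable_conv {κ f : E3 → ℂ} (hκ : Integrable κ) (hf : Integrable f) :
    ∀ᵐ x, Integrable fun y => κ y * f (x - y) := by
  filter_upwards [hκ.ae_convolution_exists (ContinuousLinearMap.mul ℝ ℂ) hf] with x hx
  simpa [ConvolutionExistsAt] using hx

lemma conv_sub_ae {κ f g : E3 → ℂ} (hκ : Integrable κ) (hf : Integrable f) (hg : Integrable g) :
    conv κ f - conv κ g =ᵐ[volume] conv κ (f - g) := by
  filter_upwards [ae_integrable_conv hκ hf, ae_integrable_conv hκ hg] with x h1 h2
  simp only [conv, Pi.sub_apply, mul_sub]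
  rw [integral_sub h1 h2]

lemma tendsto_eLpNorm_conv {κ : E3 → ℂ} (hκ : Measurable κ) (hκi : Integrable κ) {p : ℝ}
    (hp : 1 < p) {f : ℕ → E3 → ℂ} {f' : E3 → ℂ} (hf : ∀ n, Measurable (f n))
    (hfi : ∀ n, Integrable (f n)) (hf' : Measurable f') (hfi' : Integrable f')
    (h : Tendsto (fun n => eLpNorm (f n - f') (ENNReal.ofReal p) volume) atTop (𝓝 0)) :
    Tendsto (fun n => eLpNorm (conv κ (f n) - conv κ f') (ENNReal.ofReal p) volume)
      atTop (𝓝 0) := by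
  have h1 : Tendsto (fun n => (∫⁻ x, ‖κ x‖ₑ) * eLpNorm (f n - f') (ENNReal.ofReal p) volume)
      atTop (𝓝 0) := by
    simpa using ENNReal.Tendsto.const_mul h (Or.inr hκi.2.ne)
  refine tendsto_of_tendsto_of_tendsto_of_le_of_le tendsto_const_nhds h1 (fun _ => zero_le)
    fun n => ?_
  simp only
  rw [eLpNorm_congr_ae (conv_sub_ae hκi (hfi n) hfi')]
  exact eLpNorm_conv_le hκ ((hf n).sub hf') hp

lemma memLp_conv {κ f : E3 → ℂ} (hκ : Measurable κ) (hκi : Integrable κ) {p : ℝ} (hp : 1 < p)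
    (hf : Measurable f) (hfp : MemLp f (ENNReal.ofReal p) volume) :
    MemLp (conv κ f) (ENNReal.ofReal p) volume := by
  refine ⟨?_, (eLpNorm_conv_le hκ hf hp).trans_lt (ENNReal.mul_lt_top hκi.2 hfp.2)⟩
  have : StronglyMeasurable fun z : E3 × E3 => κ z.2 * f (z.1 - z.2) :=
    ((hκ.comp measurable_snd).mul (hf.comp (measurable_fst.sub measurable_snd))).stronglyMeasurable
  exact this.integral_prod_right.aestronglyMeasurable

/-- First and second derivatives of the potential of a test function are controlled in `L^p` by
the test function. -/
lemma exists_eLpNorm_pd_conv_le {α : ℂ} {κ m : E3 → ℂ} {R : ℝ} (hκ : Measurable κ)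
    (hκi : Integrable κ) (hκ0 : ∀ x, R < ‖x‖ → κ x = 0) (hm : ContDiff ℝ (⊤ : ℕ∞) m)
    (hms : HasCompactSupport m)
    (H : ∀ φ : E3 → ℂ, ContDiff ℝ (⊤ : ℕ∞) φ → HasCompactSupport φ →
        ∫ x, κ x * (lap φ x + α ^ 2 * φ x) = φ 0 + ∫ x, m x * φ x) {p : ℝ} (hp : 1 < p) :
    ∃ C : ENNReal, C ≠ ⊤ ∧ ∀ g : E3 → ℂ, ContDiff ℝ (⊤ : ℕ∞) g → HasCompactSupport g →
      (∀ i, eLpNorm (pd i (conv κ g)) (ENNReal.ofReal p) volume ≤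
        C * eLpNorm g (ENNReal.ofReal p) volume) ∧
      ∀ i j, eLpNorm (pd i (pd j (conv κ g))) (ENNReal.ofReal p) volume ≤
        C * eLpNorm g (ENNReal.ofReal p) volume := by
  obtain ⟨C, hC⟩ := exists_eLpNorm_pd_pd_le hp
  have hp1 : 1 ≤ ENNReal.ofReal p := by simpa using hp.le
  have hmi : Integrable m := hm.continuous.integrable_of_hasCompactSupport hms
  set A := ∫⁻ x, ‖κ x‖ₑ
  set B := ∫⁻ x, ‖m x‖ₑ
  have hA : A ≠ ⊤ := hκi.2.ne
  have hB : B ≠ ⊤ := hmi.2.ne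
  set L : ENNReal := 1 + B + ‖α ^ 2‖ₑ * A
  refine ⟨2 * A + C * L, by finiteness, fun g hg hgs => ?_⟩
  set ψ := conv κ g
  have hψ : ContDiff ℝ (⊤ : ℕ∞) ψ := contDiff_conv hκi.locallyIntegrable hg hgs
  have hψs : HasCompactSupport ψ := hasCompactSupport_conv hκ0 hgs
  have hcm := contDiff_conv hm.continuous.locallyIntegrable hg hgs
  -- The parametrix identity expresses `Δψ` through `g`, `m * g` and `ψ`, each bounded by Young's
  -- inequality. Calderón-Zygmund turns this into a bound for all second derivatives.
  have e : lap ψ = (g + conv m g) - α ^ 2 • ψ := by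
    funext x
    have := helmholtz_conv hκi.locallyIntegrable H hg hgs x
    simp only [Pi.sub_apply, Pi.add_apply, Pi.smul_apply, smul_eq_mul]
    linear_combination this
  set N := eLpNorm g (ENNReal.ofReal p) volume
  have hlap : eLpNorm (lap ψ) (ENNReal.ofReal p) volume ≤ L * N := by
    rw [e]
    refine (eLpNorm_sub_le (hg.continuous.add hcm.continuous).aestronglyMeasurable
      (hψ.continuous.const_smul _).aestronglyMeasurable hp1).trans ?_
    refine (add_le_add (eLpNorm_add_le hg.continuous.aestronglyMeasurable
      hcm.continuous.aestronglyMeasurable hp1) le_rfl).trans ?_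
    rw [eLpNorm_const_smul]
    have h1 := eLpNorm_conv_le hκ hg.continuous.measurable hp
    have h2 := eLpNorm_conv_le hm.continuous.measurable hg.continuous.measurable hp
    calc _ ≤ N + B * N + ‖α ^ 2‖ₑ * (A * N) := by gcongr
      _ = L * N := by ring
  have h2 : ∀ i j, eLpNorm (pd i (pd j ψ)) (ENNReal.ofReal p) volume ≤ C * L * N := fun i j => by
    refine (hC i j ψ hψ hψs).trans ?_
    rw [mul_assoc]
    gcongr
  refine ⟨fun i => ?_, fun i j => (h2 i j).trans ?_⟩
  · calc eLpNorm (pd i ψ) (ENNReal.ofReal p) volume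
        ≤ 2 * eLpNorm ψ (ENNReal.ofReal p) volume +
          eLpNorm (pd i (pd i ψ)) (ENNReal.ofReal p) volume := eLpNorm_dd_le hψ hp _
      _ ≤ 2 * (A * N) + C * L * N := by
        gcongr
        · exact eLpNorm_conv_le hκ hg.continuous.measurable hp
        · exact h2 i i
      _ = _ := by ring
  · gcongr
    exact le_add_self

/-- A rapidly convergent approximation by test functions. -/
lemma exists_approx {p : ENNReal} (hp : p ≠ ⊤) (hp1 : 1 ≤ p) {f : E3 → ℂ} (hf : MemLp f p volume) :
    ∃ g : ℕ → E3 → ℂ, (∀ n, ContDiff ℝ (⊤ : ℕ∞) (g n)) ∧ (∀ n, HasCompactSupport (g n)) ∧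
      Tendsto (fun n => eLpNorm (g n - f) p volume) atTop (𝓝 0) ∧
      ∀ N n m, N ≤ n → N ≤ m → eLpNorm (g n - g m) p volume ≤ 2 * (2⁻¹ : ENNReal) ^ N := by
  have hε : ∀ n : ℕ, (0 : ℝ) < 2⁻¹ ^ n := fun n => by positivity
  choose g hgs hg hgf using fun n => hf.exist_eLpNorm_sub_le hp hp1 (hε n)
  have he : ∀ n : ℕ, ENNReal.ofReal (2⁻¹ ^ n) = (2⁻¹ : ENNReal) ^ n := fun n => by
    rw [ENNReal.ofReal_pow (by positivity), ENNReal.ofReal_inv_of_pos (by positivity)]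
    simp
  have hgf' : ∀ n, eLpNorm (g n - f) p volume ≤ (2⁻¹ : ENNReal) ^ n := fun n => by
    rw [eLpNorm_sub_comm, ← he]
    exact hgf n
  refine ⟨g, hg, hgs, ?_, fun N n m hn hm => ?_⟩
  · refine tendsto_of_tendsto_of_tendsto_of_le_of_le tendsto_const_nhds
      (ENNReal.tendsto_pow_atTop_nhds_zero_of_lt_one ?_) (fun _ => zero_le) hgf'
    simp
  · have e : g n - g m = (g n - f) - (g m - f) := by abel
    have hm' : ∀ n, AEStronglyMeasurable (g n - f) volume := fun n =>
      (hg n).continuous.aestronglyMeasurable.sub hf.1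
    have hmono : ∀ n, N ≤ n → (2⁻¹ : ENNReal) ^ n ≤ 2⁻¹ ^ N := fun n hn =>
      pow_le_pow_right_of_le_one' (by simp) hn
    rw [e, two_mul]
    exact (eLpNorm_sub_le (hm' n) (hm' m) hp1).trans
      (add_le_add ((hgf' n).trans (hmono n hn)) ((hgf' m).trans (hmono m hm)))

/-- Completeness of `L^p` for rapidly Cauchy sequences. -/
lemma exists_tendsto_eLpNorm {p : ENNReal} (hp1 : 1 ≤ p) {F : ℕ → E3 → ℂ}
    (hF : ∀ n, MemLp (F n) p volume) {C : ENNReal} (hC : C ≠ ⊤)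
    (h : ∀ N n m, N ≤ n → N ≤ m → eLpNorm (F n - F m) p volume ≤ C * (2⁻¹ : ENNReal) ^ N) :
    ∃ F' : E3 → ℂ, MemLp F' p volume ∧
      Tendsto (fun n => eLpNorm (F n - F') p volume) atTop (𝓝 0) := by
  -- The completeness criterion asks for a strict bound; `C + 1` provides it even when `C = 0`.
  refine Lp.cauchy_complete_eLpNorm hp1 hF (B := fun N => (C + 1) * (2⁻¹ : ENNReal) ^ N) ?_
    fun N n m hn hm => (h N n m hn hm).trans_lt ?_
  · rw [ENNReal.tsum_mul_left, ENNReal.tsum_geometric, ENNReal.one_sub_inv_two, inv_inv]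
    finiteness
  · have h0 : (2⁻¹ : ENNReal) ^ N ≠ 0 := by simp
    have h1 : (2⁻¹ : ENNReal) ^ N ≠ ⊤ := by simp
    exact (ENNReal.mul_lt_mul_iff_left h0 h1).2 (ENNReal.lt_add_right hC one_ne_zero)

lemma IsTest.memLp {Ω : Set E3} {φ : E3 → ℂ} (hφ : IsTest Ω φ) (q : ENNReal) (ν : Measure E3)
    [IsFiniteMeasureOnCompacts ν] : MemLp φ q ν :=
  hφ.1.continuous.memLp_of_hasCompactSupport hφ.2.1

lemma IsTest.tendsto_pair {Ω : Set E3} {φ : E3 → ℂ} (hφ : IsTest Ω φ) {p : ℝ} (hp : 1 < p)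
    {F : ℕ → E3 → ℂ} {F' : E3 → ℂ} (hF : ∀ n, MemLp (F n) (ENNReal.ofReal p) volume)
    (hF' : MemLp F' (ENNReal.ofReal p) volume)
    (h : Tendsto (fun n => eLpNorm (F n - F') (ENNReal.ofReal p) volume) atTop (𝓝 0)) :
    Tendsto (fun n => pair Ω φ (F n)) atTop (𝓝 (pair Ω φ F')) := by
  have := (Real.HolderConjugate.conjExponent hp).ennrealOfReal
  simp only [hφ.pair_eq, mul_comm (φ _)]
  exact tendsto_integral_mul_of_eLpNorm (q := ENNReal.ofReal p.conjExponent) hF hF'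
    (hφ.memLp _ _) h

lemma conv_sub_of_smooth {κ g g' : E3 → ℂ} (hκ : LocallyIntegrable κ) (hg : Continuous g)
    (hgs : HasCompactSupport g) (hg' : Continuous g') (hgs' : HasCompactSupport g') :
    conv κ (g - g') = conv κ g - conv κ g' := by
  funext x
  simp only [conv, Pi.sub_apply, mul_sub]
  exact integral_sub (integrable_mul_comp_sub hκ hg hgs x) (integrable_mul_comp_sub hκ hg' hgs' x)

lemma pd_sub {f g : E3 → ℂ} (hf : ContDiff ℝ (⊤ : ℕ∞) f) (hg : ContDiff ℝ (⊤ : ℕ∞) g)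
    (i : Fin 3) : pd i (f - g) = pd i f - pd i g := by
  funext x
  simp only [pd, Pi.sub_apply]
  rw [fderiv_sub (hf.contDiffAt.differentiableAt (by simp))
    (hg.contDiffAt.differentiableAt (by simp))]
  rfl

/-! ### Regularity of the Newton potential -/

/-- The smooth remainder of a parametrix vanishes where the parametrix is the fundamental
solution. -/
lemma remainder_eq_zero {α : ℂ} {κ m : E3 → ℂ} {r : ℝ} (hκ : ∀ x, ‖x‖ ≤ r → κ x = theta α x)
    (hm : Continuous m)
    (H : ∀ φ : E3 → ℂ, ContDiff ℝ (⊤ : ℕ∞) φ → HasCompactSupport φ →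
        ∫ x, κ x * (lap φ x + α ^ 2 * φ x) = φ 0 + ∫ x, m x * φ x) {x : E3} (hx : ‖x‖ < r) :
    m x = 0 := by
  refine eqOn_zero_of_pair_eq_zero (Metric.isOpen_ball (x := (0 : E3)) (ε := r)) hm.continuousOn
    (fun φ hφ => ?_) (by simpa using hx)
  -- For `φ` supported where `κ = θ`, the parametrix identity and the fundamental solution property
  -- have the same left side, so `∫ m φ = 0`.
  have h1 := H φ hφ.1 hφ.2.1
  have h2 := integral_theta_mul_helmholtz α hφ.1 hφ.2.1
  have h3 : ∫ x, κ x * (lap φ x + α ^ 2 * φ x) = ∫ x, theta α x * (lap φ x + α ^ 2 * φ x) := by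
    congr 1 with y
    by_cases hy : ‖y‖ < r
    · rw [hκ y hy.le]
    · have hy' : y ∉ Metric.ball (0 : E3) r := by simpa using hy
      have : lap φ y = 0 := Finset.sum_eq_zero fun i _ => ((hφ.pd i).pd i).eq_zero hy'
      rw [this, hφ.eq_zero hy']
      simp
  rw [h3, h2] at h1
  rw [hφ.pair_eq]
  have : ∫ x, m x * φ x = 0 := by linear_combination -h1
  simpa only [mul_comm] using this

/-- Regularity of the Helmholtz Newton potential of a scalar `L^p` function: first and second weak
derivatives are in `L^p`, and the potential solves the Helmholtz equation. -/
theorem exists_weak_derivs_potential {Ω : Set E3} (hΩ : IsOpen Ω) (hb : Bornology.IsBounded Ω)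
    (α : ℂ) {p : ℝ} (hp : 1 < p) {f : E3 → ℂ} (hf : MemLpOn Ω p f) :
    (∀ᵐ x ∂(volume.restrict Ω), IntegrableOn (fun y => theta α (x - y) * f y) Ω) ∧
    MemLpOn Ω p (fun x => ∫ y in Ω, theta α (x - y) * f y) ∧
    ∃ (D : Fin 3 → E3 → ℂ) (DD : Fin 3 → Fin 3 → E3 → ℂ),
      (∀ i, MemLpOn Ω p (D i)) ∧ (∀ i j, MemLpOn Ω p (DD i j)) ∧
      ∀ φ, IsTest Ω φ →
        (∀ i, pair Ω φ (D i) =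
          -pair Ω (pd i φ) fun x => ∫ y in Ω, theta α (x - y) * f y) ∧
        (∀ i j, pair Ω φ (DD i j) = -pair Ω (pd i φ) (D j)) ∧
        ∑ i, pair Ω φ (DD i i) = pair Ω φ f -
          α ^ 2 * pair Ω φ fun x => ∫ y in Ω, theta α (x - y) * f y := by
  have hp1 : 1 ≤ ENNReal.ofReal p := by simpa using hp.le
  have hpt : ENNReal.ofReal p ≠ ⊤ := ENNReal.ofReal_ne_top
  -- a measurable representative, extended by zero
  have hfm := hf.1.measurable_mk
  have hfe := hf.1.ae_eq_mk
  set f₁ : E3 → ℂ := Ω.indicator (hf.1.mk f) with hf₁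
  have hf₁m : Measurable f₁ := hfm.indicator hΩ.measurableSet
  have hf₁f : f =ᵐ[volume.restrict Ω] f₁ := by
    filter_upwards [hfe, ae_restrict_mem hΩ.measurableSet] with x h1 h2
    rw [hf₁, Set.indicator_of_mem h2, ← h1]
  have hf₁p : MemLp f₁ (ENNReal.ofReal p) volume :=
    (memLp_indicator_iff_restrict hΩ.measurableSet).2 (hf.ae_eq hfe)
  have hΩf : volume Ω < ⊤ := hb.measure_lt_top
  have : IsFiniteMeasure (volume.restrict Ω) := ⟨by simpa using hΩf⟩
  have hf₁i : Integrable f₁ :=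
    (integrable_indicator_iff hΩ.measurableSet).2 ((hf.ae_eq hfe).integrable hp1)
  -- the parametrix
  set r : ℝ := Metric.diam Ω + 1
  have hr : 0 < r := by positivity
  obtain ⟨κ, m, hκ, hκi, hκ0, hκθ, hm, hm0, H⟩ := exists_parametrix α hr (lt_add_one r)
  have hms : HasCompactSupport m :=
    HasCompactSupport.intro (isCompact_closedBall 0 (r + 1)) fun x hx => hm0 x (by simpa using hx)
  have hκz : ∀ x, r + 1 < ‖x‖ → κ x = 0 := fun x hx => hκ0 x hx.le
  have hκl := hκi.locallyIntegrable
  have hmi : Integrable m := hm.continuous.integrable_of_hasCompactSupport hms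
  have hdist : ∀ x ∈ Ω, ∀ y ∈ Ω, ‖x - y‖ < r := fun x hx y hy => by
    rw [← dist_eq_norm]
    exact (Metric.dist_le_diam_of_mem hb hx hy).trans_lt (lt_add_one _)
  -- the potential as a convolution
  set N : E3 → ℂ := fun x => ∫ y in Ω, theta α (x - y) * f y with hN
  have hker : ∀ x ∈ Ω, (fun y => Ω.indicator (fun y => theta α (x - y) * f₁ y) y) =
      fun y => κ (x - y) * f₁ y := by
    intro x hx
    funext y
    by_cases hy : y ∈ Ω
    · rw [Set.indicator_of_mem hy, hκθ _ (hdist x hx y hy).le]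
    · rw [Set.indicator_of_notMem hy, hf₁, Set.indicator_of_notMem hy, mul_zero]
  have hNκ : ∀ x ∈ Ω, N x = conv κ f₁ x := by
    intro x hx
    have h1 : N x = ∫ y in Ω, theta α (x - y) * f₁ y :=
      integral_congr_ae (hf₁f.mono fun y hy => by simp only [hy])
    rw [h1, conv_eq_integral, ← hker x hx, ← integral_indicator hΩ.measurableSet]
  have hNae : N =ᵐ[volume.restrict Ω] conv κ f₁ := by
    filter_upwards [ae_restrict_mem hΩ.measurableSet] with x hx using hNκ x hx
  have hc0 : ∀ x ∈ Ω, conv m f₁ x = 0 := by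
    intro x hx
    rw [conv_eq_integral]
    refine integral_eq_zero_of_ae (Eventually.of_forall fun y => ?_)
    by_cases hy : y ∈ Ω
    · simp [remainder_eq_zero hκθ hm.continuous H (hdist x hx y hy)]
    · simp [hf₁, Set.indicator_of_notMem hy]
  have hcp : MemLp (conv κ f₁) (ENNReal.ofReal p) volume := memLp_conv hκ hκi hp hf₁m hf₁p
  have hcmp : MemLp (conv m f₁) (ENNReal.ofReal p) volume :=
    memLp_conv hm.continuous.measurable hmi hp hf₁m hf₁p
  -- approximation
  obtain ⟨g, hg, hgs, hgf, hgc⟩ := exists_approx hpt hp1 hf₁p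
  obtain ⟨C, hC, hCb⟩ := exists_eLpNorm_pd_conv_le hκ hκi hκz hm hms H hp
  set ψ : ℕ → E3 → ℂ := fun n => conv κ (g n)
  have hψ : ∀ n, ContDiff ℝ (⊤ : ℕ∞) (ψ n) := fun n => contDiff_conv hκl (hg n) (hgs n)
  have hψs : ∀ n, HasCompactSupport (ψ n) := fun n => hasCompactSupport_conv hκz (hgs n)
  have hψsub : ∀ n l, ψ n - ψ l = conv κ (g n - g l) := fun n l =>
    (conv_sub_of_smooth hκl (hg n).continuous (hgs n) (hg l).continuous (hgs l)).symm
  have hpsub : ∀ i n l, pd i (ψ n) - pd i (ψ l) = pd i (conv κ (g n - g l)) := fun i n l => by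
    rw [← hψsub, pd_sub (hψ n) (hψ l)]
  have hppsub : ∀ i j n l, pd i (pd j (ψ n)) - pd i (pd j (ψ l)) =
      pd i (pd j (conv κ (g n - g l))) := fun i j n l => by
    rw [← hpsub, pd_sub (contDiff_pd (hψ n) j) (contDiff_pd (hψ l) j)]
  have hmemp : ∀ i n, MemLp (pd i (ψ n)) (ENNReal.ofReal p) volume := fun i n =>
    (contDiff_pd (hψ n) i).continuous.memLp_of_hasCompactSupport (hasCompactSupport_pd (hψs n) i)
  have hmempp : ∀ i j n, MemLp (pd i (pd j (ψ n))) (ENNReal.ofReal p) volume := fun i j n =>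
    (contDiff_pd (contDiff_pd (hψ n) j) i).continuous.memLp_of_hasCompactSupport
      (hasCompactSupport_pd (hasCompactSupport_pd (hψs n) j) i)
  have hC2 : C * 2 ≠ ⊤ := by finiteness
  -- The derivative bounds for `κ * g` make the derivatives of the approximating potentials Cauchy
  -- in `L^p`; their limits are the weak derivatives.
  have hD : ∀ i, ∃ F' : E3 → ℂ, MemLp F' (ENNReal.ofReal p) volume ∧
      Tendsto (fun n => eLpNorm (pd i (ψ n) - F') (ENNReal.ofReal p) volume) atTop (𝓝 0) :=
    fun i => exists_tendsto_eLpNorm hp1 (hmemp i) hC2 fun M n l hn hl => by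
      rw [hpsub, mul_assoc]
      exact ((hCb _ ((hg n).sub (hg l)) ((hgs n).sub (hgs l))).1 i).trans
        (mul_le_mul_right (hgc M n l hn hl) C)
  have hDD : ∀ i j, ∃ F' : E3 → ℂ, MemLp F' (ENNReal.ofReal p) volume ∧
      Tendsto (fun n => eLpNorm (pd i (pd j (ψ n)) - F') (ENNReal.ofReal p) volume)
        atTop (𝓝 0) :=
    fun i j => exists_tendsto_eLpNorm hp1 (hmempp i j) hC2 fun M n l hn hl => by
      rw [hppsub, mul_assoc]
      exact ((hCb _ ((hg n).sub (hg l)) ((hgs n).sub (hgs l))).2 i j).trans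
        (mul_le_mul_right (hgc M n l hn hl) C)
  choose D hDp hDt using hD
  choose DD hDDp hDDt using hDD
  have hgi : ∀ n, Integrable (g n) := fun n =>
    (hg n).continuous.integrable_of_hasCompactSupport (hgs n)
  have hgp : ∀ n, MemLp (g n) (ENNReal.ofReal p) volume := fun n =>
    (hg n).continuous.memLp_of_hasCompactSupport (hgs n)
  have hψp : ∀ n, MemLp (ψ n) (ENNReal.ofReal p) volume := fun n =>
    (hψ n).continuous.memLp_of_hasCompactSupport (hψs n)
  have hcm : ∀ n, ContDiff ℝ (⊤ : ℕ∞) (conv m (g n)) := fun n =>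
    contDiff_conv hm.continuous.locallyIntegrable (hg n) (hgs n)
  have hmp : ∀ n, MemLp (conv m (g n)) (ENNReal.ofReal p) volume := fun n =>
    (hcm n).continuous.memLp_of_hasCompactSupport (hasCompactSupport_conv hm0 (hgs n))
  have hψt := tendsto_eLpNorm_conv hκ hκi hp (fun n => (hg n).continuous.measurable) hgi hf₁m
    hf₁i hgf
  have hmt := tendsto_eLpNorm_conv hm.continuous.measurable hmi hp
    (fun n => (hg n).continuous.measurable) hgi hf₁m hf₁i hgf
  refine ⟨?_, (hcp.restrict Ω).ae_eq hNae.symm, D, DD, fun i => (hDp i).restrict Ω,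
    fun i j => (hDDp i j).restrict Ω, fun φ hφ => ⟨fun i => ?_, fun i j => ?_, ?_⟩⟩
  · filter_upwards [ae_restrict_of_ae (ae_integrable_conv hκi hf₁i),
      ae_restrict_mem hΩ.measurableSet] with x h1 hx
    have h2 : Integrable fun y => κ (x - y) * f₁ y := by
      have := h1.comp_sub_left x
      simpa using this
    rw [← hker x hx, integrable_indicator_iff hΩ.measurableSet] at h2
    exact Integrable.congr h2 (hf₁f.mono fun y hy => by simp only [hy])
  · rw [pair_congr hNae]
    refine tendsto_nhds_unique (hφ.tendsto_pair hp (hmemp i) (hDp i) (hDt i)) ?_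
    refine ((hφ.pd i).tendsto_pair hp hψp hcp hψt).neg.congr fun n => ?_
    rw [pair_pd_of_contDiffOn hΩ ((hψ n).of_le (by simp)).contDiffOn hφ, neg_neg]
  · refine tendsto_nhds_unique (hφ.tendsto_pair hp (hmempp i j) (hDDp i j) (hDDt i j)) ?_
    refine ((hφ.pd i).tendsto_pair hp (hmemp j) (hDp j) (hDt j)).neg.congr fun n => ?_
    rw [pair_pd_of_contDiffOn hΩ ((contDiff_pd (hψ n) j).of_le (by simp)).contDiffOn hφ, neg_neg]
  · rw [pair_congr hNae, pair_congr hf₁f]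
    have hz : pair Ω φ (conv m f₁) = 0 :=
      (setIntegral_congr_fun hΩ.measurableSet fun x hx => by
        rw [hc0 x hx, mul_zero]).trans (integral_zero _ _)
    have h1 := tendsto_finsetSum Finset.univ fun i _ =>
      hφ.tendsto_pair hp (hmempp i i) (hDDp i i) (hDDt i i)
    have h2 := ((hφ.tendsto_pair hp hgp hf₁p hgf).add (hφ.tendsto_pair hp hmp hcmp hmt)).sub
      ((hφ.tendsto_pair hp hψp hcp hψt).const_mul (α ^ 2))
    rw [hz, add_zero] at h2
    refine tendsto_nhds_unique h1 (h2.congr fun n => ?_)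
    have hloc : ∀ {F : E3 → ℂ}, Continuous F → LocallyIntegrableOn F Ω := fun hF =>
      hF.continuousOn.locallyIntegrableOn hΩ.measurableSet
    have hc := fun i => hloc (contDiff_pd (contDiff_pd (hψ n) i) i).continuous
    have e : (fun x => pd 0 (pd 0 (ψ n)) x + pd 1 (pd 1 (ψ n)) x + pd 2 (pd 2 (ψ n)) x) =
        fun x => (g n x + conv m (g n) x) - α ^ 2 * ψ n x := by
      funext x
      have := helmholtz_conv hκl H (hg n) (hgs n) x
      simp only [lap, Fin.sum_univ_three] at this
      linear_combination this
    have hs1 := hφ.pair_add (hc 0) (hc 1)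
    have hs2 := hφ.pair_add (f := fun x => pd 0 (pd 0 (ψ n)) x + pd 1 (pd 1 (ψ n)) x)
      ((hc 0).add (hc 1)) (hc 2)
    have hs3 := hφ.pair_sub (f := fun x => g n x + conv m (g n) x) (g := fun x => α ^ 2 * ψ n x)
      (hloc ((hg n).continuous.add (hcm n).continuous)) (hloc ((hψ n).continuous.const_smul (α ^ 2)))
    rw [e, hs3, hφ.pair_add (hloc (hg n).continuous) (hloc (hcm n).continuous),
      pair_const_mul] at hs2
    rw [Fin.sum_univ_three, ← hs1, ← hs2]

lemma IsTest.pd_comm {Ω : Set E3} {φ : E3 → ℂ} (hφ : IsTest Ω φ) (a b : Fin 3) :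
    ChiralMaxwell.pd a (ChiralMaxwell.pd b φ) = ChiralMaxwell.pd b (ChiralMaxwell.pd a φ) := by
  simp only [pd_eq_dd]
  exact dd_comm hφ.1 _ _

/-- A weak curl is weakly divergence free. -/
lemma IsWeakCurl.isWeakDiv_zero {Ω : Set E3} (hΩ : IsOpen Ω) {F G : E3 → C3}
    (h : IsWeakCurl Ω F G) : IsWeakDiv Ω G 0 := by
  obtain ⟨hF, hG, h⟩ := isWeakCurl_iff.1 h
  refine isWeakDiv_iff.2 ⟨hG, continuousOn_const.locallyIntegrableOn hΩ.measurableSet,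
    fun φ hφ => ?_⟩
  have hz : pair Ω φ 0 = 0 := by simp [pair]
  rw [hz, Fin.sum_univ_three, (h _ (hφ.pd 0)).1, (h _ (hφ.pd 1)).2.1, (h _ (hφ.pd 2)).2.2,
    hφ.pd_comm 1 0, hφ.pd_comm 2 0, hφ.pd_comm 2 1]
  ring

lemma MemLpOn.locallyIntegrableOn {V : Type} [NormedAddCommGroup V] {Ω : Set E3}
    (hb : Bornology.IsBounded Ω) {p : ℝ} (hp : 1 < p) {F : E3 → V} (hF : MemLpOn Ω p F) :
    LocallyIntegrableOn F Ω := by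
  have : IsFiniteMeasure (volume.restrict Ω) := ⟨by simpa using hb.measure_lt_top⟩
  have : IntegrableOn F Ω := MemLp.integrable (q := ENNReal.ofReal p) (by simpa using hp.le) hF
  exact this.locallyIntegrableOn

/-- The weak curl and double curl of the Newton potential `W` of an `L^p` field `j` are in `L^p`,
and `curl (curl curl W + j) = α² curl W`. -/
theorem exists_weak_curl_newton {Ω : Set E3} (hΩ : IsOpen Ω) (hb : Bornology.IsBounded Ω)
    (α : ℂ) {p : ℝ} (hp : 1 < p) {j : E3 → C3} (hj : MemLpOn Ω p j) :
    ∃ C K : E3 → C3, MemLpOn Ω p C ∧ IsWeakCurl Ω (newton Ω α j) C ∧ MemLpOn Ω p K ∧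
      IsWeakCurl Ω C K ∧ IsWeakCurl Ω (fun x => K x + j x) (fun x => α ^ 2 • C x) := by
  have hji : ∀ i, MemLpOn Ω p fun x => j x i := fun i => MemLp.eval hj i
  choose hint hN D DD hD hDD hφD using fun l => exists_weak_derivs_potential hΩ hb α hp (hji l)
  set W : Fin 3 → E3 → ℂ := fun l x => ∫ y in Ω, theta α (x - y) * j y l with hW
  have hWe : newton Ω α j =ᵐ[volume.restrict Ω] fun x l => W l x := by
    filter_upwards [hint 0, hint 1, hint 2] with x h0 h1 h2
    funext l
    refine eval_integral (f := fun y => theta α (x - y) • j y) (fun i => ?_) l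
    fin_cases i
    exacts [h0, h1, h2]
  have hWp : MemLpOn Ω p (newton Ω α j) := (MemLp.of_eval hN).ae_eq hWe.symm
  have loc : ∀ {f : E3 → ℂ}, MemLpOn Ω p f → LocallyIntegrableOn f Ω :=
    fun hf => hf.locallyIntegrableOn hb hp
  have lD : ∀ l i, LocallyIntegrableOn (D l i) Ω := fun l i => loc (hD l i)
  have lDD : ∀ l i k, LocallyIntegrableOn (DD l i k) Ω := fun l i k => loc (hDD l i k)
  -- In these formulas `D l i` plays the part of `∂ᵢ W_l` and `DD l i k` that of `∂ᵢ ∂ₖ W_l`.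
  set C : E3 → C3 := fun x => ![D 2 1 x - D 1 2 x, D 0 2 x - D 2 0 x, D 1 0 x - D 0 1 x] with hC
  set K : E3 → C3 := fun x => ![(DD 1 1 0 x - DD 0 1 1 x) - (DD 0 2 2 x - DD 2 2 0 x),
    (DD 2 2 1 x - DD 1 2 2 x) - (DD 1 0 0 x - DD 0 0 1 x),
    (DD 0 0 2 x - DD 2 0 0 x) - (DD 2 1 1 x - DD 1 1 2 x)] with hK
  have hCp : MemLpOn Ω p C := MemLp.of_eval fun i => by
    fin_cases i
    exacts [(hD _ _).sub (hD _ _), (hD _ _).sub (hD _ _), (hD _ _).sub (hD _ _)]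
  have hKp : MemLpOn Ω p K := MemLp.of_eval fun i => by
    fin_cases i
    exacts [((hDD _ _ _).sub (hDD _ _ _)).sub ((hDD _ _ _).sub (hDD _ _ _)),
      ((hDD _ _ _).sub (hDD _ _ _)).sub ((hDD _ _ _).sub (hDD _ _ _)),
      ((hDD _ _ _).sub (hDD _ _ _)).sub ((hDD _ _ _).sub (hDD _ _ _))]
  have lC := hCp.locallyIntegrableOn hb hp
  have lK := hKp.locallyIntegrableOn hb hp
  have lj := hj.locallyIntegrableOn hb hp
  have eW : ∀ φ l, pair Ω φ (fun x => newton Ω α j x l) = pair Ω φ (W l) := fun φ l =>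
    pair_congr (hWe.mono fun x hx => by simp only [hx]) φ
  have p2 : ∀ {φ}, IsTest Ω φ → ∀ l i k l' i' k',
      pair Ω φ (fun x => DD l i k x - DD l' i' k' x) = pair Ω φ (DD l i k) - pair Ω φ (DD l' i' k') :=
    fun hφ l i k l' i' k' => hφ.pair_sub (lDD l i k) (lDD l' i' k')
  have pC : ∀ φ, IsTest Ω φ →
      pair Ω φ (fun x => C x 0) = pair Ω φ (D 2 1) - pair Ω φ (D 1 2) ∧
      pair Ω φ (fun x => C x 1) = pair Ω φ (D 0 2) - pair Ω φ (D 2 0) ∧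
      pair Ω φ (fun x => C x 2) = pair Ω φ (D 1 0) - pair Ω φ (D 0 1) := fun φ hφ =>
    ⟨hφ.pair_sub (lD _ _) (lD _ _), hφ.pair_sub (lD _ _) (lD _ _), hφ.pair_sub (lD _ _) (lD _ _)⟩
  have pK : ∀ φ, IsTest Ω φ →
      pair Ω φ (fun x => K x 0) = (pair Ω φ (DD 1 1 0) - pair Ω φ (DD 0 1 1)) -
        (pair Ω φ (DD 0 2 2) - pair Ω φ (DD 2 2 0)) ∧
      pair Ω φ (fun x => K x 1) = (pair Ω φ (DD 2 2 1) - pair Ω φ (DD 1 2 2)) -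
        (pair Ω φ (DD 1 0 0) - pair Ω φ (DD 0 0 1)) ∧
      pair Ω φ (fun x => K x 2) = (pair Ω φ (DD 0 0 2) - pair Ω φ (DD 2 0 0)) -
        (pair Ω φ (DD 2 1 1) - pair Ω φ (DD 1 1 2)) := fun φ hφ => by
    simp only [← p2 hφ]
    exact ⟨hφ.pair_sub ((lDD _ _ _).sub (lDD _ _ _)) ((lDD _ _ _).sub (lDD _ _ _)),
      hφ.pair_sub ((lDD _ _ _).sub (lDD _ _ _)) ((lDD _ _ _).sub (lDD _ _ _)),
      hφ.pair_sub ((lDD _ _ _).sub (lDD _ _ _)) ((lDD _ _ _).sub (lDD _ _ _))⟩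
  have d1 : ∀ φ, IsTest Ω φ → ∀ l i, pair Ω φ (D l i) = -pair Ω (pd i φ) (W l) :=
    fun φ hφ l i => (hφD l φ hφ).1 i
  have d2 : ∀ φ, IsTest Ω φ → ∀ l i k, pair Ω φ (DD l i k) = -pair Ω (pd i φ) (D l k) :=
    fun φ hφ l i k => (hφD l φ hφ).2.1 i k
  have d3 : ∀ φ, IsTest Ω φ → ∀ l, pair Ω φ (DD l 0 0) + pair Ω φ (DD l 1 1) +
      pair Ω φ (DD l 2 2) = pair Ω φ (fun x => j x l) - α ^ 2 * pair Ω φ (W l) :=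
    fun φ hφ l => by rw [← Fin.sum_univ_three (fun i => pair Ω φ (DD l i i))]; exact (hφD l φ hφ).2.2
  have hcurlC : IsWeakCurl Ω C K := by
    refine isWeakCurl_iff.2 ⟨lC, lK, fun φ hφ => ?_⟩
    simp only [(pK φ hφ).1, (pK φ hφ).2.1, (pK φ hφ).2.2, (pC _ (hφ.pd _)).1, (pC _ (hφ.pd _)).2.1,
      (pC _ (hφ.pd _)).2.2, d2 φ hφ]
    refine ⟨?_, ?_, ?_⟩ <;> ring
  refine ⟨C, K, hCp, ?_, hKp, hcurlC, ?_⟩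
  · refine isWeakCurl_iff.2 ⟨hWp.locallyIntegrableOn hb hp, lC, fun φ hφ => ?_⟩
    simp only [eW, (pC φ hφ).1, (pC φ hφ).2.1, (pC φ hφ).2.2, d1 φ hφ]
    refine ⟨?_, ?_, ?_⟩ <;> ring
  -- Weakly, `curl curl W + j = grad div W + α² W`. Taking the curl removes the gradient by symmetry
  -- of second derivatives of the test function.
  · have hdiv : ∀ φ, IsTest Ω φ → ∀ l, pair Ω φ (fun x => K x l) + pair Ω φ (fun x => j x l) =
        pair Ω (pd 0 (pd l φ)) (W 0) + pair Ω (pd 1 (pd l φ)) (W 1) +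
          pair Ω (pd 2 (pd l φ)) (W 2) + α ^ 2 * pair Ω φ (W l) := by
      intro φ hφ l
      have h3 := d3 φ hφ l
      have hk := pK φ hφ
      simp only [d2 φ hφ, d1 _ (hφ.pd _), neg_neg] at h3 hk
      rw [hφ.pd_comm 1 0, hφ.pd_comm 2 0, hφ.pd_comm 2 1] at hk
      fin_cases l <;> simp only [Fin.zero_eta, Fin.mk_one, Fin.reduceFinMk] at h3 ⊢
      · rw [hφ.pd_comm 1 0, hφ.pd_comm 2 0]
        linear_combination hk.1 - h3
      · rw [hφ.pd_comm 2 1]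
        linear_combination hk.2.1 - h3
      · linear_combination hk.2.2 - h3
    refine isWeakCurl_iff.2 ⟨lK.add lj, lC.smul (α ^ 2), fun φ hφ => ?_⟩
    have hs : ∀ k l, pair Ω (pd k φ) (fun x => (K x + j x) l) =
        pair Ω (pd k φ) (fun x => K x l) + pair Ω (pd k φ) (fun x => j x l) := fun k l =>
      (hφ.pd k).pair_add (locallyIntegrableOn_eval lK l) (locallyIntegrableOn_eval lj l)
    have hc : ∀ l, pair Ω φ (fun x => (α ^ 2 • C x) l) = α ^ 2 * pair Ω φ fun x => C x l :=
      fun l => pair_const_mul _ _ _ _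
    simp only [hs, hc, hdiv _ (hφ.pd _), (pC φ hφ).1, (pC φ hφ).2.1, (pC φ hφ).2.2, d1 φ hφ]
    rw [hφ.pd_comm 1 0, hφ.pd_comm 2 0, hφ.pd_comm 2 1]
    refine ⟨?_, ?_, ?_⟩ <;> ring

/-! ### Linear operations on weak derivatives -/

lemma locallyIntegrableOn_congr_ae {V : Type} [NormedAddCommGroup V] {Ω : Set E3} {F F' : E3 → V}
    (hF : LocallyIntegrableOn F Ω) (h : F =ᵐ[volume.restrict Ω] F') :
    LocallyIntegrableOn F' Ω := fun x hx => by
  obtain ⟨s, hs, hi⟩ := hF x hx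
  refine ⟨s ∩ Ω, inter_mem hs self_mem_nhdsWithin, ?_⟩
  have h1 : IntegrableOn F (s ∩ Ω) := hi.mono_set Set.inter_subset_left
  exact h1.congr (ae_restrict_of_ae_restrict_of_subset Set.inter_subset_right h)

section calculus

variable {Ω : Set E3} {φ : E3 → ℂ} {F F' G G' : E3 → C3} {d d' : E3 → ℂ}

lemma IsTest.integrableOn_smul (hφ : IsTest Ω φ) (hF : LocallyIntegrableOn F Ω) :
    IntegrableOn (fun x => φ x • F x) Ω :=
  Integrable.of_eval fun i => hφ.integrableOn_mul (locallyIntegrableOn_eval hF i)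

lemma IsTest.integrableOn_grad_mul (hφ : IsTest Ω φ) (hF : LocallyIntegrableOn F Ω) (i j : Fin 3) :
    IntegrableOn (fun x => grad φ x i * F x j) Ω :=
  (hφ.pd i).integrableOn_mul (locallyIntegrableOn_eval hF j)

lemma IsTest.integrableOn_crossProduct (hφ : IsTest Ω φ) (hF : LocallyIntegrableOn F Ω) :
    IntegrableOn (fun x => crossProduct (grad φ x) (F x)) Ω := by
  have h := hφ.integrableOn_grad_mul hF
  refine Integrable.of_eval fun i => ?_
  fin_cases i <;> simp only [cross_apply] <;> exact (h _ _).sub (h _ _)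

lemma IsTest.integrableOn_dotProduct (hφ : IsTest Ω φ) (hF : LocallyIntegrableOn F Ω) :
    IntegrableOn (fun x => dotProduct (grad φ x) (F x)) Ω :=
  integrable_finsetSum _ fun i _ => hφ.integrableOn_grad_mul hF i i

lemma IsTest.integral_smul_add (hφ : IsTest Ω φ) (hF : LocallyIntegrableOn F Ω)
    (hF' : LocallyIntegrableOn F' Ω) :
    ∫ x in Ω, φ x • (F x + F' x) = (∫ x in Ω, φ x • F x) + ∫ x in Ω, φ x • F' x := by
  simp only [smul_add]
  exact integral_add (hφ.integrableOn_smul hF) (hφ.integrableOn_smul hF')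

lemma IsTest.integral_crossProduct_add (hφ : IsTest Ω φ) (hF : LocallyIntegrableOn F Ω)
    (hF' : LocallyIntegrableOn F' Ω) :
    ∫ x in Ω, crossProduct (grad φ x) (F x + F' x) =
      (∫ x in Ω, crossProduct (grad φ x) (F x)) + ∫ x in Ω, crossProduct (grad φ x) (F' x) := by
  simp only [map_add]
  exact integral_add (hφ.integrableOn_crossProduct hF) (hφ.integrableOn_crossProduct hF')

lemma IsTest.integral_dotProduct_add (hφ : IsTest Ω φ) (hF : LocallyIntegrableOn F Ω)
    (hF' : LocallyIntegrableOn F' Ω) :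
    ∫ x in Ω, dotProduct (grad φ x) (F x + F' x) =
      (∫ x in Ω, dotProduct (grad φ x) (F x)) + ∫ x in Ω, dotProduct (grad φ x) (F' x) := by
  simp only [dotProduct_add]
  exact integral_add (hφ.integrableOn_dotProduct hF) (hφ.integrableOn_dotProduct hF')

lemma integral_smul_const_smul (Ω : Set E3) (φ : E3 → ℂ) (c : ℂ) (F : E3 → C3) :
    ∫ x in Ω, φ x • c • F x = c • ∫ x in Ω, φ x • F x := by
  rw [← integral_smul]
  congr 1 with x
  rw [smul_comm]

lemma integral_crossProduct_const_smul (Ω : Set E3) (g : E3 → C3) (c : ℂ) (F : E3 → C3) :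
    ∫ x in Ω, crossProduct (g x) (c • F x) = c • ∫ x in Ω, crossProduct (g x) (F x) := by
  rw [← integral_smul]
  congr 1 with x : 1
  rw [map_smul]

lemma integral_dotProduct_const_smul (Ω : Set E3) (g : E3 → C3) (c : ℂ) (F : E3 → C3) :
    ∫ x in Ω, dotProduct (g x) (c • F x) = c * ∫ x in Ω, dotProduct (g x) (F x) := by
  rw [← integral_const_mul]
  congr 1 with x
  rw [dotProduct_smul, smul_eq_mul]

lemma IsWeakCurl.add (h : IsWeakCurl Ω F G) (h' : IsWeakCurl Ω F' G') :
    IsWeakCurl Ω (fun x => F x + F' x) (fun x => G x + G' x) := by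
  refine ⟨h.1.add h'.1, h.2.1.add h'.2.1, fun φ hφ => ?_⟩
  rw [hφ.integral_smul_add h.2.1 h'.2.1, hφ.integral_crossProduct_add h.1 h'.1, h.2.2 φ hφ,
    h'.2.2 φ hφ, neg_add]

lemma IsWeakCurl.const_smul (h : IsWeakCurl Ω F G) (c : ℂ) :
    IsWeakCurl Ω (fun x => c • F x) (fun x => c • G x) := by
  refine ⟨h.1.smul c, h.2.1.smul c, fun φ hφ => ?_⟩
  rw [integral_smul_const_smul, integral_crossProduct_const_smul, h.2.2 φ hφ, smul_neg]

lemma IsWeakCurl.congr_ae (h : IsWeakCurl Ω F G)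
    (hF : F =ᵐ[volume.restrict Ω] F') (hG : G =ᵐ[volume.restrict Ω] G') : IsWeakCurl Ω F' G' := by
  refine ⟨locallyIntegrableOn_congr_ae h.1 hF, locallyIntegrableOn_congr_ae h.2.1 hG,
    fun φ hφ => ?_⟩
  have e1 : ∫ x in Ω, φ x • G x = ∫ x in Ω, φ x • G' x :=
    integral_congr_ae (hG.mono fun x hx => by simp only [hx])
  have e2 : ∫ x in Ω, crossProduct (grad φ x) (F x) = ∫ x in Ω, crossProduct (grad φ x) (F' x) :=
    integral_congr_ae (hF.mono fun x hx => by simp only [hx])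
  rw [← e1, ← e2]
  exact h.2.2 φ hφ

lemma IsWeakDiv.add (h : IsWeakDiv Ω F d) (h' : IsWeakDiv Ω F' d') :
    IsWeakDiv Ω (fun x => F x + F' x) (fun x => d x + d' x) := by
  refine ⟨h.1.add h'.1, h.2.1.add h'.2.1, fun φ hφ => ?_⟩
  have := hφ.pair_add h.2.1 h'.2.1
  simp only [pair] at this
  rw [this, hφ.integral_dotProduct_add h.1 h'.1, h.2.2 φ hφ, h'.2.2 φ hφ, neg_add]

lemma IsWeakDiv.const_smul (h : IsWeakDiv Ω F d) (c : ℂ) :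
    IsWeakDiv Ω (fun x => c • F x) (fun x => c * d x) := by
  refine ⟨h.1.smul c, h.2.1.smul c, fun φ hφ => ?_⟩
  have := pair_const_mul Ω φ c d
  simp only [pair] at this
  rw [this, integral_dotProduct_const_smul, h.2.2 φ hφ, mul_neg]

lemma IsWeakDiv.congr_ae (h : IsWeakDiv Ω F d)
    (hF : F =ᵐ[volume.restrict Ω] F') (hd : d =ᵐ[volume.restrict Ω] d') : IsWeakDiv Ω F' d' := by
  refine ⟨locallyIntegrableOn_congr_ae h.1 hF, locallyIntegrableOn_congr_ae h.2.1 hd,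
    fun φ hφ => ?_⟩
  have e1 : ∫ x in Ω, φ x * d x = ∫ x in Ω, φ x * d' x := pair_congr hd φ
  have e2 : ∫ x in Ω, dotProduct (grad φ x) (F x) = ∫ x in Ω, dotProduct (grad φ x) (F' x) :=
    integral_congr_ae (hF.mono fun x hx => by simp only [hx])
  rw [← e1, ← e2]
  exact h.2.2 φ hφ

end calculus

lemma IsForceFree.const_smul {Ω : Set E3} (hΩ : IsOpen Ω) {κ : ℂ} {u : E3 → C3}
    (h : IsForceFree Ω κ u) (c : ℂ) : IsForceFree Ω κ fun x => c • u x := by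
  refine ⟨h.1.const_smul c, fun x hx => ?_⟩
  have hd : ∀ i k, pd k (fun y => (c • u y) i) x = c * pd k (fun y => u y i) x := fun i k => by
    have := (((contDiffOn_eval h.1 i).contDiffAt (hΩ.mem_nhds hx)).differentiableAt (by simp))
    simp only [pd, Pi.smul_apply]
    rw [fderiv_fun_const_smul this]
    rfl
  obtain ⟨h1, h2⟩ := h.2 x hx
  have e1 : divergence (fun x => c • u x) x = c * divergence u x := by
    simp only [divergence, hd, Finset.mul_sum]
  have e2 : curl (fun x => c • u x) x = c • curl u x := by
    simp only [curl, hd]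
    ext i
    fin_cases i <;> simp <;> ring
  rw [e1, e2, h1, mul_zero, smul_comm κ c, ← smul_add, h2, smul_zero]
  exact ⟨rfl, rfl⟩

/-! ### Diagonalization into Beltrami equations -/

/-- The scalar algebra behind the diagonalization: `x` stands for a curl, `m` for a field, `n` for
the source. The relations `iωμB = -kA`, `iωεA = 1/2` and `2kB = 1` bring both equations to a common
scale; half their sum contains only `x₁, m₁` and half their difference only `x₂, m₂`. -/
lemma beltrami_iff {ω ε μ β k a b : ℂ} (hω : ω ≠ 0) (hε : ε ≠ 0) (hk : k ≠ 0)
    (hk2 : k ^ 2 = ω ^ 2 * ε * μ) (hβ₁ : 1 + k * β ≠ 0) (hβ₂ : 1 - k * β ≠ 0)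
    (ha : a = k / (1 + k * β)) (hb : b = k / (1 - k * β)) (x₁ x₂ m₁ m₂ n : ℂ) :
    (-(Complex.I / (2 * ω * ε)) * (x₁ + x₂) = Complex.I * ω * μ *
        (1 / (2 * k) * (m₁ - m₂) + β * (1 / (2 * k) * (x₁ - x₂))) ∧
      1 / (2 * k) * (x₁ - x₂) = -(Complex.I * ω * ε) * (-(Complex.I / (2 * ω * ε)) * (m₁ + m₂) +
        β * (-(Complex.I / (2 * ω * ε)) * (x₁ + x₂))) + n) ↔
    x₁ = -a * m₁ + a * n ∧ x₂ = b * m₂ - b * n := by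
  have ha' : a * (1 + k * β) = k := by rw [ha, div_mul_cancel₀ _ hβ₁]
  have hb' : b * (1 - k * β) = k := by rw [hb, div_mul_cancel₀ _ hβ₂]
  have hI : Complex.I ≠ 0 := Complex.I_ne_zero
  set A : ℂ := -(Complex.I / (2 * ω * ε)) with hA
  have hA0 : A ≠ 0 := neg_ne_zero.2 (div_ne_zero hI (mul_ne_zero (mul_ne_zero two_ne_zero hω) hε))
  set B : ℂ := 1 / (2 * k) with hB
  have hB1 : 2 * k * B = 1 := by rw [hB]; field_simp
  have hAB : Complex.I * ω * μ * B = -k * A := by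
    rw [hA, hB]
    field_simp
    linear_combination -hk2
  have hA2 : Complex.I * ω * ε * A = 1 / 2 := by
    rw [hA]
    field_simp
    linear_combination -Complex.I_sq
  constructor
  · rintro ⟨e1, e2⟩
    have s1 : x₁ + x₂ = -k * (m₁ - m₂ + β * (x₁ - x₂)) := by
      refine mul_left_cancel₀ hA0 ?_
      linear_combination e1 + (m₁ - m₂ + β * (x₁ - x₂)) * hAB
    have s2 : x₁ - x₂ = -k * (m₁ + m₂ + β * (x₁ + x₂)) + 2 * k * n := by
      linear_combination 2 * k * e2 - (x₁ - x₂) * hB1 - 2 * k * (m₁ + m₂ + β * (x₁ + x₂)) * hA2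
    constructor
    · refine mul_right_cancel₀ hβ₁ ?_
      linear_combination (1 / 2) * s1 + (1 / 2) * s2 + (m₁ - n) * ha'
    · refine mul_right_cancel₀ hβ₂ ?_
      linear_combination (1 / 2) * s1 - (1 / 2) * s2 - (m₂ - n) * hb'
  · rintro ⟨e1, e2⟩
    have t1 : (1 + k * β) * x₁ = -k * m₁ + k * n := by
      linear_combination (1 + k * β) * e1 + (n - m₁) * ha'
    have t2 : (1 - k * β) * x₂ = k * m₂ - k * n := by
      linear_combination (1 - k * β) * e2 + (m₂ - n) * hb'
    constructor
    · linear_combination A * (t1 + t2) - (m₁ - m₂ + β * (x₁ - x₂)) * hAB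
    · linear_combination B * (t1 - t2) + (n - (1 / 2) * (m₁ + m₂ + β * (x₁ + x₂))) * hB1 +
        (m₁ + m₂ + β * (x₁ + x₂)) * hA2

/-- Diagonalization of the chiral Maxwell system into two Beltrami equations. -/
lemma weakChiralMaxwell_iff {Ω : Set E3} {ω ε μ β k a b : ℂ} (hω : ω ≠ 0) (hε : ε ≠ 0)
    (hk : k ≠ 0) (hk2 : k ^ 2 = ω ^ 2 * ε * μ) (hβ₁ : 1 + k * β ≠ 0) (hβ₂ : 1 - k * β ≠ 0)
    (ha : a = k / (1 + k * β)) (hb : b = k / (1 - k * β)) {j Q₁ Q₂ : E3 → C3} {ρ : E3 → ℂ}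
    (hj : LocallyIntegrableOn j Ω) (hρ : LocallyIntegrableOn (fun x => Complex.I * ω * ρ x) Ω)
    (h₁ : LocallyIntegrableOn Q₁ Ω) (h₂ : LocallyIntegrableOn Q₂ Ω) :
    WeakChiralMaxwell Ω (smoothTests Ω) ω ε μ β j ρ
        (fun x => -(Complex.I / (2 * ω * ε)) • (Q₁ x + Q₂ x))
        (fun x => (1 / (2 * k)) • (Q₁ x + (-1 : ℂ) • Q₂ x)) ↔
      IsWeakCurl Ω Q₁ (fun x => -a • Q₁ x + a • j x) ∧
      IsWeakCurl Ω Q₂ (fun x => b • Q₂ x + -b • j x) ∧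
      IsWeakDiv Ω Q₁ (fun x => Complex.I * ω * ρ x) ∧
      IsWeakDiv Ω Q₂ (fun x => Complex.I * ω * ρ x) := by
  have hsplit : WeakChiralMaxwell Ω (smoothTests Ω) ω ε μ β j ρ
        (fun x => -(Complex.I / (2 * ω * ε)) • (Q₁ x + Q₂ x))
        (fun x => (1 / (2 * k)) • (Q₁ x + (-1 : ℂ) • Q₂ x)) ↔ ∀ φ, IsTest Ω φ →
      ((∫ x in Ω, φ x • (-a • Q₁ x + a • j x) = -∫ x in Ω, crossProduct (grad φ x) (Q₁ x)) ∧
        (∫ x in Ω, φ x • (b • Q₂ x + -b • j x) = -∫ x in Ω, crossProduct (grad φ x) (Q₂ x))) ∧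
      ((∫ x in Ω, φ x * (Complex.I * ω * ρ x) = -∫ x in Ω, dotProduct (grad φ x) (Q₁ x)) ∧
        (∫ x in Ω, φ x * (Complex.I * ω * ρ x) = -∫ x in Ω, dotProduct (grad φ x) (Q₂ x))) := by
    have h2' : LocallyIntegrableOn (fun x => (-1 : ℂ) • Q₂ x) Ω := h₂.smul (-1 : ℂ)
    have hred : WeakChiralMaxwell Ω (smoothTests Ω) ω ε μ β j ρ
        (fun x => -(Complex.I / (2 * ω * ε)) • (Q₁ x + Q₂ x))
        (fun x => (1 / (2 * k)) • (Q₁ x + (-1 : ℂ) • Q₂ x)) ↔ ∀ φ, IsTest Ω φ → _ :=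
      ⟨fun h φ hφ => h φ (grad φ) ⟨hφ, rfl⟩, fun h v g ⟨hv, hg⟩ => by
        simp only at hv hg
        subst hg
        exact h v hv⟩
    rw [hred]
    refine forall₂_congr fun φ hφ => ?_
    have hρε : ∫ x in Ω, φ x * (ρ x / ε) =
        (Complex.I * ω * ε)⁻¹ * ∫ x in Ω, φ x * (Complex.I * ω * ρ x) := by
      rw [← integral_const_mul]
      congr 1 with x
      field_simp
    have l1 : LocallyIntegrableOn (fun x => -a • Q₁ x) Ω := h₁.smul (-a)
    have l2 : LocallyIntegrableOn (fun x => a • j x) Ω := hj.smul a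
    have l3 : LocallyIntegrableOn (fun x => b • Q₂ x) Ω := h₂.smul b
    have l4 : LocallyIntegrableOn (fun x => -b • j x) Ω := hj.smul (-b)
    simp only [hρε, integral_crossProduct_const_smul, integral_smul_const_smul,
      integral_dotProduct_const_smul, hφ.integral_crossProduct_add h₁ h₂,
      hφ.integral_crossProduct_add h₁ h2', hφ.integral_smul_add h₁ h₂,
      hφ.integral_smul_add h₁ h2', hφ.integral_dotProduct_add h₁ h₂,
      hφ.integral_dotProduct_add h₁ h2', hφ.integral_smul_add l1 l2, hφ.integral_smul_add l3 l4]
    generalize (∫ x in Ω, φ x * (Complex.I * ω * ρ x)) = R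
    generalize (∫ x in Ω, dotProduct (grad φ x) (Q₁ x)) = D₁
    generalize (∫ x in Ω, dotProduct (grad φ x) (Q₂ x)) = D₂
    generalize (∫ x in Ω, crossProduct (grad φ x) (Q₁ x)) = X₁
    generalize (∫ x in Ω, crossProduct (grad φ x) (Q₂ x)) = X₂
    generalize (∫ x in Ω, φ x • Q₁ x) = M₁
    generalize (∫ x in Ω, φ x • Q₂ x) = M₂
    generalize (∫ x in Ω, φ x • j x) = J
    rw [← and_assoc]
    refine and_congr ?_ ?_
    -- Component by component, `x` is `-∫ ∇φ × Q`, `m` is `∫ φ Q` and `n` is `∫ φ j`.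
    · simp only [funext_iff (α := Fin 3), ← forall_and]
      refine forall_congr' fun i => ?_
      have := beltrami_iff hω hε hk hk2 hβ₁ hβ₂ ha hb (-X₁ i) (-X₂ i) (M₁ i) (M₂ i) (J i)
      simp only [Pi.neg_apply, Pi.add_apply, Pi.smul_apply, smul_eq_mul]
      rw [eq_comm (b := -X₁ i), eq_comm (b := -X₂ i)]
      refine Iff.trans ?_ (this.trans ?_)
      · refine and_congr ?_ ?_ <;> ring_nf
      · rw [sub_eq_add_neg, neg_mul b]
    -- The equation for `div H` makes the two divergences equal, and the one for `div E` gives their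
    -- common value.
    · have hI : Complex.I ≠ 0 := Complex.I_ne_zero
      constructor
      · rintro ⟨e1, e2⟩
        have f2 : D₁ = D₂ := by
          field_simp at e2
          linear_combination -e2
        subst f2
        field_simp at e1
        have : R = -D₁ := by
          linear_combination (1 / 2) * (-e1) + (D₁ + D₁) * Complex.I_sq / 2
        exact ⟨this, this⟩
      · rintro ⟨e1, e2⟩
        have f2 : D₁ = D₂ := by linear_combination e1 - e2
        subst f2
        refine ⟨?_, by ring⟩
        rw [e1]
        field_simp
        linear_combination (2 * D₁) * Complex.I_sq
  rw [hsplit]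
  constructor
  · intro h
    exact ⟨⟨h₁, (h₁.smul (-a)).add (hj.smul a), fun φ hφ => (h φ hφ).1.1⟩,
      ⟨h₂, (h₂.smul b).add (hj.smul (-b)), fun φ hφ => (h φ hφ).1.2⟩,
      ⟨h₁, hρ, fun φ hφ => (h φ hφ).2.1⟩, ⟨h₂, hρ, fun φ hφ => (h φ hφ).2.2⟩⟩
  · rintro ⟨c1, c2, d1, d2⟩ φ hφ
    exact ⟨⟨c1.2.2 φ hφ, c2.2.2 φ hφ⟩, d1.2.2 φ hφ, d2.2.2 φ hφ⟩

lemma WeakChiralMaxwell.congr_ae {Ω : Set E3} {T : Set ((E3 → ℂ) × (E3 → C3))} {ω ε μ β : ℂ}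
    {j : E3 → C3} {ρ : E3 → ℂ} {E H E' H' : E3 → C3} (h : WeakChiralMaxwell Ω T ω ε μ β j ρ E H)
    (hE : E =ᵐ[volume.restrict Ω] E') (hH : H =ᵐ[volume.restrict Ω] H') :
    WeakChiralMaxwell Ω T ω ε μ β j ρ E' H' := by
  intro v g hvg
  have c : ∀ {F F' : E3 → C3}, F =ᵐ[volume.restrict Ω] F' →
      (∫ x in Ω, crossProduct (g x) (F x) = ∫ x in Ω, crossProduct (g x) (F' x)) ∧
      (∫ x in Ω, v x • F x = ∫ x in Ω, v x • F' x) ∧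
      (∫ x in Ω, dotProduct (g x) (F x) = ∫ x in Ω, dotProduct (g x) (F' x)) := fun hF =>
    ⟨integral_congr_ae (hF.mono fun x hx => by simp only [hx]),
      integral_congr_ae (hF.mono fun x hx => by simp only [hx]),
      integral_congr_ae (hF.mono fun x hx => by simp only [hx])⟩
  have := h v g hvg
  rwa [(c hE).1, (c hE).2.1, (c hE).2.2, (c hH).1, (c hH).2.1, (c hH).2.2] at this

/-- In `Q - V` the source `κ j` and the divergence `d` cancel, which leaves a weak force-free field.
-/
lemma exists_forceFree_of_beltrami {Ω : Set E3} (hΩ : IsOpen Ω) {κ : ℂ} {j Q V : E3 → C3}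
    {d : E3 → ℂ} (hQ : IsWeakCurl Ω Q fun x => -κ • Q x + κ • j x)
    (hV : IsWeakCurl Ω V fun x => -κ • V x + κ • j x) (hQd : IsWeakDiv Ω Q d)
    (hVd : IsWeakDiv Ω V d) :
    ∃ u, IsForceFree Ω κ u ∧ ∀ᵐ x ∂(volume.restrict Ω), Q x = V x + u x := by
  have hc := hQ.add (hV.const_smul (-1))
  have hd := hQd.add (hVd.const_smul (-1))
  obtain ⟨u, hu, he⟩ := exists_isForceFree_ae_eq hΩ (κ := κ)
    (U := fun x => Q x + (-1 : ℂ) • V x)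
    (hc.congr_ae EventuallyEq.rfl (Eventually.of_forall fun x => by
      ext i; simp only [Pi.add_apply, Pi.smul_apply, smul_eq_mul]; ring))
    (hd.congr_ae EventuallyEq.rfl (Eventually.of_forall fun x => by simp))
  refine ⟨u, hu, he.mono fun x hx => ?_⟩
  rw [hx]
  ext i
  simp

lemma beltrami_add_forceFree {Ω : Set E3} (hΩ : IsOpen Ω) {κ : ℂ} {j V u : E3 → C3}
    {d : E3 → ℂ} (hV : IsWeakCurl Ω V fun x => -κ • V x + κ • j x) (hVd : IsWeakDiv Ω V d)
    (hu : IsForceFree Ω κ u) :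
    (IsWeakCurl Ω (fun x => V x + u x) fun x => -κ • (V x + u x) + κ • j x) ∧
      IsWeakDiv Ω (fun x => V x + u x) d := by
  refine ⟨(hV.add (hu.isWeakCurl hΩ)).congr_ae EventuallyEq.rfl (Eventually.of_forall fun x => ?_),
    (hVd.add (hu.isWeakDiv hΩ)).congr_ae EventuallyEq.rfl (Eventually.of_forall fun x => ?_)⟩
  · ext i; simp only [Pi.add_apply, Pi.smul_apply, smul_eq_mul]; ring
  · simp

/-- The general solution in the sense of distributions, relative to given solutions of the two
Beltrami equations. -/
lemma isLocalWeakSolution_iff_of_beltrami {Ω : Set E3} (hΩ : IsOpen Ω) {ω ε μ β k a b rε rμ : ℂ}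
    (hω : ω ≠ 0) (hrε0 : rε ≠ 0) (hrμ0 : rμ ≠ 0) (hrε : rε ^ 2 = ε) (hrμ : rμ ^ 2 = μ)
    (hk : k = ω * (rε * rμ)) (hβ₁ : 1 + k * β ≠ 0) (hβ₂ : 1 - k * β ≠ 0)
    (ha : a = k / (1 + k * β)) (hb : b = k / (1 - k * β)) {j V₁ V₂ : E3 → C3} {ρ : E3 → ℂ}
    (hj : LocallyIntegrableOn j Ω) (hρ : LocallyIntegrableOn (fun x => Complex.I * ω * ρ x) Ω)
    (h₁ : IsWeakCurl Ω V₁ fun x => -a • V₁ x + a • j x)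
    (h₂ : IsWeakCurl Ω V₂ fun x => -(-b) • V₂ x + -b • j x)
    (h₁' : IsWeakDiv Ω V₁ fun x => Complex.I * ω * ρ x)
    (h₂' : IsWeakDiv Ω V₂ fun x => Complex.I * ω * ρ x) (E H : E3 → C3) :
    IsLocalWeakSolution Ω ω ε μ β j ρ E H ↔ ∃ u₁ u₂ : E3 → C3,
      IsForceFree Ω a u₁ ∧ IsForceFree Ω (-b) u₂ ∧
      (∀ᵐ x ∂(volume.restrict Ω), E x = -(Complex.I / (2 * ω * ε)) • (V₁ x + V₂ x) -
        rμ • (u₁ x + u₂ x)) ∧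
      ∀ᵐ x ∂(volume.restrict Ω), H x = (1 / (2 * k)) • (V₁ x - V₂ x) +
        (rε / Complex.I) • (u₁ x - u₂ x) := by
  have hε : ε ≠ 0 := hrε ▸ pow_ne_zero 2 hrε0
  have hk0 : k ≠ 0 := hk ▸ mul_ne_zero hω (mul_ne_zero hrε0 hrμ0)
  have hI : Complex.I ≠ 0 := Complex.I_ne_zero
  have hk2 : k ^ 2 = ω ^ 2 * ε * μ := by rw [hk, ← hrε, ← hrμ]; ring
  set A : ℂ := -(Complex.I / (2 * ω * ε)) with hA
  have hA0 : A ≠ 0 := neg_ne_zero.2 (div_ne_zero hI (mul_ne_zero (mul_ne_zero two_ne_zero hω) hε))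
  set B : ℂ := 1 / (2 * k) with hB
  have hB0 : B ≠ 0 := one_div_ne_zero (mul_ne_zero two_ne_zero hk0)
  -- One rescaling of the force-free fields, by `-A / rμ`, turns `A (u₁ + u₂)` into `-rμ (u₁ + u₂)`
  -- and at the same time `B (u₁ - u₂)` into `(rε / i)(u₁ - u₂)`.
  have hAB : rε / Complex.I * (-(A / rμ)) = B := by
    rw [hA, hB, hk, ← hrε]
    field_simp
  have key := fun {Q₁ Q₂ : E3 → C3} => weakChiralMaxwell_iff (Q₁ := Q₁) (Q₂ := Q₂) hω hε hk0 hk2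
    hβ₁ hβ₂ ha hb hj hρ
  simp only [← hA, ← hB] at key
  constructor
  · rintro ⟨hE, hH, h⟩
    -- The inverse of the substitution `E = A (Q₁ + Q₂)`, `H = B (Q₁ - Q₂)`.
    set Q₁ : E3 → C3 := fun x => (2 * A)⁻¹ • E x + (2 * B)⁻¹ • H x with hQ₁
    set Q₂ : E3 → C3 := fun x => (2 * A)⁻¹ • E x + -(2 * B)⁻¹ • H x with hQ₂
    have eE : E = fun x => A • (Q₁ x + Q₂ x) := by
      funext x; ext i
      simp only [hQ₁, hQ₂, Pi.add_apply, Pi.smul_apply, smul_eq_mul]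
      field_simp
      ring
    have eH : H = fun x => B • (Q₁ x + (-1 : ℂ) • Q₂ x) := by
      funext x; ext i
      simp only [hQ₁, hQ₂, Pi.add_apply, Pi.smul_apply, smul_eq_mul]
      field_simp
      ring
    have l1 : LocallyIntegrableOn Q₁ Ω := (hE.smul (2 * A)⁻¹).add (hH.smul (2 * B)⁻¹)
    have l2 : LocallyIntegrableOn Q₂ Ω := (hE.smul (2 * A)⁻¹).add (hH.smul (-(2 * B)⁻¹))
    obtain ⟨c1, c2, d1, d2⟩ := (key l1 l2).1 (by rw [← eE, ← eH]; exact h)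
    obtain ⟨u₁, hu₁, e1⟩ := exists_forceFree_of_beltrami hΩ c1 h₁ d1 h₁'
    obtain ⟨u₂, hu₂, e2⟩ := exists_forceFree_of_beltrami hΩ (by simpa only [neg_neg] using c2) h₂
      d2 h₂'
    refine ⟨fun x => (-(A / rμ)) • u₁ x, fun x => (-(A / rμ)) • u₂ x, hu₁.const_smul hΩ _,
      hu₂.const_smul hΩ _, ?_, ?_⟩
    · filter_upwards [e1, e2] with x hx1 hx2
      have := congrFun eE x
      simp only [hx1, hx2] at this
      rw [this]
      ext i
      simp only [Pi.add_apply, Pi.sub_apply, Pi.smul_apply, smul_eq_mul]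
      field_simp
      ring
    · filter_upwards [e1, e2] with x hx1 hx2
      have := congrFun eH x
      simp only [hx1, hx2] at this
      rw [this, ← smul_sub, smul_smul, hAB]
      ext i
      simp only [Pi.add_apply, Pi.sub_apply, Pi.smul_apply, smul_eq_mul]
      ring
  · rintro ⟨u₁, u₂, hu₁, hu₂, hE, hH⟩
    obtain ⟨c1, d1⟩ := beltrami_add_forceFree hΩ h₁ h₁' (hu₁.const_smul hΩ (-(rμ / A)))
    obtain ⟨c2, d2⟩ := beltrami_add_forceFree hΩ h₂ h₂' (hu₂.const_smul hΩ (-(rμ / A)))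
    have h := (key c1.1 c2.1).2 ⟨c1, by simpa only [neg_neg] using c2, d1, d2⟩
    have hBr : B * (rμ / A) = -(rε / Complex.I) := by
      rw [← hAB]
      field_simp
    have eE : (fun x => A • ((V₁ x + -(rμ / A) • u₁ x) + (V₂ x + -(rμ / A) • u₂ x)))
        =ᵐ[volume.restrict Ω] E := hE.mono fun x hx => by
      simp only
      rw [hx]
      ext i
      simp only [Pi.add_apply, Pi.sub_apply, Pi.smul_apply, smul_eq_mul]
      field_simp
      ring
    have eH : (fun x => B • ((V₁ x + -(rμ / A) • u₁ x) + (-1 : ℂ) • (V₂ x + -(rμ / A) • u₂ x)))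
        =ᵐ[volume.restrict Ω] H := hH.mono fun x hx => by
      simp only
      rw [hx]
      ext i
      simp only [Pi.add_apply, Pi.sub_apply, Pi.smul_apply, smul_eq_mul]
      linear_combination (u₂ x i - u₁ x i) * hBr
    exact ⟨locallyIntegrableOn_congr_ae ((c1.1.add c2.1).smul A) eE,
      locallyIntegrableOn_congr_ae ((c1.1.add (c2.1.smul (-1 : ℂ))).smul B) eH, h.congr_ae eE eH⟩

/-! ### Density of smooth test functions -/

section density

variable {Ω : Set E3} {p q : ENNReal} [ENNReal.HolderConjugate q p]

lemma eLpNorm_eval_tendsto {a : ℕ → E3 → C3} {a' : E3 → C3} {ν : Measure E3}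
    (h : Tendsto (fun n => eLpNorm (a n - a') q ν) atTop (𝓝 0)) (i : Fin 3) :
    Tendsto (fun n => eLpNorm ((fun x => a n x i) - fun x => a' x i) q ν) atTop (𝓝 0) :=
  tendsto_of_tendsto_of_tendsto_of_le_of_le tendsto_const_nhds h (fun _ => zero_le)
    fun n => eLpNorm_mono fun x => norm_le_pi_norm ((a n - a') x) i

lemma tendsto_pair_of_eLpNorm {a : ℕ → E3 → ℂ} {a' f : E3 → ℂ}
    (ha : ∀ n, MemLp (a n) q (volume.restrict Ω)) (ha' : MemLp a' q (volume.restrict Ω))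
    (hf : MemLp f p (volume.restrict Ω))
    (h : Tendsto (fun n => eLpNorm (a n - a') q (volume.restrict Ω)) atTop (𝓝 0)) :
    Tendsto (fun n => pair Ω (a n) f) atTop (𝓝 (pair Ω a' f)) :=
  tendsto_integral_mul_of_eLpNorm ha ha' hf h

lemma tendsto_integral_smul_of_eLpNorm {a : ℕ → E3 → ℂ} {a' : E3 → ℂ} {F : E3 → C3}
    (ha : ∀ n, MemLp (a n) q (volume.restrict Ω)) (ha' : MemLp a' q (volume.restrict Ω))
    (hF : MemLp F p (volume.restrict Ω))
    (h : Tendsto (fun n => eLpNorm (a n - a') q (volume.restrict Ω)) atTop (𝓝 0)) :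
    Tendsto (fun n => ∫ x in Ω, a n x • F x) atTop (𝓝 (∫ x in Ω, a' x • F x)) := by
  refine tendsto_pi_nhds.2 fun i => ?_
  have hi : ∀ {b : E3 → ℂ}, MemLp b q (volume.restrict Ω) → ∀ i,
      IntegrableOn (fun x => b x * F x i) Ω := fun hb i => integrable_mul_of_memLp hb (hF.eval i)
  simp only [integral_smul_apply (hi (ha _)), integral_smul_apply (hi ha')]
  exact tendsto_pair_of_eLpNorm ha ha' (hF.eval i) h

lemma tendsto_integral_crossProduct_of_eLpNorm {a : ℕ → E3 → C3} {a' F : E3 → C3}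
    (ha : ∀ n, MemLp (a n) q (volume.restrict Ω)) (ha' : MemLp a' q (volume.restrict Ω))
    (hF : MemLp F p (volume.restrict Ω))
    (h : Tendsto (fun n => eLpNorm (a n - a') q (volume.restrict Ω)) atTop (𝓝 0)) :
    Tendsto (fun n => ∫ x in Ω, crossProduct (a n x) (F x)) atTop
      (𝓝 (∫ x in Ω, crossProduct (a' x) (F x))) := by
  have hi : ∀ {b : E3 → C3}, MemLp b q (volume.restrict Ω) → ∀ i j,
      IntegrableOn (fun x => b x i * F x j) Ω := fun hb i j =>
    integrable_mul_of_memLp (hb.eval i) (hF.eval j)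
  have ht := fun i j => tendsto_pair_of_eLpNorm (fun n => (ha n).eval i) (ha'.eval i) (hF.eval j)
    (eLpNorm_eval_tendsto h i)
  simp only [integral_crossProduct (hi (ha _)), integral_crossProduct (hi ha')]
  refine tendsto_pi_nhds.2 fun i => ?_
  fin_cases i
  exacts [(ht 1 2).sub (ht 2 1), (ht 2 0).sub (ht 0 2), (ht 0 1).sub (ht 1 0)]

lemma tendsto_integral_dotProduct_of_eLpNorm {a : ℕ → E3 → C3} {a' F : E3 → C3}
    (ha : ∀ n, MemLp (a n) q (volume.restrict Ω)) (ha' : MemLp a' q (volume.restrict Ω))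
    (hF : MemLp F p (volume.restrict Ω))
    (h : Tendsto (fun n => eLpNorm (a n - a') q (volume.restrict Ω)) atTop (𝓝 0)) :
    Tendsto (fun n => ∫ x in Ω, dotProduct (a n x) (F x)) atTop
      (𝓝 (∫ x in Ω, dotProduct (a' x) (F x))) := by
  have hi : ∀ {b : E3 → C3}, MemLp b q (volume.restrict Ω) → ∀ i,
      IntegrableOn (fun x => b x i * F x i) Ω := fun hb i =>
    integrable_mul_of_memLp (hb.eval i) (hF.eval i)
  simp only [integral_dotProduct (hi (ha _)), integral_dotProduct (hi ha')]
  exact tendsto_finsetSum _ fun i _ => tendsto_pair_of_eLpNorm (fun n => (ha n).eval i)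
    (ha'.eval i) (hF.eval i) (eLpNorm_eval_tendsto h i)

end density

lemma IsTest.memLp_grad {Ω : Set E3} {φ : E3 → ℂ} (hφ : IsTest Ω φ) (q : ENNReal)
    (ν : Measure E3) [IsFiniteMeasureOnCompacts ν] : MemLp (grad φ) q ν :=
  MemLp.of_eval fun i => (hφ.pd i).memLp q ν

lemma smoothTests_subset_sobolevTests (Ω : Set E3) (q : ℝ) :
    smoothTests Ω ⊆ sobolevTests Ω q := by
  rintro ⟨v, g⟩ ⟨hv, hg⟩
  simp only at hv hg
  subst hg
  exact ⟨hv.memLp _ _, hv.memLp_grad _ _, fun _ => v, fun _ => hv, by simp, by simp⟩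

/-- For fields of class `L^p`, testing against smooth functions or against `W_0^{1,q}` is the
same. -/
lemma weakChiralMaxwell_sobolevTests_iff {Ω : Set E3} {p : ℝ} (hp : 1 < p) {ω ε μ β : ℂ}
    {j : E3 → C3} {ρ : E3 → ℂ} {E H : E3 → C3} (hj : MemLpOn Ω p j) (hρ : MemLpOn Ω p ρ)
    (hE : MemLpOn Ω p E) (hH : MemLpOn Ω p H) :
    WeakChiralMaxwell Ω (sobolevTests Ω (p / (p - 1))) ω ε μ β j ρ E H ↔
      WeakChiralMaxwell Ω (smoothTests Ω) ω ε μ β j ρ E H := by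
  refine ⟨fun h v g hvg => h v g (smoothTests_subset_sobolevTests _ _ hvg), fun h v g hvg => ?_⟩
  obtain ⟨hv, hg, φ, hφ, hφv, hφg⟩ := hvg
  have := (Real.HolderConjugate.conjExponent hp).symm.ennrealOfReal
  set q := ENNReal.ofReal (p / (p - 1))
  have hpq : ENNReal.HolderConjugate q (ENNReal.ofReal p) := this
  have mφ : ∀ n, MemLp (φ n) q (volume.restrict Ω) := fun n => (hφ n).memLp _ _
  have mg : ∀ n, MemLp (grad (φ n)) q (volume.restrict Ω) := fun n => (hφ n).memLp_grad _ _
  have hρε : MemLp (fun x => ρ x / ε) (ENNReal.ofReal p) (volume.restrict Ω) := by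
    simpa only [div_eq_inv_mul] using hρ.const_mul ε⁻¹
  have xE := (tendsto_integral_crossProduct_of_eLpNorm mg hg hE hφg).neg
  have xH := (tendsto_integral_crossProduct_of_eLpNorm mg hg hH hφg).neg
  have sE := tendsto_integral_smul_of_eLpNorm mφ hv hE hφv
  have sH := tendsto_integral_smul_of_eLpNorm mφ hv hH hφv
  have sj := tendsto_integral_smul_of_eLpNorm mφ hv hj hφv
  have dE := (tendsto_integral_dotProduct_of_eLpNorm mg hg hE hφg).neg
  have dH := (tendsto_integral_dotProduct_of_eLpNorm mg hg hH hφg).neg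
  have rρ := tendsto_pair_of_eLpNorm mφ hv hρε hφv
  have hn := fun n => h (φ n) (grad (φ n)) ⟨hφ n, rfl⟩
  -- For `L^p` fields both sides of each equation are continuous in the test function and its
  -- gradient in `L^q`, so the identities pass to the limit.
  refine ⟨tendsto_nhds_unique xE ?_, tendsto_nhds_unique xH ?_, tendsto_nhds_unique dE ?_,
    tendsto_nhds_unique dH ?_⟩
  · exact ((sH.add (xH.const_smul β)).const_smul _).congr fun n => (hn n).1.symm
  · exact (((sE.add (xE.const_smul β)).const_smul _).add sj).congr fun n => (hn n).2.1.symm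
  · exact rρ.congr fun n => (hn n).2.2.1.symm
  · exact tendsto_const_nhds.congr fun n => (hn n).2.2.2.symm

/-! ### Particular solutions and the main theorem -/

/-- The combinations `curl curl W + j ∓ α curl W` of a Newton potential solve Beltrami equations. -/
lemma beltrami_of_weak_curl {Ω : Set E3} (hΩ : IsOpen Ω) (s : ℂ) {W j C K : E3 → C3} {d : E3 → ℂ}
    (hj : IsWeakDiv Ω j d) (hW : IsWeakCurl Ω W C) (hC : IsWeakCurl Ω C K)
    (hK : IsWeakCurl Ω (fun x => K x + j x) fun x => s ^ 2 • C x) :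
    IsWeakCurl Ω (fun x => K x + j x + -s • C x)
        (fun x => -s • (K x + j x + -s • C x) + s • j x) ∧
      IsWeakDiv Ω (fun x => K x + j x + -s • C x) d := by
  refine ⟨(hK.add (hC.const_smul (-s))).congr_ae EventuallyEq.rfl
      (Eventually.of_forall fun x => ?_),
    (((hC.isWeakDiv_zero hΩ).add hj).add ((hW.isWeakDiv_zero hΩ).const_smul (-s))).congr_ae
      EventuallyEq.rfl (Eventually.of_forall fun x => ?_)⟩
  -- Here `s² C - s K = -s (K + j - s C) + s j`.
  · ext i; simp only [Pi.add_apply, Pi.smul_apply, smul_eq_mul]; ring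
  · simp

end ChiralMaxwell

end

open ChiralMaxwell

theorem mainTheorem5 (Ω : Set E3) (hΩ : IsBoundedLiapunovDomain Ω)
    (p : ℝ) (hp : 1 < p)
    (ω ε μ β : ℂ) (hω : ω ≠ 0) (hε : ε ≠ 0) (hμ : μ ≠ 0)
    (rε rμ : ℂ) (hrε : rε ^ 2 = ε) (hrμ : rμ ^ 2 = μ)
    (k : ℂ) (hk : k = ω * (rε * rμ))
    (hβ₁ : 1 + k * β ≠ 0) (hβ₂ : 1 - k * β ≠ 0)
    (α₁ α₂ : ℂ) (hα₁ : α₁ = k / (1 + k * β)) (hα₂ : α₂ = k / (1 - k * β))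
    (j : E3 → C3) (hj : MemWDiv Ω p j)
    (ρ : E3 → ℂ) (hρ : IsWeakDiv Ω j (fun x => Complex.I * ω * ρ x)) :
    ∃ C₁ K₁ C₂ K₂ : E3 → C3,
      (MemLpOn Ω p C₁ ∧ IsWeakCurl Ω (newton Ω α₁ j) C₁) ∧
      (MemLpOn Ω p K₁ ∧ IsWeakCurl Ω C₁ K₁) ∧
      (MemLpOn Ω p C₂ ∧ IsWeakCurl Ω (newton Ω α₂ j) C₂) ∧
      (MemLpOn Ω p K₂ ∧ IsWeakCurl Ω C₂ K₂) ∧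
      (∀ E H : E3 → C3,
        IsLpWeakSolution Ω p ω ε μ β j ρ E H ↔
          ∃ u₁ u₂ : E3 → C3,
            IsForceFree Ω α₁ u₁ ∧ MemLpOn Ω p u₁ ∧
            IsForceFree Ω (-α₂) u₂ ∧ MemLpOn Ω p u₂ ∧
            IsGivenBy Ω ω ε rε rμ k α₁ α₂ j C₁ K₁ C₂ K₂ u₁ u₂ E H) ∧
      (∀ E H : E3 → C3,
        IsLocalWeakSolution Ω ω ε μ β j ρ E H ↔
          ∃ u₁ u₂ : E3 → C3,
            IsForceFree Ω α₁ u₁ ∧ IsForceFree Ω (-α₂) u₂ ∧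
            IsGivenBy Ω ω ε rε rμ k α₁ α₂ j C₁ K₁ C₂ K₂ u₁ u₂ E H) := by
  obtain ⟨hΩo, -, hb, -⟩ := hΩ
  obtain ⟨hjp, d, hdp, hd⟩ := hj
  have hrε0 : rε ≠ 0 := fun h => hε (by rw [← hrε, h]; ring)
  have hrμ0 : rμ ≠ 0 := fun h => hμ (by rw [← hrμ, h]; ring)
  have hI : Complex.I ≠ 0 := Complex.I_ne_zero
  have hρp : MemLpOn Ω p ρ := by
    have h1 : MemLpOn Ω p fun x => (Complex.I * ω)⁻¹ * d x := hdp.const_mul _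
    refine h1.ae_eq ((hd.unique hΩo hρ).mono fun x hx => ?_)
    rw [hx]
    field_simp
  obtain ⟨C₁, K₁, hC₁, hWC₁, hK₁, hCK₁, hS₁⟩ := exists_weak_curl_newton hΩo hb α₁ hp hjp
  obtain ⟨C₂, K₂, hC₂, hWC₂, hK₂, hCK₂, hS₂⟩ := exists_weak_curl_newton hΩo hb α₂ hp hjp
  obtain ⟨b₁, d₁⟩ := beltrami_of_weak_curl hΩo α₁ hρ hWC₁ hCK₁ hS₁
  -- The potential for `α₂` serves the Beltrami parameter `-α₂`, because only the square enters the
  -- Helmholtz equation.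
  obtain ⟨b₂, d₂⟩ := beltrami_of_weak_curl hΩo (-α₂) hρ hWC₂ hCK₂ (by simpa only [neg_sq] using hS₂)
  have hloc : ∀ E H : E3 → C3, IsLocalWeakSolution Ω ω ε μ β j ρ E H ↔ ∃ u₁ u₂ : E3 → C3,
      IsForceFree Ω α₁ u₁ ∧ IsForceFree Ω (-α₂) u₂ ∧
        IsGivenBy Ω ω ε rε rμ k α₁ α₂ j C₁ K₁ C₂ K₂ u₁ u₂ E H := by
    intro E H
    rw [isLocalWeakSolution_iff_of_beltrami hΩo hω hrε0 hrμ0 hrε hrμ hk hβ₁ hβ₂ hα₁ hα₂ hρ.1 hρ.2.1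
      b₁ b₂ d₁ d₂]
    refine exists₂_congr fun u₁ u₂ => and_congr_right fun _ => and_congr_right fun _ =>
      and_congr (eventually_congr (Eventually.of_forall fun x => ?_))
        (eventually_congr (Eventually.of_forall fun x => ?_))
    · have : K₁ x + j x + -α₁ • C₁ x + (K₂ x + j x + -(-α₂) • C₂ x) =
          (2 : ℂ) • j x - α₁ • C₁ x + α₂ • C₂ x + (K₁ x + K₂ x) := by
        ext i; simp only [Pi.add_apply, Pi.sub_apply, Pi.smul_apply, smul_eq_mul]; ring
      rw [this]
    · have : (1 / (2 * k)) • (K₁ x + j x + -α₁ • C₁ x - (K₂ x + j x + -(-α₂) • C₂ x)) =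
          -(1 / (2 * k)) • (α₁ • C₁ x + α₂ • C₂ x - (K₁ x - K₂ x)) := by
        ext i; simp only [Pi.add_apply, Pi.sub_apply, Pi.smul_apply, smul_eq_mul]; ring
      rw [this]
  refine ⟨C₁, K₁, C₂, K₂, ⟨hC₁, hWC₁⟩, ⟨hK₁, hCK₁⟩, ⟨hC₂, hWC₂⟩, ⟨hK₂, hCK₂⟩, fun E H => ?_, hloc⟩
  have hXp : MemLpOn Ω p fun x => -(Complex.I / (2 * ω * ε)) •
      ((2 : ℂ) • j x - α₁ • C₁ x + α₂ • C₂ x + (K₁ x + K₂ x)) :=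
    ((((hjp.const_smul (2 : ℂ)).sub (hC₁.const_smul α₁)).add (hC₂.const_smul α₂)).add
      (hK₁.add hK₂)).const_smul (-(Complex.I / (2 * ω * ε)))
  have hYp : MemLpOn Ω p fun x => -(1 / (2 * k)) •
      (α₁ • C₁ x + α₂ • C₂ x - (K₁ x - K₂ x)) :=
    (((hC₁.const_smul α₁).add (hC₂.const_smul α₂)).sub (hK₁.sub hK₂)).const_smul (-(1 / (2 * k)))
  constructor
  · rintro ⟨hE, hH, h⟩
    obtain ⟨u₁, u₂, hu₁, hu₂, hg⟩ := (hloc E H).1 ⟨hE.locallyIntegrableOn hb hp,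
      hH.locallyIntegrableOn hb hp, (weakChiralMaxwell_sobolevTests_iff hp hjp hρp hE hH).1 h⟩
    -- These combinations equal `(u₁ + u₂)/2` and `(u₁ - u₂)/2` almost everywhere; their sum and
    -- difference put `u₁` and `u₂` in `L^p`.
    have hE₀ := (hE.sub hXp).const_smul (-(2 * rμ)⁻¹)
    have hH₀ := (hH.sub hYp).const_smul (Complex.I / (2 * rε))
    refine ⟨u₁, u₂, hu₁, ?_, hu₂, ?_, hg⟩
    · refine (hE₀.add hH₀).ae_eq ?_
      filter_upwards [hg.1, hg.2] with x h1 h2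
      simp only [Pi.add_apply, Pi.sub_apply, Pi.smul_apply]
      rw [h1, h2]
      ext i
      simp only [Pi.add_apply, Pi.sub_apply, Pi.smul_apply, smul_eq_mul]
      field_simp
      ring
    · refine (hE₀.sub hH₀).ae_eq ?_
      filter_upwards [hg.1, hg.2] with x h1 h2
      simp only [Pi.sub_apply, Pi.smul_apply]
      rw [h1, h2]
      ext i
      simp only [Pi.add_apply, Pi.sub_apply, Pi.smul_apply, smul_eq_mul]
      field_simp
      ring
  · rintro ⟨u₁, u₂, hu₁, hu₁p, hu₂, hu₂p, hg⟩
    have hE : MemLpOn Ω p E :=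
      (hXp.sub ((hu₁p.add hu₂p).const_smul rμ)).ae_eq (hg.1.mono fun x hx => hx.symm)
    have hH : MemLpOn Ω p H :=
      (hYp.add ((hu₁p.sub hu₂p).const_smul (rε / Complex.I))).ae_eq (hg.2.mono fun x hx => hx.symm)
    exact ⟨hE, hH, (weakChiralMaxwell_sobolevTests_iff hp hjp hρp hE hH).2
      ((hloc E H).2 ⟨u₁, u₂, hu₁, hu₂, hg⟩).2.2⟩
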